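/- For a finite multiset $Y\subset\mathbb{R}^d$ and a nonempty finite set $C\subset\mathbb{R}^d$ let $\mathrm{cost}_p(Y,C)$ be the sum of the $p$ largest of the Euclidean distances $d(y,C)=\min_{c\in C}\|y-c\|_2$, $y\in Y$ (counted with multiplicity). An $\varepsilon$-coreset of an $n$-point set $X\subset\mathbb{R}^d$ for $k$-facility $p$-centrum is a multiset $D$ of $n$ points of $\mathbb{R}^d$ (counted with multiplicity), equivalently a finite set with positive integer weights of total weight $n$, such that $$(1-\varepsilon)\,\mathrm{cost}_p(X,C)\le \mathrm{cost}_p(D,C)\le(1+\varepsilon)\,\mathrm{cost}_p(X,C)\qquad\text{for all } C\subset\mathbb{R}^d \text{ with } |C|=k;$$ its size is its number of distinct points. Theorem. For all $d$, $k\ge 1$, $\varepsilon\in(0,1)$, every $n$-point set $X\subset\mathbb{R}^d$ and every $p\in\{1,\dots,n\}$, there is an $\varepsilon$-coreset $D$ of $X$ for $k$-facility $p$-centrum of size $O(k^2/\varepsilon^{d+1})$, where the implied constant depends only on $d$ and is at most $c^{d+1}$ for an absolute constant $c$. Moreover, $D$ can be computed in polynomial time: there is a single deterministic real-RAM algorithm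 (unit-cost real arithmetic, square roots and comparisons, no rounding; unit-cost addition, subtraction and comparison of integers and indirect addressing; no constants other than integers) that, given $n,d,k,p,\varepsilon$ and the coordinates of the points of $X$, outputs the distinct points of such a $D$ and their multiplicities after a number of steps that is bounded by a fixed polynomial in $n+d$. -/

import Mathlib

noncomputable section

namespace PCentrum

/-! ### The clustering objective and coresets -/

/-- Points of `ℝ^d`, with the Euclidean distance. -/
abbrev Point (d : ℕ) : Type := EuclideanSpace ℝ (Fin d)

/-- The sum of the `p` largest elements, with multiplicity, of a finite multiset of reals. -/
def topSum (p : ℕ) (M : Multiset ℝ) : ℝ :=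
  ((M.sort (· ≥ ·)).take p).sum

/-- The `p`-centrum objective: the sum of the `p` largest distances of points of the multiset `X`
to the nearest center in `C` (for nonempty finite `C` the infimum distance is the minimum). -/
def cost {d : ℕ} (p : ℕ) (X : Multiset (Point d)) (C : Finset (Point d)) : ℝ :=
  topSum p (X.map fun x => Metric.infDist x (C : Set (Point d)))

/-- The multiset `D` is an `ε`-coreset of `X` for `k`-facility `p`-centrum. As the objective is an
ordered weighted sum with `|X|` weights, `D` is required to have `|X|` elements, counted with
multiplicity. -/
def IsCoreset {d : ℕ} (k p : ℕ) (ε : ℝ) (X : Finset (Point d)) (D : Multiset (Point d)) : Prop :=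
  D.card = X.card ∧
    ∀ C : Finset (Point d), C.card = k →
      (1 - ε) * cost p X.val C ≤ cost p D C ∧ cost p D C ≤ (1 + ε) * cost p X.val C

open Classical in
/-- The size of a coreset: its number of distinct points. -/
def coresetSize {d : ℕ} (D : Multiset (Point d)) : ℕ := D.toFinset.card

/-! ### A real RAM

Structured programs over a memory that consists of arrays of natural numbers and arrays of real
numbers; a program refers to arrays by fixed names (numerals) and to their cells by computed
indices. Every operation, memory access, test and assignment costs one step. Natural numbers can
only be added, subtracted and compared, real numbers can be added, subtracted, multiplied, divided,
compared, and their square roots can be taken. There is no way from reals to naturals other than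
comparisons (in particular no rounding), and the only constants are natural numbers. -/

/-- Contents of the memory: `nat a i` is the `i`-th cell of the `a`-th array of naturals, and
`real a i` is the `i`-th cell of the `a`-th array of reals. -/
@[ext] structure Memory where
  nat : ℕ → ℕ → ℕ
  real : ℕ → ℕ → ℝ

/-- Expressions with values in the natural numbers. -/
inductive NatExpr : Type
  | const (c : ℕ)
  | read (a : ℕ) (i : NatExpr)
  | add (e f : NatExpr)
  | sub (e f : NatExpr)

/-- Expressions with values in the real numbers. -/
inductive RealExpr : Type
  | ofNat (e : NatExpr)
  | read (a : ℕ) (i : NatExpr)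
  | add (e f : RealExpr)
  | sub (e f : RealExpr)
  | mul (e f : RealExpr)
  | div (e f : RealExpr)
  | sqrt (e : RealExpr)

/-- Tests. -/
inductive Test : Type
  | natLe (e f : NatExpr)
  | realLe (e f : RealExpr)
  | not (b : Test)
  | and (b c : Test)

/-- Programs. -/
inductive Prog : Type
  | skip
  | setNat (a : ℕ) (i e : NatExpr)
  | setReal (a : ℕ) (i : NatExpr) (e : RealExpr)
  | seq (P Q : Prog)
  | ite (b : Test) (P Q : Prog)
  | loop (b : Test) (P : Prog)

/-- Value of an expression (subtraction of naturals is truncated). -/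
def NatExpr.eval (s : Memory) : NatExpr → ℕ
  | .const c => c
  | .read a i => s.nat a (i.eval s)
  | .add e f => e.eval s + f.eval s
  | .sub e f => e.eval s - f.eval s

/-- Number of steps that the evaluation of an expression takes. -/
def NatExpr.steps : NatExpr → ℕ
  | .const _ => 1
  | .read _ i => i.steps + 1
  | .add e f => e.steps + f.steps + 1
  | .sub e f => e.steps + f.steps + 1

/-- Value of an expression. -/
def RealExpr.eval (s : Memory) : RealExpr → ℝ
  | .ofNat e => (e.eval s : ℝ)
  | .read a i => s.real a (i.eval s)
  | .add e f => e.eval s + f.eval s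
  | .sub e f => e.eval s - f.eval s
  | .mul e f => e.eval s * f.eval s
  | .div e f => e.eval s / f.eval s
  | .sqrt e => Real.sqrt (e.eval s)

/-- Number of steps that the evaluation of an expression takes. -/
def RealExpr.steps : RealExpr → ℕ
  | .ofNat e => e.steps + 1
  | .read _ i => i.steps + 1
  | .add e f => e.steps + f.steps + 1
  | .sub e f => e.steps + f.steps + 1
  | .mul e f => e.steps + f.steps + 1
  | .div e f => e.steps + f.steps + 1
  | .sqrt e => e.steps + 1

/-- Truth of a test. -/
def Test.Holds (s : Memory) : Test → Prop
  | .natLe e f => e.eval s ≤ f.eval s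
  | .realLe e f => e.eval s ≤ f.eval s
  | .not b => ¬ b.Holds s
  | .and b c => b.Holds s ∧ c.Holds s

/-- Number of steps that a test takes. -/
def Test.steps : Test → ℕ
  | .natLe e f => e.steps + f.steps + 1
  | .realLe e f => e.steps + f.steps + 1
  | .not b => b.steps + 1
  | .and b c => b.steps + c.steps + 1

/-- Overwrite one cell of an array of naturals. -/
def Memory.setNat (s : Memory) (a i v : ℕ) : Memory :=
  { s with nat := Function.update s.nat a (Function.update (s.nat a) i v) }

/-- Overwrite one cell of an array of reals. -/
def Memory.setReal (s : Memory) (a i : ℕ) (v : ℝ) : Memory :=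
  { s with real := Function.update s.real a (Function.update (s.real a) i v) }

/-- `Exec P s t s'`: the program `P`, started on the memory `s`, halts after exactly `t` steps with
the memory `s'`. -/
inductive Exec : Prog → Memory → ℕ → Memory → Prop
  | skip (s : Memory) : Exec .skip s 1 s
  | setNat (a : ℕ) (i e : NatExpr) (s : Memory) :
      Exec (.setNat a i e) s (i.steps + e.steps + 1) (s.setNat a (i.eval s) (e.eval s))
  | setReal (a : ℕ) (i : NatExpr) (e : RealExpr) (s : Memory) :
      Exec (.setReal a i e) s (i.steps + e.steps + 1) (s.setReal a (i.eval s) (e.eval s))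
  | seq {P Q : Prog} {s s' s'' : Memory} {t t' : ℕ} :
      Exec P s t s' → Exec Q s' t' s'' → Exec (.seq P Q) s (t + t') s''
  | ite_true {b : Test} {P Q : Prog} {s s' : Memory} {t : ℕ} :
      b.Holds s → Exec P s t s' → Exec (.ite b P Q) s (b.steps + t) s'
  | ite_false {b : Test} {P Q : Prog} {s s' : Memory} {t : ℕ} :
      ¬ b.Holds s → Exec Q s t s' → Exec (.ite b P Q) s (b.steps + t) s'
  | loop_true {b : Test} {P : Prog} {s s' s'' : Memory} {t t' : ℕ} :
      b.Holds s → Exec P s t s' → Exec (.loop b P) s' t' s'' →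
        Exec (.loop b P) s (b.steps + t + t') s''
  | loop_false {b : Test} {P : Prog} {s : Memory} :
      ¬ b.Holds s → Exec (.loop b P) s b.steps s

/-! ### Input and output conventions -/

/-- The memory that holds an instance: the numbers `n, d, k, p` in cells `0, 1, 2, 3` of array `0` of
naturals, `ε` in cell `0` of array `0` of reals, and the `j`-th coordinate of the `i`-th data point in
cell `i * d + j` of array `1` of reals. All other cells are `0`. -/
def inputMemory {n d : ℕ} (k p : ℕ) (ε : ℝ) (x : Fin n → Point d) : Memory where
  nat a i :=
    if a = 0 then
      if i = 0 then n else if i = 1 then d else if i = 2 then k else if i = 3 then p else 0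
    else 0
  real a i :=
    if a = 0 then
      if i = 0 then ε else 0
    else if a = 1 then
      if h : i < n * d then
        x (finProdFinEquiv.symm ⟨i, h⟩).1 (finProdFinEquiv.symm ⟨i, h⟩).2
      else 0
    else 0

/-- The number of points of the output, in cell `0` of array `1` of naturals. -/
def outCount (s : Memory) : ℕ := s.nat 1 0

/-- The weight of the `i`-th point of the output, in cell `i` of array `2` of naturals. -/
def outWeight (s : Memory) (i : ℕ) : ℕ := s.nat 2 i

/-- The `i`-th point of the output; its `j`-th coordinate is in cell `i * d + j` of array `2` of
reals. -/
def outPoint (d : ℕ) (s : Memory) (i : ℕ) : Point d :=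
  WithLp.toLp 2 fun j : Fin d => s.real 2 (i * d + j)

/-- The output is a set of points with positive integer weights, and `D` is the multiset in which
the multiplicities are these weights. -/
def Outputs {d : ℕ} (s : Memory) (D : Multiset (Point d)) : Prop :=
  Set.InjOn (outPoint d s) (Set.Iio (outCount s)) ∧
    (∀ i < outCount s, 0 < outWeight s i) ∧
    D = ∑ i ∈ Finset.range (outCount s), Multiset.replicate (outWeight s i) (outPoint d s i)

end PCentrum

end

noncomputable section
namespace PCentrum

/-! ### The sum of the `p` largest values -/

/-! The sum of the `p` largest values of `f` is the minimum over thresholds `t` of `p * t + ∑ max (f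
i - t) 0`, attained at the `p`-th largest value. Hence replacing points changes the cost little if,
outside a set `Z`, each distance changes by at most `η` (at a price of `p * η`) and, on `Z`, the
truncated sums change little for every `t ≥ 0` (`topSumOn_le_topSumOn_add`). All errors must be
small relative to the cost of every set `C` of `k` centers.

Inner points. For a threshold `t` of the distances to `C`, at most `p` points are farther than `t`
from `C`, the others form at most `k` clusters of diameter at most `2 * t`, and `p * t` is at most
the cost. Greedy covering, tried with all interpoint distances as radii, therefore finds a `ρ` such
that `p * ρ` is at most twice the cost of every `C` and at most `k` balls of radius `2 * ρ` miss a
set `Z` of at most `p` points. Points outside `Z` move to a net of mesh `e * ρ`; by volume it has at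
most `k * (1 + 4 / e) ^ d` points.

Outer points. As `Z` has at most `p` points, its distances to `C` sum to at most the cost. Local
search finds `2 * k` centers for which the sum of the distances of `Z` (the radii) is at most `8`
times that. Around each center, directions are rounded to a net of mesh `e`, which moves a point by
at most `e` times its radius. Each resulting ray is cut into consecutive buckets, and the points of
a bucket are replaced by copies of their mean.

The main estimate is `IsBucketing.abs_sum_sub_le`. Along a ray, the truncated distance to `C` is
convex on each of `k` intervals, one per nearest center. For a bucket inside one interval, the gap
in Jensen's inequality is at most the bucket sum times the increase of the slope, and slopes lie in
`[-1, 1]`, so all buckets of one interval together lose at most `2 * δ`, where `δ` bounds the sums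
of the buckets with more than one point. At most `k` buckets straddle intervals, and each loses at
most `2 * δ`. With `δ = e * G / k`, where `G` is the sum of the radii on the ray, the error is at
most `4 * e * G`, while `1 + 2 * k / e` buckets suffice.

Altogether the relative error is `2 * e + 8 * 5 * e = 42 * e`, so that `e = ε / 64` suffices, and
the number of rays times the number of buckets gives the order `k ^ 2 / ε ^ (d + 1)`.

For the algorithm, every choice above is a search over indices. It is written in a language whose
loops have bounds fixed in advance and cut off at `n + d`, so that a polynomial time bound can be
read off the syntax (`Cmd.exec_toProg`), and correctness reduces to loop invariants for the memory
transformer `Cmd.den`. -/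

theorem topSum_le_of_threshold {p : ℕ} {M : Multiset ℝ} (hp : p ≤ M.card) (t : ℝ) :
    topSum p M ≤ p * t + (M.map fun m => max (m - t) 0).sum := by
  unfold topSum
  set l := M.sort (· ≥ ·) with hl
  have hlM : (l : Multiset ℝ) = M := Multiset.sort_eq _ _
  have hlen : l.length = M.card := by rw [← hlM, Multiset.coe_card]
  have hsum : (M.map fun m => max (m - t) 0).sum = (l.map fun m => max (m - t) 0).sum := by
    rw [← hlM]; simp
  rw [hsum]
  have h1 : (l.take p).sum ≤ ((l.take p).map fun m => t + max (m - t) 0).sum := by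
    conv_lhs => rw [← List.map_id (l.take p)]
    refine List.sum_le_sum fun m _ => ?_
    have := le_max_left (m - t) 0
    simp only [id]; linarith
  have h2 : ((l.take p).map fun m => t + max (m - t) 0).sum
      = p * t + ((l.take p).map fun m => max (m - t) 0).sum := by
    rw [List.sum_map_add]
    simp [hlen, hp]
  have h3 : ((l.take p).map fun m => max (m - t) 0).sum ≤ (l.map fun m => max (m - t) 0).sum := by
    conv_rhs => rw [← List.take_append_drop p l, List.map_append, List.sum_append]
    have : 0 ≤ ((l.drop p).map fun m => max (m - t) 0).sum := by
      refine List.sum_nonneg fun a ha => ?_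
      obtain ⟨m, -, rfl⟩ := List.mem_map.1 ha
      exact le_max_right _ _
    linarith
  linarith

/-- The `p`-th largest value is an optimal threshold: truncation loses nothing on the first `p`
sorted entries and annihilates the others. Together with `topSum_le_of_threshold` this allows the
optimal threshold of one family to be tested on another. -/
theorem exists_topSum_eq {p : ℕ} {M : Multiset ℝ} (hp : p ≤ M.card) (h1 : 1 ≤ p) :
    ∃ t ∈ M, topSum p M = p * t + (M.map fun m => max (m - t) 0).sum := by
  unfold topSum
  set l := M.sort (· ≥ ·) with hl
  have hlM : (l : Multiset ℝ) = M := Multiset.sort_eq _ _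
  have hlen : l.length = M.card := by rw [← hlM, Multiset.coe_card]
  have hsorted : l.Pairwise (· ≥ ·) := Multiset.pairwise_sort _ _
  have hlt : p - 1 < l.length := by omega
  refine ⟨l[p - 1], ?_, ?_⟩
  · rw [← hlM]; simp
  set t := l[p - 1] with ht
  have hsum : (M.map fun m => max (m - t) 0).sum = (l.map fun m => max (m - t) 0).sum := by
    rw [← hlM]; simp
  rw [hsum]
  have hge : ∀ m ∈ l.take p, t ≤ m := by
    intro m hm
    obtain ⟨i, hi, rfl⟩ := List.getElem_of_mem hm
    rw [List.getElem_take]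
    rcases Nat.lt_or_ge i (p - 1) with h | h
    · exact List.pairwise_iff_getElem.1 hsorted i (p - 1) _ _ h
    · have hi' : i < p := by simp at hi; omega
      have : i = p - 1 := by omega
      subst this; exact le_rfl
  have hle : ∀ m ∈ l.drop p, m ≤ t := by
    intro m hm
    obtain ⟨i, hi, rfl⟩ := List.getElem_of_mem hm
    rw [List.getElem_drop]
    exact List.pairwise_iff_getElem.1 hsorted (p - 1) (p + i) _ (by simp at hi; omega) (by omega)
  have e1 : (l.take p).sum = ((l.take p).map fun m => t + max (m - t) 0).sum := by
    conv_lhs => rw [← List.map_id (l.take p)]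
    congr 1
    refine List.map_congr_left fun m hm => ?_
    rw [max_eq_left (by linarith [hge m hm])]; simp
  have h2 : ((l.take p).map fun m => t + max (m - t) 0).sum
      = p * t + ((l.take p).map fun m => max (m - t) 0).sum := by
    rw [List.sum_map_add]
    simp [hlen, hp]
  have h3 : ((l.drop p).map fun m => max (m - t) 0).sum = 0 := by
    refine List.sum_eq_zero ?_
    intro a ha
    obtain ⟨m, hm, rfl⟩ := List.mem_map.1 ha
    rw [max_eq_right (by linarith [hle m hm])]
  rw [e1, h2]
  conv_rhs => rw [← List.take_append_drop p l, List.map_append, List.sum_append, h3]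
  simp

/-- The top-`p` sum of an indexed family. -/
def topSumOn (p n : ℕ) (f : ℕ → ℝ) : ℝ := topSum p ((Finset.range n).val.map f)

theorem topSumOn_le {p n : ℕ} (hp : p ≤ n) (f : ℕ → ℝ) (t : ℝ) :
    topSumOn p n f ≤ p * t + ∑ i ∈ Finset.range n, max (f i - t) 0 := by
  refine (topSum_le_of_threshold (by simpa using hp) t).trans_eq ?_
  rw [Multiset.map_map]; rfl

theorem exists_topSumOn_eq {p n : ℕ} (hp : p ≤ n) (h1 : 1 ≤ p) (f : ℕ → ℝ) :
    ∃ i ∈ Finset.range n,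
      topSumOn p n f = p * f i + ∑ j ∈ Finset.range n, max (f j - f i) 0 := by
  obtain ⟨t, ht, he⟩ := exists_topSum_eq (M := (Finset.range n).val.map f) (by simpa using hp) h1
  obtain ⟨i, hi, rfl⟩ := Multiset.mem_map.1 ht
  refine ⟨i, hi, he.trans ?_⟩
  rw [Multiset.map_map]; rfl

/-- A set of at most `p` indices contributes at most the top-`p` sum. -/
theorem sum_le_topSumOn {p n : ℕ} (hp : p ≤ n) (h1 : 1 ≤ p) {f : ℕ → ℝ} (hf : ∀ i, 0 ≤ f i)
    {Z : Finset ℕ} (hZ : Z ⊆ Finset.range n) (hc : Z.card ≤ p) :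
    ∑ i ∈ Z, f i ≤ topSumOn p n f := by
  obtain ⟨i, -, he⟩ := exists_topSumOn_eq hp h1 f
  rw [he]
  calc ∑ j ∈ Z, f j ≤ ∑ j ∈ Z, (f i + max (f j - f i) 0) :=
        Finset.sum_le_sum fun j _ => by linarith [le_max_left (f j - f i) 0]
    _ = Z.card * f i + ∑ j ∈ Z, max (f j - f i) 0 := by
        rw [Finset.sum_add_distrib]; simp
    _ ≤ _ := by
        refine add_le_add (mul_le_mul_of_nonneg_right (by exact_mod_cast hc) (hf i)) ?_
        exact Finset.sum_le_sum_of_subset_of_nonneg hZ fun _ _ _ => le_max_right _ _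

/-- A threshold that at most `p` values exceed and that is paid `p` times. -/
theorem exists_threshold {p n : ℕ} (hp : p ≤ n) (h1 : 1 ≤ p) (f : ℕ → ℝ) :
    ∃ i ∈ Finset.range n, p * f i ≤ topSumOn p n f ∧
      ((Finset.range n).filter fun j => f i < f j).card ≤ p := by
  -- otherwise `p` values above the threshold have a sum that is too large
  obtain ⟨i, hi, he⟩ := exists_topSumOn_eq hp h1 f
  refine ⟨i, hi, ?_, ?_⟩
  · rw [he]
    have : 0 ≤ ∑ j ∈ Finset.range n, max (f j - f i) 0 :=
      Finset.sum_nonneg fun _ _ => le_max_right _ _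
    linarith
  by_contra! hlt
  set P := (Finset.range n).filter fun j => f i < f j with hP
  have hne : P.Nonempty := Finset.card_pos.1 (by omega)
  obtain ⟨j₀, hj₀, hmin⟩ := P.exists_min_image f hne
  have hj₀' := (Finset.mem_filter.1 hj₀).2
  -- Raising the threshold from `f i` to the smallest larger value `f j₀` costs `p` times the gap
  -- and saves at least `P.card` times the gap. As `p < P.card`, this contradicts the optimality of
  -- `f i`.
  have key := topSumOn_le hp f (f j₀)
  rw [he] at key
  have hsplit : ∀ g : ℕ → ℝ, (∀ j, g j = max (f j - f j₀) 0) →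
      ∑ j ∈ Finset.range n, g j + P.card * (f j₀ - f i) ≤
        ∑ j ∈ Finset.range n, max (f j - f i) 0 := by
    intro g hg
    have : (P.card : ℝ) * (f j₀ - f i) =
        ∑ j ∈ Finset.range n, if f i < f j then f j₀ - f i else 0 := by
      rw [← Finset.sum_filter, Finset.sum_const, nsmul_eq_mul]
    rw [this, ← Finset.sum_add_distrib]
    refine Finset.sum_le_sum fun j hj => ?_
    rw [hg]
    split_ifs with h
    · have := hmin j (Finset.mem_filter.2 ⟨hj, h⟩)
      rw [max_eq_left (by linarith)]
      exact le_max_of_le_left (by linarith)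
    · rw [max_eq_right (by linarith [not_lt.1 h])]; simp
  have := hsplit _ fun _ => rfl
  have hc : (p : ℝ) + 1 ≤ P.card := by exact_mod_cast hlt
  nlinarith

/-- Comparison of top-`p` sums of families that are close on the complement of `Z` and have close
truncated sums on `Z`. -/
theorem topSumOn_le_topSumOn_add {p n : ℕ} (hp : p ≤ n) (h1 : 1 ≤ p) {f h : ℕ → ℝ}
    (hf : ∀ i, 0 ≤ f i) {Z : Finset ℕ} (hZ : Z ⊆ Finset.range n) {η E : ℝ} (hη : 0 ≤ η)
    (hin : ∀ i ∈ Finset.range n \ Z, h i ≤ f i + η)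
    (hout : ∀ t, 0 ≤ t → ∑ i ∈ Z, max (h i - t) 0 ≤ ∑ i ∈ Z, max (f i - t) 0 + E) :
    topSumOn p n h ≤ topSumOn p n f + (p * η + E) := by
  obtain ⟨i, -, he⟩ := exists_topSumOn_eq hp h1 f
  rw [he]
  -- The optimal threshold of `f`, raised by `η`, absorbs the change outside `Z` and is paid for by
  -- `p * η`. On `Z` the raise is simply dropped.
  refine (topSumOn_le hp h (f i + η)).trans ?_
  have h2 := hout (f i) (hf i)
  rw [← Finset.sum_sdiff hZ, ← Finset.sum_sdiff hZ]
  have h3 : ∑ j ∈ Finset.range n \ Z, max (h j - (f i + η)) 0 ≤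
      ∑ j ∈ Finset.range n \ Z, max (f j - f i) 0 :=
    Finset.sum_le_sum fun j hj => max_le_max (by linarith [hin j hj]) le_rfl
  have h4 : ∑ j ∈ Z, max (h j - (f i + η)) 0 ≤ ∑ j ∈ Z, max (h j - f i) 0 :=
    Finset.sum_le_sum fun j _ => max_le_max (by linarith) le_rfl
  linarith

end PCentrum
end

noncomputable section
namespace PCentrum

/-! ### Packing -/

/-- Volume bound for the size of a separated subset of a ball. -/
theorem card_le_of_separated {d : ℕ} (s : Finset (Point d)) (c : Point d) {R σ : ℝ} (hσ : 0 < σ)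
    (hR : 0 ≤ R) (hs : ∀ x ∈ s, dist x c ≤ R)
    (h : ∀ x ∈ s, ∀ y ∈ s, x ≠ y → σ ≤ dist x y) : (s.card : ℝ) ≤ (1 + 2 * R / σ) ^ d := by
  open MeasureTheory Metric ENNReal in
  let μ : Measure (Point d) := volume
  -- Balls of radius `σ / 2` around the points are disjoint and lie in a ball of radius `R + σ / 2`;
  -- the quotient of these radii is `1 + 2 * R / σ`.
  let δ : ℝ := σ / 2
  let ρ : ℝ := R + σ / 2
  have δpos : 0 < δ := by positivity
  have ρpos : 0 < ρ := by positivity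
  set A := ⋃ x ∈ s, ball (x : Point d) δ with hA
  have D : Set.Pairwise (s : Set (Point d)) (Function.onFun Disjoint fun x => ball x δ) := by
    rintro x hx y hy hxy
    apply ball_disjoint_ball
    have := h x hx y hy hxy
    simp only [δ]; linarith
  have A_subset : A ⊆ ball c ρ := by
    refine Set.iUnion₂_subset fun x hx => ?_
    apply ball_subset_ball'
    have := hs x hx
    simp only [δ, ρ]; linarith
  have I : (s.card : ℝ≥0∞) * ENNReal.ofReal (δ ^ d) * μ (ball 0 1) ≤
      ENNReal.ofReal (ρ ^ d) * μ (ball 0 1) :=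
    calc
      (s.card : ℝ≥0∞) * ENNReal.ofReal (δ ^ d) * μ (ball 0 1) = μ A := by
        rw [hA, measure_biUnion_finset D fun c _ => measurableSet_ball]
        simp only [μ.addHaar_ball_of_pos _ δpos, finrank_euclideanSpace, Fintype.card_fin]
        simp only [Finset.sum_const, nsmul_eq_mul, mul_assoc]
      _ ≤ μ (ball c ρ) := measure_mono A_subset
      _ = ENNReal.ofReal (ρ ^ d) * μ (ball 0 1) := by
        simp only [μ.addHaar_ball_of_pos _ ρpos, finrank_euclideanSpace, Fintype.card_fin]
  have J : (s.card : ℝ≥0∞) * ENNReal.ofReal (δ ^ d) ≤ ENNReal.ofReal (ρ ^ d) :=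
    (ENNReal.mul_le_mul_iff_left (measure_ball_pos _ _ zero_lt_one).ne' measure_ball_lt_top.ne).1 I
  have K : (s.card : ℝ) * δ ^ d ≤ ρ ^ d := by
    have := ENNReal.toReal_le_of_le_ofReal (pow_nonneg ρpos.le _) J
    rwa [ENNReal.toReal_mul, ENNReal.toReal_natCast,
      ENNReal.toReal_ofReal (pow_nonneg δpos.le _)] at this
  have e : 1 + 2 * R / σ = ρ / δ := by simp only [ρ, δ]; field_simp; ring
  rw [e, div_pow, le_div_iff₀ (pow_pos δpos _)]
  exact K

/-! ### Replacing points of a line by means -/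

/-- The variation of a monotone function with values in `[-1, 1]` over intervals without common
interior points. -/
theorem sum_variation_le {B : Finset ℕ} {a e : ℕ → ℝ} (hae : ∀ β ∈ B, a β ≤ e β)
    (hd : ∀ β ∈ B, ∀ γ ∈ B, β ≠ γ → e β ≤ a γ ∨ e γ ≤ a β) {ψ : ℝ → ℝ} (hψ : Monotone ψ)
    (h1 : ∀ r, |ψ r| ≤ 1) : ∑ β ∈ B, (ψ (e β) - ψ (a β)) ≤ 2 := by
  -- The induction needs a variable upper bound `M`: once the rightmost interval `β` is split off,
  -- the values of `ψ` on the others are bounded by `ψ (a β)`, and the sum telescopes.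
  suffices H : ∀ M : ℝ, -1 ≤ M → (∀ β ∈ B, ψ (e β) ≤ M) →
      ∑ β ∈ B, (ψ (e β) - ψ (a β)) ≤ M + 1 by
    have := H 1 (by norm_num) fun β _ => (abs_le.1 (h1 _)).2
    linarith
  induction B using Finset.induction_on_max_value (fun β => a β + e β) with
  | empty => intro M hM _; simp; linarith
  | insert β B hβ hmax ih =>
    intro M hM hM'
    rw [Finset.sum_insert hβ]
    have hb : a β ≤ e β := hae β (Finset.mem_insert_self _ _)
    have := ih (fun γ hγ => hae γ (Finset.mem_insert_of_mem hγ))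
      (fun γ hγ γ' hγ' => hd γ (Finset.mem_insert_of_mem hγ) γ' (Finset.mem_insert_of_mem hγ'))
      (ψ (a β)) (abs_le.1 (h1 _)).1 (by
        intro γ hγ
        apply hψ
        have hg : a γ ≤ e γ := hae γ (Finset.mem_insert_of_mem hγ)
        have hm := hmax γ hγ
        -- If `γ` were to the right of `β`, maximality of `a β + e β` would force all four endpoints
        -- to coincide, so the conclusion holds in this case too.
        rcases hd β (Finset.mem_insert_self _ _) γ (Finset.mem_insert_of_mem hγ)
          (fun h => hβ (h ▸ hγ)) with h | h
        · linarith
        · exact h)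
    have := hM' β (Finset.mem_insert_self _ _)
    linarith

/-- Sums of deviations from the mean. -/
theorem sum_abs_sub_mean_le {A : Finset ℕ} {r : ℕ → ℝ} (hr : ∀ i ∈ A, 0 ≤ r i) {m : ℝ}
    (hm : A.card * m = ∑ i ∈ A, r i) : ∑ i ∈ A, |r i - m| ≤ 2 * ∑ i ∈ A, r i := by
  rcases A.eq_empty_or_nonempty with rfl | hA
  · simp
  have hc : (0 : ℝ) < A.card := by exact_mod_cast Finset.card_pos.2 hA
  have hm0 : 0 ≤ m := by
    have := Finset.sum_nonneg hr
    rw [← hm] at this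
    exact nonneg_of_mul_nonneg_right this hc
  calc ∑ i ∈ A, |r i - m| ≤ ∑ i ∈ A, (r i + m) := Finset.sum_le_sum fun i hi => by
        have := hr i hi
        rw [abs_le]; constructor <;> linarith
    _ = 2 * ∑ i ∈ A, r i := by
        rw [Finset.sum_add_distrib, Finset.sum_const, nsmul_eq_mul, hm]; ring

/-- The gap in Jensen's inequality, in terms of the increase of a subgradient. -/
theorem jensen_gap_le {A : Finset ℕ} {r : ℕ → ℝ} (hr : ∀ i ∈ A, 0 ≤ r i) {m : ℝ}
    (hm : A.card * m = ∑ i ∈ A, r i) {g ψ : ℝ → ℝ}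
    (hsub : ∀ x y, g x + ψ x * (y - x) ≤ g y) (hψ : Monotone ψ) {lo hi : ℝ}
    (hlo : ∀ i ∈ A, lo ≤ r i) (hhi : ∀ i ∈ A, r i ≤ hi) :
    0 ≤ ∑ i ∈ A, (g (r i) - g m) ∧
      ∑ i ∈ A, (g (r i) - g m) ≤ (∑ i ∈ A, r i) * (ψ hi - ψ lo) := by
  have hz : ∑ i ∈ A, (r i - m) = 0 := by
    rw [Finset.sum_sub_distrib, Finset.sum_const, nsmul_eq_mul, hm, sub_self]
  rcases A.eq_empty_or_nonempty with rfl | hA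
  · simp
  have hc : (0 : ℝ) < A.card := by exact_mod_cast Finset.card_pos.2 hA
  have hm0 : 0 ≤ m := by
    have := Finset.sum_nonneg hr
    rw [← hm] at this
    exact nonneg_of_mul_nonneg_right this hc
  constructor
  · have : ∑ i ∈ A, ψ m * (r i - m) ≤ ∑ i ∈ A, (g (r i) - g m) :=
      Finset.sum_le_sum fun i _ => by linarith [hsub m (r i)]
    rwa [← Finset.mul_sum, hz, mul_zero] at this
  · have h1 : ∑ i ∈ A, (g (r i) - g m) ≤ ∑ i ∈ A, ψ (r i) * (r i - m) :=
      Finset.sum_le_sum fun i _ => by linarith [hsub (r i) m]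
    -- The deviations from the mean sum to zero, so a constant may be subtracted from the slopes.
    -- Subtracting `ψ lo` makes them nonnegative, and then `m ≥ 0` allows `r i - m` to be replaced
    -- by `r i`.
    have h2 : ∑ i ∈ A, ψ (r i) * (r i - m) = ∑ i ∈ A, (ψ (r i) - ψ lo) * (r i - m) := by
      simp only [sub_mul, Finset.sum_sub_distrib (f := fun i => ψ (r i) * (r i - m)),
        ← Finset.mul_sum, hz]
      simp
    rw [h2] at h1
    refine h1.trans ?_
    rw [Finset.sum_mul]
    refine Finset.sum_le_sum fun i hi' => ?_
    have a1 : 0 ≤ ψ (r i) - ψ lo := sub_nonneg.2 (hψ (hlo i hi'))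
    have a2 : ψ (r i) ≤ ψ hi := hψ (hhi i hi')
    have a3 := hr i hi'
    calc (ψ (r i) - ψ lo) * (r i - m) ≤ (ψ (r i) - ψ lo) * r i :=
          mul_le_mul_of_nonneg_left (by linarith) a1
      _ ≤ (ψ hi - ψ lo) * r i := mul_le_mul_of_nonneg_right (by linarith) a3
      _ = _ := mul_comm _ _

/-- The points of `G` in the bucket `β`. -/
abbrev fiber (G : Finset ℕ) (b : ℕ → ℕ) (β : ℕ) : Finset ℕ := G.filter fun w => b w = β

/-- The mean of `r` over a bucket. -/
def bucketMean (G : Finset ℕ) (b : ℕ → ℕ) (r : ℕ → ℝ) (β : ℕ) : ℝ :=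
  (∑ w ∈ fiber G b β, r w) / (fiber G b β).card

theorem card_mul_bucketMean (G : Finset ℕ) (b : ℕ → ℕ) (r : ℕ → ℝ) (β : ℕ) :
    (fiber G b β).card * bucketMean G b r β = ∑ w ∈ fiber G b β, r w := by
  unfold bucketMean
  rcases (fiber G b β).eq_empty_or_nonempty with h | h
  · rw [h]; simp
  · have : ((fiber G b β).card : ℝ) ≠ 0 := by exact_mod_cast (Finset.card_pos.2 h).ne'
    field_simp

/-- A partition of points of a half-line into consecutive buckets of sum at most `δ`, or with one
element. -/
structure IsBucketing (G : Finset ℕ) (b : ℕ → ℕ) (r : ℕ → ℝ) (δ : ℝ) : Prop where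
  nonneg : ∀ z ∈ G, 0 ≤ r z
  delta_nonneg : 0 ≤ δ
  ordered : ∀ β γ, β ≠ γ → (∀ z ∈ fiber G b β, ∀ w ∈ fiber G b γ, r z ≤ r w) ∨
    (∀ z ∈ fiber G b β, ∀ w ∈ fiber G b γ, r w ≤ r z)
  small : ∀ β, ∑ w ∈ fiber G b β, r w ≤ δ ∨ (fiber G b β).card ≤ 1

/-- Replacing the points of each bucket by their mean changes the sum of a `1`-Lipschitz function
that is a minimum of `|C|` convex ones with interval-shaped domains by at most `4 |C| δ`. -/
theorem IsBucketing.abs_sum_sub_le {ι : Type*} {G : Finset ℕ} {b : ℕ → ℕ} {r : ℕ → ℝ} {δ : ℝ}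
    (hG : IsBucketing G b r δ) {C : Finset ι} {near : ι → ℝ → Prop} {F : ℝ → ℝ} {g ψ : ι → ℝ → ℝ}
    (hF : ∀ x y, |F x - F y| ≤ |x - y|) (hex : ∀ x, ∃ q ∈ C, near q x)
    (hconv : ∀ q x y z, near q x → near q z → x ≤ y → y ≤ z → near q y)
    (hFg : ∀ q x, near q x → F x = g q x)
    (hsub : ∀ q x y, g q x + ψ q x * (y - x) ≤ g q y) (hψ : ∀ q x, |ψ q x| ≤ 1) :
    |∑ z ∈ G, F (r z) - ∑ z ∈ G, F (bucketMean G b r (b z))| ≤ 4 * C.card * δ := by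
  classical
  set B := G.image b with hB
  set m := bucketMean G b r with hm
  set err : ℕ → ℝ := fun β => ∑ z ∈ fiber G b β, (F (r z) - F (m β)) with herr
  have hmono : ∀ q, Monotone (ψ q) := by
    intro q x y hxy
    rcases hxy.eq_or_lt with rfl | hlt
    · exact le_rfl
    have h1 := hsub q x y
    have h2 := hsub q y x
    by_contra! hcon
    nlinarith
  have hδ := hG.delta_nonneg
  have hsum : ∑ z ∈ G, F (r z) - ∑ z ∈ G, F (m (b z)) = ∑ β ∈ B, err β := by
    rw [← Finset.sum_sub_distrib, ← Finset.sum_fiberwise_of_maps_to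
      (g := b) (t := B) (fun z hz => Finset.mem_image_of_mem b hz)]
    refine Finset.sum_congr rfl fun β _ => Finset.sum_congr rfl fun z hz => ?_
    rw [(Finset.mem_filter.1 hz).2]
  have hfib : ∀ β ∈ B, (fiber G b β).Nonempty := by
    intro β hβ
    obtain ⟨z, hz, rfl⟩ := Finset.mem_image.1 hβ
    exact ⟨z, Finset.mem_filter.2 ⟨hz, rfl⟩⟩
  -- Below, `a β` and `e β` are points of smallest and largest radius in the bucket; `0` is a dummy
  -- value for names outside `B`.
  have hlo : ∀ β, ∃ z, β ∈ B → z ∈ fiber G b β ∧ ∀ w ∈ fiber G b β, r z ≤ r w := by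
    intro β
    by_cases hβ : β ∈ B
    · obtain ⟨z, hz, h⟩ := (fiber G b β).exists_min_image r (hfib β hβ)
      exact ⟨z, fun _ => ⟨hz, h⟩⟩
    · exact ⟨0, fun h => absurd h hβ⟩
  have hhi : ∀ β, ∃ z, β ∈ B → z ∈ fiber G b β ∧ ∀ w ∈ fiber G b β, r w ≤ r z := by
    intro β
    by_cases hβ : β ∈ B
    · obtain ⟨z, hz, h⟩ := (fiber G b β).exists_max_image r (hfib β hβ)
      exact ⟨z, fun _ => ⟨hz, h⟩⟩
    · exact ⟨0, fun h => absurd h hβ⟩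
  choose a ha using hlo
  choose e he using hhi
  have hord : ∀ β ∈ B, ∀ γ ∈ B, β ≠ γ → r (e β) ≤ r (a γ) ∨ r (e γ) ≤ r (a β) := by
    intro β hβ γ hγ hne
    rcases hG.ordered β γ hne with h | h
    · exact Or.inl (h _ (he β hβ).1 _ (ha γ hγ).1)
    · exact Or.inr (h _ (ha β hβ).1 _ (he γ hγ).1)
  have hae : ∀ β ∈ B, r (a β) ≤ r (e β) := fun β hβ => (ha β hβ).2 _ (he β hβ).1
  have hnn : ∀ β, ∀ z ∈ fiber G b β, 0 ≤ r z := fun β z hz => hG.nonneg z (Finset.mem_filter.1 hz).1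
  have hmean : ∀ β, (fiber G b β).card * m β = ∑ w ∈ fiber G b β, r w :=
    card_mul_bucketMean G b r
  have hone : ∀ β, (fiber G b β).card ≤ 1 → err β = 0 := by
    intro β hc
    refine Finset.sum_eq_zero fun z hz => ?_
    have : fiber G b β = {z} := Finset.eq_singleton_iff_unique_mem.2
      ⟨hz, fun w hw => Finset.card_le_one.1 hc w hw z hz⟩
    have h := hmean β
    rw [this] at h
    simp at h
    rw [h, sub_self]
  -- The crude bound, by the Lipschitz property alone. Buckets with one point have no error, so
  -- their sum may exceed `δ`.
  have hbad : ∀ β, |err β| ≤ 2 * δ := by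
    intro β
    rcases hG.small β with h | h
    · calc |err β| ≤ ∑ z ∈ fiber G b β, |F (r z) - F (m β)| := Finset.abs_sum_le_sum_abs _ _
        _ ≤ ∑ z ∈ fiber G b β, |r z - m β| := Finset.sum_le_sum fun z _ => hF _ _
        _ ≤ 2 * ∑ z ∈ fiber G b β, r z := sum_abs_sub_mean_le (hnn β) (hmean β)
        _ ≤ 2 * δ := by linarith
    · rw [hone β h]; simp; linarith
  -- A center that is nearest at both ends is nearest on the whole bucket, its mean included. There
  -- `F` is the convex function `g q`, and the Jensen gap applies.
  have hnear : ∀ q β, β ∈ B → near q (r (a β)) → near q (r (e β)) →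
      |err β| ≤ δ * (ψ q (r (e β)) - ψ q (r (a β))) := by
    intro q β hβ h1 h2
    rcases hG.small β with h | h
    · have hin : ∀ x, r (a β) ≤ x → x ≤ r (e β) → F x = g q x := fun x hx hx' =>
        hFg q x (hconv q _ _ _ h1 h2 hx hx')
      have hcp : (0 : ℝ) < (fiber G b β).card := by exact_mod_cast Finset.card_pos.2 (hfib β hβ)
      have hm1 : r (a β) ≤ m β := by
        have : ((fiber G b β).card : ℝ) * r (a β) ≤ (fiber G b β).card * m β := by
          rw [hmean, ← nsmul_eq_mul]
          exact Finset.card_nsmul_le_sum _ _ _ (ha β hβ).2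
        exact le_of_mul_le_mul_left this hcp
      have hm2 : m β ≤ r (e β) := by
        have : ((fiber G b β).card : ℝ) * m β ≤ (fiber G b β).card * r (e β) := by
          rw [hmean, ← nsmul_eq_mul]
          exact Finset.sum_le_card_nsmul _ _ _ (he β hβ).2
        exact le_of_mul_le_mul_left this hcp
      have herrg : err β = ∑ z ∈ fiber G b β, (g q (r z) - g q (m β)) := by
        refine Finset.sum_congr rfl fun z hz => ?_
        rw [hin _ ((ha β hβ).2 z hz) ((he β hβ).2 z hz), hin _ hm1 hm2]
      obtain ⟨p1, p2⟩ := jensen_gap_le (hnn β) (hmean β) (hsub q) (hmono q)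
        (ha β hβ).2 (he β hβ).2
      rw [herrg, abs_of_nonneg p1]
      exact p2.trans (mul_le_mul_of_nonneg_right h (sub_nonneg.2 (hmono q (hae β hβ))))
    · rw [hone β h, abs_zero]
      exact mul_nonneg hδ (sub_nonneg.2 (hmono q (hae β hβ)))
  -- a nearest center at the left end
  choose nq hnq hnq' using hex
  set good := B.filter fun β => ∃ q ∈ C, near q (r (a β)) ∧ near q (r (e β)) with hgood
  -- Straddling buckets have different nearest centers at their left ends: a center chosen at two
  -- left ends is nearest everywhere between them, in particular at the right end of the first
  -- bucket, which then does not straddle.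
  have hbadcard : (B.filter fun β => ¬ ∃ q ∈ C, near q (r (a β)) ∧ near q (r (e β))).card ≤
      C.card := by
    refine Finset.card_le_card_of_injOn (fun β => nq (r (a β))) (fun β _ => hnq _) ?_
    intro β hβ γ hγ heq
    by_contra hne
    obtain ⟨hβB, hβ'⟩ := Finset.mem_filter.1 (Finset.mem_coe.1 hβ)
    obtain ⟨hγB, hγ'⟩ := Finset.mem_filter.1 (Finset.mem_coe.1 hγ)
    simp only at heq
    rcases hord β hβB γ hγB hne with h | h
    · exact hβ' ⟨_, hnq (r (a β)), hnq' _,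
        hconv _ _ _ _ (hnq' (r (a β))) (heq ▸ hnq' (r (a γ))) (hae β hβB) h⟩
    · exact hγ' ⟨_, hnq (r (a γ)), hnq' _,
        hconv _ _ _ _ (hnq' (r (a γ))) (heq ▸ hnq' (r (a β))) (hae γ hγB) h⟩
  have hchoice : ∀ β, ∃ q, β ∈ good → q ∈ C ∧ near q (r (a β)) ∧ near q (r (e β)) := by
    intro β
    by_cases hβ : β ∈ good
    · obtain ⟨q, h⟩ := (Finset.mem_filter.1 hβ).2
      exact ⟨q, fun _ => h⟩
    · exact ⟨nq 0, fun h => absurd h hβ⟩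
  choose gq hgq using hchoice
  -- The other buckets are charged to a common nearest center of their ends; each center pays `δ`
  -- times the variation of its slope, which is at most `2`.
  have hgoodsum : ∑ β ∈ good, |err β| ≤ 2 * C.card * δ := by
    rw [← Finset.sum_fiberwise_of_maps_to (g := gq) (t := C) fun β hβ => (hgq β hβ).1]
    have : ∀ q ∈ C, ∑ β ∈ good.filter (fun β => gq β = q), |err β| ≤ 2 * δ := by
      intro q _
      calc ∑ β ∈ good.filter (fun β => gq β = q), |err β|
          ≤ ∑ β ∈ good.filter (fun β => gq β = q), δ * (ψ q (r (e β)) - ψ q (r (a β))) := by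
            refine Finset.sum_le_sum fun β hβ => ?_
            obtain ⟨hβ1, rfl⟩ := Finset.mem_filter.1 hβ
            exact hnear _ β (Finset.mem_filter.1 hβ1).1 (hgq β hβ1).2.1 (hgq β hβ1).2.2
        _ ≤ δ * 2 := by
            rw [← Finset.mul_sum]
            refine mul_le_mul_of_nonneg_left ?_ hδ
            refine sum_variation_le (a := fun β => r (a β)) (e := fun β => r (e β)) ?_ ?_
              (hmono q) (hψ q)
            · intro β hβ
              exact hae β (Finset.mem_filter.1 (Finset.mem_filter.1 hβ).1).1
            · intro β hβ γ hγ hne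
              exact hord β (Finset.mem_filter.1 (Finset.mem_filter.1 hβ).1).1
                γ (Finset.mem_filter.1 (Finset.mem_filter.1 hγ).1).1 hne
        _ = 2 * δ := mul_comm _ _
    refine (Finset.sum_le_sum this).trans_eq ?_
    rw [Finset.sum_const, nsmul_eq_mul]; ring
  have hbadsum : ∑ β ∈ B.filter (fun β => ¬ ∃ q ∈ C, near q (r (a β)) ∧ near q (r (e β))),
      |err β| ≤ 2 * C.card * δ := by
    refine (Finset.sum_le_sum fun β _ => hbad β).trans ?_
    rw [Finset.sum_const, nsmul_eq_mul]
    have : ((B.filter fun β => ¬ ∃ q ∈ C, near q (r (a β)) ∧ near q (r (e β))).card : ℝ) ≤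
      C.card := by exact_mod_cast hbadcard
    nlinarith
  rw [hsum]
  refine (Finset.abs_sum_le_sum_abs _ _).trans ?_
  rw [← Finset.sum_filter_add_sum_filter_not B
    fun β => ∃ q ∈ C, near q (r (a β)) ∧ near q (r (e β))]
  linarith

/-- The same for truncated distances to a finite set along a half-line. -/
theorem IsBucketing.abs_sum_infDist_sub_le {d : ℕ} {G : Finset ℕ} {b : ℕ → ℕ} {r : ℕ → ℝ} {δ : ℝ}
    (hG : IsBucketing G b r δ) {C : Finset (Point d)} (hC : C.Nonempty) (o u : Point d)
    (hu : ‖u‖ ≤ 1) (t : ℝ) :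
    |∑ z ∈ G, max (Metric.infDist (o + r z • u) C - t) 0 -
      ∑ z ∈ G, max (Metric.infDist (o + bucketMean G b r (b z) • u) C - t) 0| ≤
        4 * C.card * δ := by
  have hL : ∀ x y : ℝ, dist (o + x • u) (o + y • u) ≤ |x - y| := by
    intro x y
    rw [dist_add_left, dist_eq_norm, ← sub_smul, norm_smul, Real.norm_eq_abs]
    exact mul_le_of_le_one_right (abs_nonneg _) hu
  have hCf : IsCompact (C : Set (Point d)) := C.finite_toSet.isCompact
  have hsq : ∀ (x : ℝ) (q : Point d), ‖o + x • u - q‖ ^ 2 =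
      ‖o - q‖ ^ 2 + x * (2 * inner ℝ (o - q) u) + x ^ 2 * ‖u‖ ^ 2 := by
    intro x q
    rw [show o + x • u - q = (o - q) + x • u by abel, norm_add_sq_real, inner_smul_right,
      norm_smul, mul_pow, Real.norm_eq_abs, sq_abs]
    ring
  -- The predicate `near q x` says that `q` belongs to `C` and is nearest at parameter `x`;
  -- membership under the quantifier is harmless as `C` is nonempty. The slope `ψ q` is the
  -- derivative of the distance to `q`, set to `0` where the distance is truncated and, by division
  -- by zero, at `q` itself.
  refine hG.abs_sum_sub_le (C := C)
    (near := fun q x => ∀ q' ∈ C, ‖o + x • u - q‖ ≤ ‖o + x • u - q'‖ ∧ q ∈ C)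
    (F := fun x => max (Metric.infDist (o + x • u) C - t) 0)
    (g := fun q x => max (‖o + x • u - q‖ - t) 0)
    (ψ := fun q x => if t < ‖o + x • u - q‖ then
      inner ℝ (o + x • u - q) u / ‖o + x • u - q‖ else 0) ?_ ?_ ?_ ?_ ?_ ?_
  · intro x y
    refine (abs_max_sub_max_le_abs _ _ _).trans ?_
    rw [sub_sub_sub_cancel_right]
    refine le_trans ?_ (hL x y)
    have := (Metric.lipschitz_infDist_pt (C : Set (Point d))).dist_le_mul (o + x • u) (o + y • u)
    simpa [Real.dist_eq] using this
  · intro x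
    obtain ⟨q, hq, h⟩ := C.exists_min_image (fun q => ‖o + x • u - q‖) hC
    exact ⟨q, hq, fun q' hq' => ⟨h q' hq', hq⟩⟩
  · intro q x y z hx hz hxy hyz q' hq'
    refine ⟨?_, (hx q' hq').2⟩
    have h1 := (hx q' hq').1
    have h2 := (hz q' hq').1
    -- The squared distances to two centers differ by an affine function of the parameter, so a
    -- comparison that holds at both ends holds in between.
    rw [← sq_le_sq₀ (norm_nonneg _) (norm_nonneg _), hsq, hsq] at h1 h2 ⊢
    set A := ‖o - q'‖ ^ 2 - ‖o - q‖ ^ 2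
    set D := 2 * inner ℝ (o - q') u - 2 * inner ℝ (o - q) u with hD
    have h1' : 0 ≤ A + x * D := by simp only [A, D]; linarith
    have h2' : 0 ≤ A + z * D := by simp only [A, D]; linarith
    suffices 0 ≤ A + y * D by simp only [A, D] at this; linarith
    rcases le_total 0 D with h | h
    · nlinarith
    · nlinarith
  · intro q x h
    have hq : q ∈ C := by
      obtain ⟨q', hq'⟩ := hC
      exact (h q' hq').2
    have : Metric.infDist (o + x • u) C = ‖o + x • u - q‖ := by
      refine le_antisymm ((Metric.infDist_le_dist_of_mem (Finset.mem_coe.2 hq)).trans_eq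
        (dist_eq_norm _ _)) ?_
      refine (Metric.le_infDist (Finset.coe_nonempty.2 hC)).2 fun q' hq' => ?_
      rw [dist_eq_norm]
      exact (h q' hq').1
    simp only [this]
  · intro q x y
    split_ifs with h
    · rw [max_eq_left (by linarith)]
      refine le_max_of_le_left ?_
      rcases (norm_nonneg (o + x • u - q)).eq_or_lt with h0 | h0
      · rw [← h0]; simp
      -- Cauchy–Schwarz yields `N ^ 2 + (y - x) * I ≤ N * N'`; division by `N` gives the subgradient
      -- inequality for the untruncated distance.
      have hcs := real_inner_le_norm (o + x • u - q) (o + y • u - q)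
      rw [show o + y • u - q = (o + x • u - q) + (y - x) • u by module, inner_add_right,
        inner_smul_right, real_inner_self_eq_norm_sq] at hcs
      rw [show o + y • u - q = (o + x • u - q) + (y - x) • u by module]
      set N := ‖o + x • u - q‖
      set N' := ‖o + x • u - q + (y - x) • u‖
      set I := inner ℝ (o + x • u - q) u
      have : N + I / N * (y - x) ≤ N' := by
        have e : N + I / N * (y - x) = (N ^ 2 + (y - x) * I) / N := by field_simp
        rw [e, div_le_iff₀ h0]; linarith
      linarith
    · rw [max_eq_right (by linarith)]
      simp
  · intro q x
    split_ifs with h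
    · rw [abs_div, abs_norm]
      refine div_le_one_of_le₀ ?_ (norm_nonneg _)
      refine (abs_real_inner_le_norm _ _).trans ?_
      exact mul_le_of_le_one_right (norm_nonneg _) hu
    · simp

end PCentrum
end

noncomputable section
namespace PCentrum

/-! ### Greedy covering with outliers -/

section Greedy

variable {α : Type*} [MetricSpace α]

/-- One step of greedy covering: the ball of radius `ρ` that contains most of `U` is selected, and
the concentric ball of radius `2 ρ` is removed from `U`. -/
def GreedyStep (x : ℕ → α) (n : ℕ) (ρ : ℝ) (U U' : Finset ℕ) : Prop :=
  ∃ v < n, (∀ w < n, (U.filter fun u => dist (x w) (x u) ≤ ρ).card ≤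
      (U.filter fun u => dist (x v) (x u) ≤ ρ).card) ∧
    U' = U.filter fun u => ¬ dist (x v) (x u) ≤ 2 * ρ

/-- A family of sets of diameter at most `ρ`. -/
def IsClusterFamily (x : ℕ → α) (n : ℕ) (ρ : ℝ) (𝒯 : Finset (Finset ℕ)) : Prop :=
  ∀ T ∈ 𝒯, T ⊆ Finset.range n ∧ ∀ u ∈ T, ∀ w ∈ T, dist (x u) (x w) ≤ ρ

/-- The state of greedy covering after `i` of `k` steps. -/
structure GreedyInv (x : ℕ → α) (n k : ℕ) (ρ : ℝ) (i : ℕ) (U : Finset ℕ) : Prop where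
  subset : U ⊆ Finset.range n
  card_le : ∀ 𝒯, IsClusterFamily x n ρ 𝒯 → 𝒯.card ≤ k → ∃ 𝒯', IsClusterFamily x n ρ 𝒯' ∧
    𝒯'.card ≤ k - i ∧ (U \ 𝒯'.biUnion id).card ≤ (Finset.range n \ 𝒯.biUnion id).card
  covered : ∃ T ⊆ Finset.range n, T.card ≤ i ∧
    ∀ u ∈ Finset.range n \ U, ∃ v ∈ T, dist (x v) (x u) ≤ 2 * ρ

theorem GreedyInv.zero (x : ℕ → α) (n k : ℕ) (ρ : ℝ) :
    GreedyInv x n k ρ 0 (Finset.range n) where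
  subset := subset_rfl
  card_le 𝒯 h hk := ⟨𝒯, h, hk, le_rfl⟩
  covered := ⟨∅, by simp, by simp, by simp⟩

/-- One cluster of the competing family can be dropped in each step. If the selected ball meets a
cluster in a remaining point, the ball of double radius swallows that cluster. Otherwise the
selected ball consists of uncovered points, which are now removed. Then any cluster `T₀` can go: it
lies in the ball of radius `ρ` around each of its points, so its remaining points are no more
numerous than those of the selected, best ball. -/
theorem GreedyInv.succ {x : ℕ → α} {n k : ℕ} {ρ : ℝ} {i : ℕ} {U U' : Finset ℕ}
    (h : GreedyInv x n k ρ i U) (hs : GreedyStep x n ρ U U') : GreedyInv x n k ρ (i + 1) U' := by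
  classical
  obtain ⟨v, hv, hmax, rfl⟩ := hs
  have hsub : U.filter (fun u => ¬ dist (x v) (x u) ≤ 2 * ρ) ⊆ U := Finset.filter_subset _ _
  refine ⟨hsub.trans h.subset, fun 𝒯 h𝒯 hk => ?_, ?_⟩
  · obtain ⟨𝒮, h𝒮, hc, hle⟩ := h.card_le 𝒯 h𝒯 hk
    rcases 𝒮.eq_empty_or_nonempty with rfl | ⟨T₀, hT₀⟩
    · refine ⟨∅, h𝒮, by simp, le_trans (Finset.card_le_card ?_) hle⟩
      exact Finset.sdiff_subset_sdiff hsub subset_rfl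
    by_cases hmeet : ∃ T ∈ 𝒮, ∃ u ∈ T, u ∈ U ∧ dist (x v) (x u) ≤ ρ
    · obtain ⟨T, hT, u, huT, huU, hu⟩ := hmeet
      refine ⟨𝒮.erase T, fun S hS => h𝒮 S (Finset.mem_of_mem_erase hS), ?_, ?_⟩
      · rw [Finset.card_erase_of_mem hT]; omega
      · refine le_trans (Finset.card_le_card ?_) hle
        intro w hw
        obtain ⟨hw1, hw2⟩ := Finset.mem_sdiff.1 hw
        obtain ⟨hwU, hwd⟩ := Finset.mem_filter.1 hw1
        refine Finset.mem_sdiff.2 ⟨hwU, fun hw3 => ?_⟩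
        obtain ⟨S, hS, hwS⟩ := Finset.mem_biUnion.1 hw3
        by_cases hST : S = T
        · subst hST
          have h1 := (h𝒮 S hS).2 u huT w hwS
          exact hwd (by linarith [dist_triangle (x v) (x u) (x w)])
        · exact hw2 (Finset.mem_biUnion.2 ⟨S, Finset.mem_erase.2 ⟨hST, hS⟩, hwS⟩)
    · push Not at hmeet
      refine ⟨𝒮.erase T₀, fun S hS => h𝒮 S (Finset.mem_of_mem_erase hS), ?_, ?_⟩
      · rw [Finset.card_erase_of_mem hT₀]; omega
      · refine le_trans ?_ hle
        set Bv := U.filter fun u => dist (x v) (x u) ≤ ρ with hBv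
        have h1 : (T₀ ∩ U).card ≤ Bv.card := by
          rcases (T₀ ∩ U).eq_empty_or_nonempty with he | ⟨w, hw⟩
          · rw [he]; simp
          · have hwT := (Finset.mem_inter.1 hw).1
            refine le_trans (Finset.card_le_card ?_)
              (hmax w (Finset.mem_range.1 ((h𝒮 T₀ hT₀).1 hwT)))
            intro u hu
            obtain ⟨hu1, hu2⟩ := Finset.mem_inter.1 hu
            exact Finset.mem_filter.2 ⟨hu2, (h𝒮 T₀ hT₀).2 w hwT u hu1⟩
        have h2 : Bv ⊆ U \ 𝒮.biUnion id := by
          intro u hu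
          obtain ⟨hu1, hu2⟩ := Finset.mem_filter.1 hu
          refine Finset.mem_sdiff.2 ⟨hu1, fun h3 => ?_⟩
          obtain ⟨S, hS, huS⟩ := Finset.mem_biUnion.1 h3
          exact absurd hu2 (not_le.2 (hmeet S hS u huS hu1))
        have h3 : U.filter (fun u => ¬ dist (x v) (x u) ≤ 2 * ρ) \ (𝒮.erase T₀).biUnion id ⊆
            ((U \ 𝒮.biUnion id) \ Bv) ∪ (T₀ ∩ U) := by
          intro w hw
          obtain ⟨hw1, hw2⟩ := Finset.mem_sdiff.1 hw
          obtain ⟨hwU, hwd⟩ := Finset.mem_filter.1 hw1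
          by_cases hwT : w ∈ T₀
          · exact Finset.mem_union_right _ (Finset.mem_inter.2 ⟨hwT, hwU⟩)
          refine Finset.mem_union_left _ (Finset.mem_sdiff.2 ⟨Finset.mem_sdiff.2 ⟨hwU, ?_⟩, ?_⟩)
          · intro hw3
            obtain ⟨S, hS, hwS⟩ := Finset.mem_biUnion.1 hw3
            refine hw2 (Finset.mem_biUnion.2 ⟨S, Finset.mem_erase.2 ⟨?_, hS⟩, hwS⟩)
            rintro rfl
            exact hwT hwS
          · intro hwB
            have h4 := (Finset.mem_filter.1 hwB).2
            have : 0 ≤ dist (x v) (x w) := dist_nonneg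
            exact hwd (by linarith)
        refine (Finset.card_le_card h3).trans ((Finset.card_union_le _ _).trans ?_)
        rw [Finset.card_sdiff_of_subset h2]
        have := Finset.card_le_card h2
        omega
  · obtain ⟨T, hTn, hTc, hT⟩ := h.covered
    refine ⟨insert v T, Finset.insert_subset (Finset.mem_range.2 hv) hTn,
      (Finset.card_insert_le _ _).trans (by omega), fun u hu => ?_⟩
    obtain ⟨hu1, hu2⟩ := Finset.mem_sdiff.1 hu
    by_cases huU : u ∈ U
    · refine ⟨v, Finset.mem_insert_self _ _, ?_⟩
      by_contra hcon
      exact hu2 (Finset.mem_filter.2 ⟨huU, hcon⟩)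
    · obtain ⟨w, hw, hwu⟩ := hT u (Finset.mem_sdiff.2 ⟨hu1, huU⟩)
      exact ⟨w, Finset.mem_insert_of_mem hw, hwu⟩

/-- After `k` steps the competing family is exhausted. Greedy covering with radius `2 * ρ` thus
leaves no more points than the best `k` clusters of diameter at most `ρ`. -/
theorem GreedyInv.card_le_of_family {x : ℕ → α} {n k : ℕ} {ρ : ℝ} {U : Finset ℕ}
    (h : GreedyInv x n k ρ k U) {𝒯 : Finset (Finset ℕ)} (h𝒯 : IsClusterFamily x n ρ 𝒯)
    (hk : 𝒯.card ≤ k) : U.card ≤ (Finset.range n \ 𝒯.biUnion id).card := by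
  classical
  obtain ⟨𝒮, -, hc, hle⟩ := h.card_le 𝒯 h𝒯 hk
  have : 𝒮 = ∅ := Finset.card_eq_zero.1 (by omega)
  subst this
  simpa using hle

theorem exists_nearest (C : Finset α) (hC : C.Nonempty) (y : α) :
    ∃ q ∈ C, Metric.infDist y (C : Set α) = dist y q := by
  obtain ⟨q, hq, h⟩ := (C.finite_toSet.isCompact).exists_infDist_eq_dist
    (Finset.coe_nonempty.2 hC) y
  exact ⟨q, hq, h⟩

/-- Every set of centers yields clusters that leave at most `p` outliers and whose diameter is
bounded by a distance of two data points that is small compared to the cost. -/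
theorem exists_clusterFamily (x : ℕ → α) {n p : ℕ} (hp : p ≤ n) (h1 : 1 ≤ p) {C : Finset α}
    (hC : C.Nonempty) : ∃ i < n, ∃ j < n, ∃ 𝒯, IsClusterFamily x n (dist (x i) (x j)) 𝒯 ∧
      𝒯.card ≤ C.card ∧ (Finset.range n \ 𝒯.biUnion id).card ≤ p ∧
      p * dist (x i) (x j) ≤ 2 * topSumOn p n fun z => Metric.infDist (x z) (C : Set α) := by
  classical
  set f : ℕ → ℝ := fun z => Metric.infDist (x z) (C : Set α) with hf
  obtain ⟨i₀, hi₀, hcost, hcard⟩ := exists_threshold hp h1 f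
  choose q hq hq' using fun y => exists_nearest C hC y
  -- Pairs of points that are served by the same center within the threshold. The largest distance
  -- of such a pair bounds all cluster diameters and, being an interpoint distance, is among the
  -- radii that the algorithm tries.
  set P := ((Finset.range n ×ˢ Finset.range n).filter fun e =>
    q (x e.1) = q (x e.2) ∧ f e.1 ≤ f i₀ ∧ f e.2 ≤ f i₀) with hP
  have hPne : P.Nonempty := ⟨(i₀, i₀), by simp [hP, Finset.mem_range.1 hi₀]⟩
  obtain ⟨⟨i, j⟩, hij, hmax⟩ := P.exists_max_image (fun e => dist (x e.1) (x e.2)) hPne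
  have hij' := Finset.mem_filter.1 hij
  simp only [Finset.mem_product, Finset.mem_range] at hij'
  refine ⟨i, hij'.1.1, j, hij'.1.2,
    C.image fun c => (Finset.range n).filter fun z => q (x z) = c ∧ f z ≤ f i₀, ?_,
    Finset.card_image_le, ?_, ?_⟩
  · intro T hT
    obtain ⟨c, hc, rfl⟩ := Finset.mem_image.1 hT
    refine ⟨Finset.filter_subset _ _, fun u hu w hw => ?_⟩
    have hu := Finset.mem_filter.1 hu
    have hw := Finset.mem_filter.1 hw
    refine hmax (u, w) (Finset.mem_filter.2 ⟨Finset.mem_product.2 ⟨hu.1, hw.1⟩, ?_, hu.2.2, hw.2.2⟩)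
    exact hu.2.1.trans hw.2.1.symm
  · refine le_trans (Finset.card_le_card ?_) hcard
    intro z hz
    obtain ⟨hz1, hz2⟩ := Finset.mem_sdiff.1 hz
    refine Finset.mem_filter.2 ⟨hz1, ?_⟩
    by_contra hcon
    refine hz2 (Finset.mem_biUnion.2 ⟨_, Finset.mem_image_of_mem _ (hq (x z)), ?_⟩)
    exact Finset.mem_filter.2 ⟨hz1, rfl, not_lt.1 hcon⟩
  -- Both points of the pair are within `f i₀` of a common center, and `p * f i₀` is at most the
  -- cost.
  · have : dist (x i) (x j) ≤ 2 * f i₀ := by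
      have t := dist_triangle_right (x i) (x j) (q (x i))
      have a1 : dist (x i) (q (x i)) ≤ f i₀ := (hq' (x i)).symm.trans_le hij'.2.2.1
      have a2 : dist (x j) (q (x i)) ≤ f i₀ := by
        rw [hij'.2.1]; exact (hq' (x j)).symm.trans_le hij'.2.2.2
      linarith
    have hp0 : (0 : ℝ) ≤ p := Nat.cast_nonneg p
    nlinarith

end Greedy

/-! ### Local search for medians -/

section LocalSearch

variable {α : Type*} [MetricSpace α] (x : ℕ → α) (n : ℕ) (Z : Finset ℕ)

/-- The sum of the distances of the points in `Z` to the nearest point in `S`. -/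
def medianCost (S : Finset ℕ) : ℝ := ∑ z ∈ Z, Metric.infDist (x z) (x '' (S : Set ℕ))

/-- `S'` arises from `S` by the cheapest removal of an element. -/
def RemoveBest (S S' : Finset ℕ) : Prop :=
  (∃ s ∈ S, S' = S.erase s) ∧ ∀ s ∈ S, medianCost x Z S' ≤ medianCost x Z (S.erase s)

/-- `S'` arises from `S` by the best insertion of an element. -/
def AddBest (S S' : Finset ℕ) : Prop :=
  (∃ s ∈ Finset.range n \ S, S' = insert s S) ∧
    ∀ s ∈ Finset.range n \ S, medianCost x Z S' ≤ medianCost x Z (insert s S)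

/-- The cost of an assignment of the points in `Z` to at most `k` points. -/
structure IsAssignment (k : ℕ) (τ : ℕ → ℕ) (V : ℝ) : Prop where
  mem : ∀ z ∈ Z, τ z < n
  card_le : (Z.image τ).card ≤ k
  value : V = ∑ z ∈ Z, dist (x z) (x (τ z))

variable {x n Z}

theorem infDist_image_le {S : Finset ℕ} {s : ℕ} (hs : s ∈ S) (y : α) :
    Metric.infDist y (x '' (S : Set ℕ)) ≤ dist y (x s) :=
  Metric.infDist_le_dist_of_mem ⟨s, hs, rfl⟩

theorem exists_nearest_image {S : Finset ℕ} (hS : S.Nonempty) (y : α) :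
    ∃ s ∈ S, Metric.infDist y (x '' (S : Set ℕ)) = dist y (x s) := by
  obtain ⟨q, ⟨s, hs, rfl⟩, h⟩ := ((S.finite_toSet.image x).isCompact).exists_infDist_eq_dist
    ((Finset.coe_nonempty.2 hS).image x) y
  exact ⟨s, hs, h⟩

theorem infDist_image_eq {S : Finset ℕ} {s : ℕ} (hs : s ∈ S) {y : α}
    (h : ∀ s' ∈ S, dist y (x s) ≤ dist y (x s')) :
    Metric.infDist y (x '' (S : Set ℕ)) = dist y (x s) := by
  obtain ⟨s', hs', he⟩ := exists_nearest_image (x := x) ⟨s, hs⟩ y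
  exact le_antisymm (infDist_image_le hs y) (he ▸ h s' hs')

theorem medianCost_insert_le {S : Finset ℕ} (hS : S.Nonempty) (s : ℕ) :
    medianCost x Z (insert s S) ≤ medianCost x Z S := by
  refine Finset.sum_le_sum fun z _ => ?_
  obtain ⟨s', hs', he⟩ := exists_nearest_image (x := x) hS (x z)
  rw [he]
  exact infDist_image_le (Finset.mem_insert_of_mem hs') _

/-- An averaging argument over the set `F` of centers of `S` that were not selected as nearest
center for any target `τ z`; there are at least `S.card - k` of them. If one of them is removed,
each point `z` that it serves is redirected to the center nearest to `x (τ z)`, which survives, at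
an extra cost of at most `2 * dist (x z) (x (τ z))`. Over all of `F` each point is redirected at
most once. -/
theorem IsAssignment.removeBest_le {k : ℕ} {τ : ℕ → ℕ} {V : ℝ} (hτ : IsAssignment x n Z k τ V)
    {S S' : Finset ℕ} (hk : k < S.card) (h : RemoveBest x Z S S') :
    ((S.card : ℝ) - k) * (medianCost x Z S' - medianCost x Z S) ≤ 2 * V := by
  classical
  have hS : S.Nonempty := Finset.card_pos.1 (by omega)
  choose π hπ hπ' using fun y => exists_nearest_image (x := x) hS y
  set F := S \ (Z.image τ).image (fun o => π (x o)) with hF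
  have hFc : S.card - k ≤ F.card := by
    have h1 : S.card - ((Z.image τ).image fun o => π (x o)).card ≤ F.card :=
      Finset.le_card_sdiff _ _
    have h2 : ((Z.image τ).image fun o => π (x o)).card ≤ (Z.image τ).card :=
      Finset.card_image_le
    have h3 := hτ.card_le
    omega
  have hFc' : (S.card : ℝ) - k ≤ F.card := by
    rw [← Nat.cast_sub hk.le]; exact_mod_cast hFc
  have hV0 : 0 ≤ V := by
    rw [hτ.value]; exact Finset.sum_nonneg fun _ _ => dist_nonneg
  by_cases hneg : medianCost x Z S' - medianCost x Z S ≤ 0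
  · have : 0 ≤ (S.card : ℝ) - k := by
      rw [← Nat.cast_sub hk.le]; positivity
    nlinarith
  push Not at hneg
  have hinc : ∀ s ∈ F, medianCost x Z S' - medianCost x Z S ≤
      ∑ z ∈ Z, if π (x z) = s then 2 * dist (x z) (x (τ z)) else 0 := by
    intro s hs
    obtain ⟨hsS, hsF⟩ := Finset.mem_sdiff.1 hs
    refine (sub_le_sub_right (h.2 s hsS) _).trans ?_
    unfold medianCost
    rw [← Finset.sum_sub_distrib]
    refine Finset.sum_le_sum fun z hz => ?_
    split_ifs with hzs
    · have hmem : π (x (τ z)) ∈ S.erase s := by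
        refine Finset.mem_erase.2 ⟨?_, hπ _⟩
        rintro rfl
        exact hsF (Finset.mem_image.2 ⟨τ z, Finset.mem_image_of_mem _ hz, rfl⟩)
      have h1 := infDist_image_le (x := x) hmem (x z)
      have h2 := dist_triangle (x z) (x (τ z)) (x (π (x (τ z))))
      have h3 : dist (x (τ z)) (x (π (x (τ z)))) ≤ dist (x (τ z)) (x (π (x z))) := by
        rw [← hπ']; exact infDist_image_le (hπ _) _
      have h4 := dist_triangle (x (τ z)) (x z) (x (π (x z)))
      rw [dist_comm (x (τ z)) (x z), ← hπ' (x z)] at h4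
      linarith
    · have hmem : π (x z) ∈ S.erase s := Finset.mem_erase.2 ⟨hzs, hπ _⟩
      have h1 := infDist_image_le (x := x) hmem (x z)
      rw [← hπ' (x z)] at h1
      linarith
  have hsum := Finset.sum_le_sum hinc
  rw [Finset.sum_const, nsmul_eq_mul, Finset.sum_comm] at hsum
  have h2 : ∑ z ∈ Z, ∑ s ∈ F, (if π (x z) = s then 2 * dist (x z) (x (τ z)) else 0) ≤ 2 * V := by
    rw [hτ.value, Finset.mul_sum]
    refine Finset.sum_le_sum fun z _ => ?_
    rw [Finset.sum_ite_eq]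
    split_ifs
    · exact le_rfl
    · have : 0 ≤ dist (x z) (x (τ z)) := dist_nonneg
      linarith
  calc _ ≤ (F.card : ℝ) * (medianCost x Z S' - medianCost x Z S) :=
        mul_le_mul_of_nonneg_right hFc' hneg.le
    _ ≤ _ := hsum.trans h2

/-- Inserting the target `τ z` alone lowers the distance of `z` at least to its distance in the
assignment, and no insertion raises a distance. The separate insertions of all targets therefore
gain at least `medianCost x Z S - V` in total, and the best insertion gains at least a `k`-th part
of it. -/
theorem IsAssignment.addBest_le {k : ℕ} {τ : ℕ → ℕ} {V : ℝ} (hτ : IsAssignment x n Z k τ V)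
    {S S' : Finset ℕ} (hS : S.Nonempty) (h : AddBest x n Z S S') :
    (medianCost x Z S - V) ≤ k * (medianCost x Z S - medianCost x Z S') := by
  classical
  have hV0 : 0 ≤ V := by
    rw [hτ.value]; exact Finset.sum_nonneg fun _ _ => dist_nonneg
  have hdec : 0 ≤ medianCost x Z S - medianCost x Z S' := by
    obtain ⟨⟨s, -, rfl⟩, -⟩ := h
    exact sub_nonneg.2 (medianCost_insert_le hS s)
  have hdec' : ∀ o ∈ Z.image τ, medianCost x Z S - medianCost x Z (insert o S) ≤
      medianCost x Z S - medianCost x Z S' := by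
    intro o ho
    by_cases hoS : o ∈ S
    · rw [Finset.insert_eq_of_mem hoS, sub_self]; exact hdec
    · obtain ⟨z, hz, rfl⟩ := Finset.mem_image.1 ho
      exact sub_le_sub_left (h.2 _ (Finset.mem_sdiff.2 ⟨Finset.mem_range.2 (hτ.mem z hz), hoS⟩)) _
  have hsum := Finset.sum_le_sum hdec'
  rw [Finset.sum_const, nsmul_eq_mul] at hsum
  have hcard : ((Z.image τ).card : ℝ) ≤ k := by exact_mod_cast hτ.card_le
  refine le_trans ?_ (hsum.trans (mul_le_mul_of_nonneg_right hcard hdec))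
  have hexp : ∀ o, medianCost x Z S - medianCost x Z (insert o S) =
      ∑ z ∈ Z, (Metric.infDist (x z) (x '' (S : Set ℕ)) -
        Metric.infDist (x z) (x '' ((insert o S : Finset ℕ) : Set ℕ))) := by
    intro o; unfold medianCost; rw [Finset.sum_sub_distrib]
  simp only [hexp]
  rw [Finset.sum_comm, hτ.value, medianCost, ← Finset.sum_sub_distrib]
  refine Finset.sum_le_sum fun z hz => ?_
  have hnn : ∀ o ∈ Z.image τ, 0 ≤ Metric.infDist (x z) (x '' (S : Set ℕ)) -
        Metric.infDist (x z) (x '' ((insert o S : Finset ℕ) : Set ℕ)) := by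
    intro o _
    obtain ⟨s', hs', he⟩ := exists_nearest_image (x := x) hS (x z)
    rw [he]
    exact sub_nonneg.2 (infDist_image_le (Finset.mem_insert_of_mem hs') _)
  refine le_trans ?_ (Finset.single_le_sum hnn (Finset.mem_image_of_mem τ hz))
  exact sub_le_sub_left (infDist_image_le (Finset.mem_insert_self _ _) _) _

variable (x n Z)

/-- The state of the initial removals after `i` steps. -/
structure RemovalInv (k i : ℕ) (S : Finset ℕ) : Prop where
  subset : S ⊆ Finset.range n
  card_eq : S.card = n - i
  cost_le : ∀ τ V, IsAssignment x n Z k τ V → medianCost x Z S ≤ 2 * i * V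

/-- The state of local search after `i` rounds. -/
structure SearchInv (k i : ℕ) (S : Finset ℕ) : Prop where
  subset : S ⊆ Finset.range n
  card_eq : S.card = 2 * k
  cost_le : ∀ τ V, IsAssignment x n Z k τ V →
    medianCost x Z S - 3 * V ≤ (1 - 1 / (k : ℝ)) ^ i * (2 * n * V)

variable {x n Z}

theorem IsAssignment.value_nonneg {k : ℕ} {τ : ℕ → ℕ} {V : ℝ} (hτ : IsAssignment x n Z k τ V) :
    0 ≤ V := by
  rw [hτ.value]; exact Finset.sum_nonneg fun _ _ => dist_nonneg

theorem RemovalInv.zero (hZ : Z ⊆ Finset.range n) (k : ℕ) :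
    RemovalInv x n Z k 0 (Finset.range n) where
  subset := subset_rfl
  card_eq := by simp
  cost_le τ V _ := by
    have : medianCost x Z (Finset.range n) = 0 := by
      refine Finset.sum_eq_zero fun z hz => ?_
      refine Metric.infDist_zero_of_mem ⟨z, ?_, rfl⟩
      exact hZ hz
    rw [this]; simp

theorem RemovalInv.succ {k i : ℕ} {S S' : Finset ℕ} (h : RemovalInv x n Z k i S) (hk : k < n - i)
    (hs : RemoveBest x Z S S') : RemovalInv x n Z k (i + 1) S' where
  subset := by
    obtain ⟨⟨s, -, rfl⟩, -⟩ := hs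
    exact (Finset.erase_subset _ _).trans h.subset
  card_eq := by
    obtain ⟨⟨s, hsS, rfl⟩, -⟩ := hs
    rw [Finset.card_erase_of_mem hsS, h.card_eq]; omega
  cost_le τ V hτ := by
    have h1 := hτ.removeBest_le (by rw [h.card_eq]; exact hk) hs
    have h2 := h.cost_le τ V hτ
    have h3 : (1 : ℝ) ≤ (S.card : ℝ) - k := by
      have : k + 1 ≤ S.card := by rw [h.card_eq]; omega
      have : (k : ℝ) + 1 ≤ S.card := by exact_mod_cast this
      linarith
    have h4 := hτ.value_nonneg
    have h5 : medianCost x Z S' - medianCost x Z S ≤ 2 * V := by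
      by_contra! hcon
      nlinarith
    push_cast
    linarith

theorem RemovalInv.searchInv {k : ℕ} {S : Finset ℕ} (hk : 2 * k ≤ n)
    (h : RemovalInv x n Z k (n - 2 * k) S) : SearchInv x n Z k 0 S where
  subset := h.subset
  card_eq := by rw [h.card_eq]; omega
  cost_le τ V hτ := by
    have h1 := h.cost_le τ V hτ
    have h2 := hτ.value_nonneg
    have h3 : ((n - 2 * k : ℕ) : ℝ) ≤ n := by exact_mod_cast Nat.sub_le _ _
    simp only [pow_zero, one_mul]
    nlinarith

/-- With `c` the cost, an insertion gains at least `(c - V) / k`, and a removal from `2 * k + 1`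
centers loses at most `2 * V / (k + 1)`. Hence `c - 3 * V` shrinks by the factor `1 - 1 / k` in each
round; the excess of centers over `k` is what makes the loss small. -/
theorem SearchInv.succ {k i : ℕ} (hk : 1 ≤ k) {S S₁ S' : Finset ℕ} (h : SearchInv x n Z k i S)
    (ha : AddBest x n Z S S₁) (hr : RemoveBest x Z S₁ S') : SearchInv x n Z k (i + 1) S' := by
  have hS : S.Nonempty := Finset.card_pos.1 (by rw [h.card_eq]; omega)
  have hc₁ : S₁.card = 2 * k + 1 := by
    obtain ⟨⟨s, hs, rfl⟩, -⟩ := ha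
    rw [Finset.card_insert_of_notMem (Finset.mem_sdiff.1 hs).2, h.card_eq]
  have hsub₁ : S₁ ⊆ Finset.range n := by
    obtain ⟨⟨s, hs, rfl⟩, -⟩ := ha
    exact Finset.insert_subset (Finset.mem_sdiff.1 hs).1 h.subset
  refine ⟨?_, ?_, fun τ V hτ => ?_⟩
  · obtain ⟨⟨s, -, rfl⟩, -⟩ := hr
    exact (Finset.erase_subset _ _).trans hsub₁
  · obtain ⟨⟨s, hsS, rfl⟩, -⟩ := hr
    rw [Finset.card_erase_of_mem hsS, hc₁]; omega
  · have h1 := hτ.addBest_le hS ha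
    have h2 := hτ.removeBest_le (by omega) hr
    have h3 := h.cost_le τ V hτ
    have h4 := hτ.value_nonneg
    have hk0 : (1 : ℝ) ≤ k := by exact_mod_cast hk
    rw [hc₁] at h2
    push_cast at h2
    set c := medianCost x Z S
    set c₁ := medianCost x Z S₁
    set c' := medianCost x Z S'
    have h5 : k * (c' - c₁) ≤ 2 * V := by
      rcases le_total c' c₁ with hle | hle
      · nlinarith
      · nlinarith
    have h6 : k * (c' - 3 * V) ≤ (k - 1) * (c - 3 * V) := by nlinarith
    have h7 : c' - 3 * V ≤ (1 - 1 / (k : ℝ)) * (c - 3 * V) := by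
      have : (1 - 1 / (k : ℝ)) * (c - 3 * V) = ((k - 1) * (c - 3 * V)) / k := by
        field_simp
      rw [this, le_div_iff₀ (by linarith)]
      linarith
    have h8 : 0 ≤ 1 - 1 / (k : ℝ) := by
      rw [sub_nonneg, div_le_one (by linarith)]; exact hk0
    calc c' - 3 * V ≤ (1 - 1 / (k : ℝ)) * (c - 3 * V) := h7
      _ ≤ (1 - 1 / (k : ℝ)) * ((1 - 1 / (k : ℝ)) ^ i * (2 * n * V)) :=
          mul_le_mul_of_nonneg_left h3 h8
      _ = _ := by ring

/-- Local search starts with cost at most `2 * n * V`. After `n * n` rounds the factor is at most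
`exp (-(n * n / k)) ≤ exp (-n)`, and `2 * n ≤ exp n`; what remains is at most `V`, besides the `3 *
V` of the limit. -/
theorem pow_mul_two_mul_le_one {k n : ℕ} (hk : 1 ≤ k) (hkn : k ≤ n) :
    (1 - 1 / (k : ℝ)) ^ (n * n) * (2 * n) ≤ 1 := by
  have hk0 : (1 : ℝ) ≤ k := by exact_mod_cast hk
  have hkn' : (k : ℝ) ≤ n := by exact_mod_cast hkn
  have h8 : 0 ≤ 1 - 1 / (k : ℝ) := by
    rw [sub_nonneg, div_le_one (by linarith)]; exact hk0
  have h1 : (1 - 1 / (k : ℝ)) ^ (n * n) ≤ Real.exp (-n) := by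
    calc (1 - 1 / (k : ℝ)) ^ (n * n) ≤ (Real.exp (-(1 / (k : ℝ)))) ^ (n * n) :=
          pow_le_pow_left₀ h8 (Real.one_sub_le_exp_neg _) _
      _ = Real.exp ((n * n : ℕ) * -(1 / (k : ℝ))) := (Real.exp_nat_mul _ _).symm
      _ ≤ Real.exp (-n) := by
          apply Real.exp_le_exp.2
          have : (n : ℝ) ≤ n * n / k := by
            rw [le_div_iff₀ (by linarith)]
            exact mul_le_mul_of_nonneg_left hkn' (by linarith)
          have e : ((n * n : ℕ) : ℝ) * -(1 / (k : ℝ)) = -(n * n / k) := by push_cast; ring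
          rw [e]; linarith
  have h2 := Real.quadratic_le_exp_of_nonneg (Nat.cast_nonneg n : (0 : ℝ) ≤ n)
  have h3 : 2 * (n : ℝ) ≤ Real.exp n := by nlinarith [sq_nonneg ((n : ℝ) - 1)]
  calc (1 - 1 / (k : ℝ)) ^ (n * n) * (2 * n) ≤ Real.exp (-n) * Real.exp n :=
        mul_le_mul h1 h3 (by positivity) (Real.exp_pos _).le
    _ = 1 := by rw [← Real.exp_add]; simp

theorem SearchInv.cost_le_four {k : ℕ} (hk : 1 ≤ k) (hkn : k ≤ n) {S : Finset ℕ}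
    (h : SearchInv x n Z k (n * n) S) {τ : ℕ → ℕ} {V : ℝ} (hτ : IsAssignment x n Z k τ V) :
    medianCost x Z S ≤ 4 * V := by
  have h1 := h.cost_le τ V hτ
  have h2 := pow_mul_two_mul_le_one hk hkn
  have h4 := hτ.value_nonneg
  have : (1 - 1 / (k : ℝ)) ^ (n * n) * (2 * n * V) ≤ 1 * V := by
    rw [← mul_assoc]; exact mul_le_mul_of_nonneg_right h2 h4
  linarith

/-- Arbitrary centers can be replaced by data points at the price of a factor `2`. -/
theorem exists_isAssignment (hZ : Z ⊆ Finset.range n) {C : Finset α} (hC : C.Nonempty) :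
    ∃ τ V, IsAssignment x n Z C.card τ V ∧
      V ≤ 2 * ∑ z ∈ Z, Metric.infDist (x z) (C : Set α) := by
  classical
  rcases Z.eq_empty_or_nonempty with rfl | hne
  · exact ⟨id, 0, ⟨by simp, by simp, by simp⟩, by simp⟩
  choose q hq hq' using fun y => exists_nearest C hC y
  -- Each center moves to the point of `Z` nearest to it, which is at least as close to it as any
  -- point of `Z` that it serves; the triangle inequality then gives the factor `2`.
  choose w hw hw' using fun c : α => Z.exists_min_image (fun z => dist c (x z)) hne
  refine ⟨fun z => w (q (x z)), _, ⟨fun z _ => Finset.mem_range.1 (hZ (hw _)), ?_, rfl⟩, ?_⟩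
  · calc (Z.image fun z => w (q (x z))).card ≤ (C.image w).card := Finset.card_le_card (by
          intro y hy
          obtain ⟨z, -, rfl⟩ := Finset.mem_image.1 hy
          exact Finset.mem_image_of_mem _ (hq _))
      _ ≤ C.card := Finset.card_image_le
  · rw [Finset.mul_sum]
    refine Finset.sum_le_sum fun z hz => ?_
    rw [hq']
    have h1 := dist_triangle (x z) (q (x z)) (x (w (q (x z))))
    have h2 := hw' (q (x z)) z hz
    rw [dist_comm (q (x z)) (x z)] at h2
    linarith

end LocalSearch

end PCentrum
end

noncomputable section
namespace PCentrum

/-! ### The coreset -/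

section Coreset

/-- `rep` assigns to each index below `n` a leader: itself, or an earlier leader that is related to
it, and no two leaders are related. -/
structure IsLeaderMap (n : ℕ) (rel : ℕ → ℕ → Prop) (rep : ℕ → ℕ) : Prop where
  lt : ∀ z < n, rep z < n
  idem : ∀ z < n, rep (rep z) = rep z
  eq_or_rel : ∀ z < n, rep z = z ∨ rel (rep z) z
  not_rel : ∀ y z, y < z → z < n → rep y = y → rep z = z → ¬ rel y z

variable {d : ℕ} (x : ℕ → Point d)

/-- The distance of a point to its center. -/
def radius (a : ℕ → ℕ) (z : ℕ) : ℝ := dist (x z) (x (a z))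

/-- The direction of a point as seen from its center. -/
def dir (a : ℕ → ℕ) (z : ℕ) : Point d := (radius x a z)⁻¹ • (x z - x (a z))

theorem radius_nonneg (a : ℕ → ℕ) (z : ℕ) : 0 ≤ radius x a z := dist_nonneg

/-- This includes points that coincide with their center: there the direction is `0`, as the inverse
of `0` is `0`. -/
theorem center_add_smul_dir (a : ℕ → ℕ) (z : ℕ) :
    x (a z) + radius x a z • dir x a z = x z := by
  unfold dir
  by_cases h : radius x a z = 0
  · rw [h, zero_smul, add_zero]
    exact (dist_eq_zero.1 h).symm
  · rw [smul_smul, mul_inv_cancel₀ h, one_smul]; abel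

theorem norm_dir_le (a : ℕ → ℕ) (z : ℕ) : ‖dir x a z‖ ≤ 1 := by
  unfold dir
  rw [norm_smul, ← dist_eq_norm, norm_inv, Real.norm_of_nonneg (radius_nonneg x a z)]
  exact inv_mul_le_one

/-- Inner points (those outside `Z`) are related if they are close to each other, outer ones if they
have the same center and nearly the same direction. -/
def Related (e ρ : ℝ) (Z : Finset ℕ) (a : ℕ → ℕ) (y z : ℕ) : Prop :=
  (y ∉ Z ∧ z ∉ Z ∧ dist (x y) (x z) ≤ e * ρ) ∨
    (y ∈ Z ∧ z ∈ Z ∧ a y = a z ∧ dist (dir x a y) (dir x a z) ≤ e)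

/-- The outer points with leader `g`. -/
abbrev group (Z : Finset ℕ) (rep : ℕ → ℕ) (g : ℕ) : Finset ℕ := Z.filter fun z => rep z = g

/-- The data from which the coreset is made: a set `Z` of at most `p` outer points, centers `S` for
them, leaders, and a partition of each group into buckets; the point `z` moves to `Y z`. -/
structure CoresetData (n k p : ℕ) (e ρ : ℝ) (Z S : Finset ℕ) (a rep b : ℕ → ℕ)
    (Y : ℕ → Point d) : Prop where
  outer_subset : Z ⊆ Finset.range n
  outer_card : Z.card ≤ p
  covered : ∃ T ⊆ Finset.range n, T.card ≤ k ∧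
    ∀ u ∈ Finset.range n \ Z, ∃ v ∈ T, dist (x v) (x u) ≤ 2 * ρ
  rho_nonneg : 0 ≤ ρ
  rho_le : ∀ C : Finset (Point d), C.card = k →
    p * ρ ≤ 2 * topSumOn p n fun z => Metric.infDist (x z) (C : Set (Point d))
  center_card : S.card ≤ 2 * k
  center_mem : ∀ z ∈ Z, a z ∈ S
  sum_radius_le : ∀ C : Finset (Point d), C.card = k →
    ∑ z ∈ Z, radius x a z ≤ 8 * topSumOn p n fun z => Metric.infDist (x z) (C : Set (Point d))
  leader : IsLeaderMap n (Related x e ρ Z a) rep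
  bucketing : ∀ g, IsBucketing (group Z rep g) b (radius x a)
    (e * (∑ z ∈ group Z rep g, radius x a z) / k)
  bucket_card : ∀ g, (((group Z rep g).image b).card : ℝ) ≤ 1 + 2 * k / e
  inner_eq : ∀ z ∈ Finset.range n \ Z, Y z = x (rep z)
  outer_eq : ∀ z ∈ Z, Y z =
    x (a z) + bucketMean (group Z rep (rep z)) b (radius x a) (b z) • dir x a (rep z)

variable {x} {n k p : ℕ} {e ρ : ℝ} {Z S : Finset ℕ} {a rep b : ℕ → ℕ} {Y : ℕ → Point d}

theorem CoresetData.inner_rel (h : CoresetData x n k p e ρ Z S a rep b Y) (he : 0 ≤ e) {z : ℕ}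
    (hz : z ∈ Finset.range n \ Z) : rep z ∉ Z ∧ dist (x (rep z)) (x z) ≤ e * ρ := by
  obtain ⟨h1, h2⟩ := Finset.mem_sdiff.1 hz
  rcases h.leader.eq_or_rel z (Finset.mem_range.1 h1) with h3 | h3 | h3
  · rw [h3, dist_self]
    exact ⟨h2, mul_nonneg he h.rho_nonneg⟩
  · exact ⟨h3.1, h3.2.2⟩
  · exact absurd h3.2.1 h2

theorem CoresetData.outer_rel (h : CoresetData x n k p e ρ Z S a rep b Y) (he : 0 ≤ e) {z : ℕ}
    (hz : z ∈ Z) : rep z ∈ Z ∧ a (rep z) = a z ∧ dist (dir x a (rep z)) (dir x a z) ≤ e := by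
  rcases h.leader.eq_or_rel z (Finset.mem_range.1 (h.outer_subset hz)) with h3 | h3 | h3
  · rw [h3, dist_self]
    exact ⟨hz, rfl, he⟩
  · exact absurd hz h3.2.1
  · exact ⟨h3.1, h3.2.2⟩

theorem abs_max_infDist_sub_le (C : Set (Point d)) (y y' : Point d) (t : ℝ) :
    |max (Metric.infDist y C - t) 0 - max (Metric.infDist y' C - t) 0| ≤ dist y y' := by
  refine (abs_max_sub_max_le_abs _ _ _).trans ?_
  rw [sub_sub_sub_cancel_right]
  have := (Metric.lipschitz_infDist_pt C).dist_le_mul y y'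
  simpa [Real.dist_eq] using this

/-- The outer points contribute an error of at most `5 e` times the sum of the radii. -/
theorem CoresetData.outer_error (h : CoresetData x n k p e ρ Z S a rep b Y) (he : 0 ≤ e)
    (hk : 1 ≤ k) {C : Finset (Point d)} (hC : C.card = k) (t : ℝ) :
    |∑ z ∈ Z, max (Metric.infDist (x z) (C : Set (Point d)) - t) 0 -
      ∑ z ∈ Z, max (Metric.infDist (Y z) (C : Set (Point d)) - t) 0| ≤
        5 * e * ∑ z ∈ Z, radius x a z := by
  classical
  set R := radius x a with hR
  set φ : Point d → ℝ := fun y => max (Metric.infDist y (C : Set (Point d)) - t) 0 with hφ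
  -- The move is split in two: first the direction is replaced by that of the leader at the same
  -- radius, which costs `e` times the radius; then the point moves along the ray of its group to
  -- the mean of its bucket.
  set mid : ℕ → Point d := fun z => x (a z) + R z • dir x a (rep z) with hmid
  have hCne : C.Nonempty := Finset.card_pos.1 (by omega)
  have h1 : |∑ z ∈ Z, φ (x z) - ∑ z ∈ Z, φ (mid z)| ≤ e * ∑ z ∈ Z, R z := by
    rw [← Finset.sum_sub_distrib, Finset.mul_sum]
    refine (Finset.abs_sum_le_sum_abs _ _).trans (Finset.sum_le_sum fun z hz => ?_)
    refine (abs_max_infDist_sub_le _ _ _ _).trans ?_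
    conv_lhs => rw [← center_add_smul_dir x a z]
    simp only [hmid]
    rw [dist_add_left, dist_smul₀, Real.norm_of_nonneg (radius_nonneg x a z), mul_comm]
    refine mul_le_mul_of_nonneg_right ?_ (radius_nonneg x a z)
    rw [dist_comm]
    exact (h.outer_rel he hz).2.2
  have hk0 : (k : ℝ) ≠ 0 := by
    have : k ≠ 0 := by omega
    exact_mod_cast this
  have h2 : |∑ z ∈ Z, φ (mid z) - ∑ z ∈ Z, φ (Y z)| ≤ 4 * e * ∑ z ∈ Z, R z := by
    rw [← Finset.sum_sub_distrib, Finset.mul_sum,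
      ← Finset.sum_fiberwise_of_maps_to (g := rep) (t := Z.image rep)
        (fun z hz => Finset.mem_image_of_mem rep hz),
      ← Finset.sum_fiberwise_of_maps_to (g := rep) (t := Z.image rep)
        (fun z hz => Finset.mem_image_of_mem rep hz)]
    refine (Finset.abs_sum_le_sum_abs _ _).trans (Finset.sum_le_sum fun g _ => ?_)
    have key := (h.bucketing g).abs_sum_infDist_sub_le hCne (x (a g)) (dir x a g)
      (norm_dir_le x a g) t
    rw [hC] at key
    have e1 : ∀ z ∈ group Z rep g, φ (mid z) - φ (Y z) =
        φ (x (a g) + R z • dir x a g) -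
          φ (x (a g) + bucketMean (group Z rep g) b R (b z) • dir x a g) := by
      intro z hz
      obtain ⟨hzZ, rfl⟩ := Finset.mem_filter.1 hz
      rw [h.outer_eq z hzZ, (h.outer_rel he hzZ).2.1]
    rw [Finset.sum_congr rfl e1, Finset.sum_sub_distrib, ← Finset.mul_sum]
    -- With the bucket bound `e * G / k` for a group of radius sum `G`, the error `4 * k * δ`
    -- becomes `4 * e * G`, independent of `k`.
    refine key.trans_eq ?_
    field_simp
    rfl
  calc |∑ z ∈ Z, φ (x z) - ∑ z ∈ Z, φ (Y z)|
      = |(∑ z ∈ Z, φ (x z) - ∑ z ∈ Z, φ (mid z)) + (∑ z ∈ Z, φ (mid z) - ∑ z ∈ Z, φ (Y z))| := by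
        congr 1; ring
    _ ≤ e * ∑ z ∈ Z, R z + 4 * e * ∑ z ∈ Z, R z := (abs_add_le _ _).trans (add_le_add h1 h2)
    _ = _ := by ring

/-- Inner points contribute `p * (e * ρ) ≤ 2 * e * κ`, outer points `5 * e * (8 * κ)`. The
comparison of top sums is applied in both directions, as its hypotheses are symmetric here. -/
theorem CoresetData.abs_cost_sub_le (h : CoresetData x n k p e ρ Z S a rep b Y) (he : 0 ≤ e)
    (hk : 1 ≤ k) (hp : p ≤ n) (hp1 : 1 ≤ p) {C : Finset (Point d)} (hC : C.card = k) :
    |topSumOn p n (fun z => Metric.infDist (Y z) (C : Set (Point d))) -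
      topSumOn p n (fun z => Metric.infDist (x z) (C : Set (Point d)))| ≤
        42 * e * topSumOn p n fun z => Metric.infDist (x z) (C : Set (Point d)) := by
  set κ := topSumOn p n fun z => Metric.infDist (x z) (C : Set (Point d)) with hκ
  have hin : ∀ z ∈ Finset.range n \ Z, |Metric.infDist (x z) (C : Set (Point d)) -
      Metric.infDist (Y z) (C : Set (Point d))| ≤ e * ρ := by
    intro z hz
    have := (Metric.lipschitz_infDist_pt (C : Set (Point d))).dist_le_mul (x z) (Y z)
    rw [Real.dist_eq] at this
    refine this.trans ?_
    rw [h.inner_eq z hz, dist_comm]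
    simpa using (h.inner_rel he hz).2
  have hout := fun t => abs_le.1 (h.outer_error he hk hC t)
  have heρ : 0 ≤ e * ρ := mul_nonneg he h.rho_nonneg
  have hle : (p : ℝ) * (e * ρ) + 5 * e * ∑ z ∈ Z, radius x a z ≤ 42 * e * κ := by
    have h1 := mul_le_mul_of_nonneg_left (h.rho_le C hC) he
    have h2 := mul_le_mul_of_nonneg_left (h.sum_radius_le C hC) he
    rw [← hκ] at h1 h2
    nlinarith
  rw [abs_le]
  constructor
  · have := topSumOn_le_topSumOn_add hp hp1
      (f := fun z => Metric.infDist (Y z) (C : Set (Point d)))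
      (h := fun z => Metric.infDist (x z) (C : Set (Point d)))
      (fun _ => Metric.infDist_nonneg) h.outer_subset heρ
      (fun z hz => by have := (abs_le.1 (hin z hz)).2; linarith)
      (E := 5 * e * ∑ z ∈ Z, radius x a z) (fun t _ => by linarith [(hout t).2])
    linarith
  · have := topSumOn_le_topSumOn_add hp hp1
      (f := fun z => Metric.infDist (x z) (C : Set (Point d)))
      (h := fun z => Metric.infDist (Y z) (C : Set (Point d)))
      (fun _ => Metric.infDist_nonneg) h.outer_subset heρ
      (fun z hz => by have := (abs_le.1 (hin z hz)).1; linarith)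
      (E := 5 * e * ∑ z ∈ Z, radius x a z) (fun t _ => by linarith [(hout t).1])
    linarith

/-! ### The number of distinct images -/

theorem CoresetData.inner_card_le [DecidableEq (Point d)]
    (h : CoresetData x n k p e ρ Z S a rep b Y) (he : 0 < e) :
    (((Finset.range n \ Z).image Y).card : ℝ) ≤ k * (1 + 4 / e) ^ d := by
  classical
  obtain ⟨T, -, hTk, hT⟩ := h.covered
  -- Images of inner points are inner leaders. These lie in at most `k` balls of radius `2 * ρ` and
  -- have mutual distances above `e * ρ`, so packing applies in each ball.
  set P : ℕ → Finset (Point d) := fun v => ((Finset.range n \ Z).filter fun y =>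
    rep y = y ∧ dist (x v) (x y) ≤ 2 * ρ).image x with hP
  have hsub : (Finset.range n \ Z).image Y ⊆ T.biUnion P := by
    intro y hy
    obtain ⟨z, hz, rfl⟩ := Finset.mem_image.1 hy
    have hzn := Finset.mem_range.1 (Finset.mem_sdiff.1 hz).1
    have hr : rep z ∈ Finset.range n \ Z :=
      Finset.mem_sdiff.2 ⟨Finset.mem_range.2 (h.leader.lt z hzn), (h.inner_rel he.le hz).1⟩
    obtain ⟨v, hv, hvd⟩ := hT _ hr
    refine Finset.mem_biUnion.2 ⟨v, hv, ?_⟩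
    rw [h.inner_eq z hz]
    exact Finset.mem_image_of_mem _ (Finset.mem_filter.2 ⟨hr, h.leader.idem z hzn, hvd⟩)
  have hPc : ∀ v ∈ T, ((P v).card : ℝ) ≤ (1 + 4 / e) ^ d := by
    intro v _
    have hball : ∀ y ∈ P v, dist y (x v) ≤ 2 * ρ := by
      intro y hy
      obtain ⟨z, hz, rfl⟩ := Finset.mem_image.1 hy
      rw [dist_comm]; exact (Finset.mem_filter.1 hz).2.2
    have hsep : ∀ y ∈ P v, ∀ y' ∈ P v, y ≠ y' → e * ρ ≤ dist y y' := by
      have aux : ∀ z ∈ Finset.range n \ Z, ∀ z' ∈ Finset.range n \ Z, rep z = z → rep z' = z' →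
          z < z' → e * ρ ≤ dist (x z) (x z') := by
        intro z hz z' hz' hr hr' hlt
        by_contra! hcon
        refine h.leader.not_rel z z' hlt (Finset.mem_range.1 (Finset.mem_sdiff.1 hz').1) hr hr'
          (Or.inl ⟨(Finset.mem_sdiff.1 hz).2, (Finset.mem_sdiff.1 hz').2, hcon.le⟩)
      intro y hy y' hy' hne
      obtain ⟨z, hz, rfl⟩ := Finset.mem_image.1 hy
      obtain ⟨z', hz', rfl⟩ := Finset.mem_image.1 hy'
      have hz := Finset.mem_filter.1 hz
      have hz' := Finset.mem_filter.1 hz'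
      rcases lt_trichotomy z z' with hlt | heq | hlt
      · exact aux z hz.1 z' hz'.1 hz.2.1 hz'.2.1 hlt
      · exact absurd (congrArg x heq) hne
      · rw [dist_comm]; exact aux z' hz'.1 z hz.1 hz'.2.1 hz.2.1 hlt
    -- For `ρ = 0` the separation is void, but then each ball is a single point.
    rcases h.rho_nonneg.eq_or_lt with h0 | hpos
    · have : (P v).card ≤ 1 := by
        refine Finset.card_le_one.2 fun y hy y' hy' => ?_
        have h1 := hball y hy
        have h2 := hball y' hy'
        rw [← h0, mul_zero] at h1 h2
        rw [dist_le_zero.1 h1, dist_le_zero.1 h2]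
      calc ((P v).card : ℝ) ≤ 1 := by exact_mod_cast this
        _ ≤ _ := one_le_pow₀ (by have : 0 < 4 / e := by positivity
                                 linarith)
    · have := card_le_of_separated (P v) (x v) (σ := e * ρ) (R := 2 * ρ) (by positivity)
        (by positivity) hball hsep
      refine this.trans_eq ?_
      congr 2
      field_simp
      norm_num
  calc (((Finset.range n \ Z).image Y).card : ℝ) ≤ (T.biUnion P).card := by
        exact_mod_cast Finset.card_le_card hsub
    _ ≤ ∑ v ∈ T, ((P v).card : ℝ) := by exact_mod_cast Finset.card_biUnion_le
    _ ≤ ∑ v ∈ T, (1 + 4 / e) ^ d := Finset.sum_le_sum hPc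
    _ = T.card * (1 + 4 / e) ^ d := by rw [Finset.sum_const, nsmul_eq_mul]
    _ ≤ _ := mul_le_mul_of_nonneg_right (by exact_mod_cast hTk) (by positivity)

/-- The three factors count the centers, the leaders with a given center (their directions are
separated by `e` in the unit ball), and the buckets of a group. -/
theorem CoresetData.outer_card_le [DecidableEq (Point d)]
    (h : CoresetData x n k p e ρ Z S a rep b Y) (he : 0 < e) :
    ((Z.image Y).card : ℝ) ≤ 2 * k * (1 + 2 / e) ^ d * (1 + 2 * k / e) := by
  classical
  set L := Z.filter fun z => rep z = z with hL
  have hLc : (L.card : ℝ) ≤ 2 * k * (1 + 2 / e) ^ d := by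
    have hmaps : ∀ z ∈ L, a z ∈ S := fun z hz => h.center_mem z (Finset.mem_filter.1 hz).1
    rw [Finset.card_eq_sum_card_fiberwise hmaps]
    push_cast
    have hfib : ∀ s ∈ S, ((L.filter fun z => a z = s).card : ℝ) ≤ (1 + 2 / e) ^ d := by
      intro s _
      have aux : ∀ z ∈ L, ∀ z' ∈ L, a z = a z' → z < z' →
          e < dist (dir x a z) (dir x a z') := by
        intro z hz z' hz' haz hlt
        by_contra! hcon
        obtain ⟨hz, hr⟩ := Finset.mem_filter.1 hz
        obtain ⟨hz', hr'⟩ := Finset.mem_filter.1 hz'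
        exact h.leader.not_rel z z' hlt (Finset.mem_range.1 (h.outer_subset hz')) hr hr'
          (Or.inr ⟨hz, hz', haz, hcon⟩)
      have aux' : ∀ z ∈ L, ∀ z' ∈ L, a z = a z' → z ≠ z' →
          e < dist (dir x a z) (dir x a z') := by
        intro z hz z' hz' haz hne
        rcases lt_or_gt_of_ne hne with hlt | hlt
        · exact aux z hz z' hz' haz hlt
        · rw [dist_comm]; exact aux z' hz' z hz haz.symm hlt
      -- Packing counts directions; since `e > 0`, leaders with the same center are determined by
      -- their directions.
      have hinj : Set.InjOn (dir x a) (L.filter fun z => a z = s : Finset ℕ) := by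
        intro z hz z' hz' heq
        obtain ⟨hz, hzs⟩ := Finset.mem_filter.1 (Finset.mem_coe.1 hz)
        obtain ⟨hz', hzs'⟩ := Finset.mem_filter.1 (Finset.mem_coe.1 hz')
        by_contra hne
        have := aux' z hz z' hz' (hzs.trans hzs'.symm) hne
        rw [heq, dist_self] at this
        linarith
      rw [← Finset.card_image_of_injOn hinj]
      have := card_le_of_separated ((L.filter fun z => a z = s).image (dir x a)) 0 (σ := e)
        (R := 1) he zero_le_one (by
          intro y hy
          obtain ⟨z, -, rfl⟩ := Finset.mem_image.1 hy
          rw [dist_zero_right]; exact norm_dir_le x a z) (by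
          intro y hy y' hy' hne
          obtain ⟨z, hz, rfl⟩ := Finset.mem_image.1 hy
          obtain ⟨z', hz', rfl⟩ := Finset.mem_image.1 hy'
          obtain ⟨hz, hzs⟩ := Finset.mem_filter.1 hz
          obtain ⟨hz', hzs'⟩ := Finset.mem_filter.1 hz'
          exact (aux' z hz z' hz' (hzs.trans hzs'.symm) fun hh => hne (congrArg _ hh)).le)
      simpa using this
    refine (Finset.sum_le_sum hfib).trans ?_
    rw [Finset.sum_const, nsmul_eq_mul]
    exact mul_le_mul_of_nonneg_right (by exact_mod_cast h.center_card) (by positivity)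
  have hsub : Z.image Y ⊆ L.biUnion fun g => (group Z rep g).image Y := by
    intro y hy
    obtain ⟨z, hz, rfl⟩ := Finset.mem_image.1 hy
    refine Finset.mem_biUnion.2 ⟨rep z, Finset.mem_filter.2 ⟨(h.outer_rel he.le hz).1,
      h.leader.idem z (Finset.mem_range.1 (h.outer_subset hz))⟩,
      Finset.mem_image_of_mem _ (Finset.mem_filter.2 ⟨hz, rfl⟩)⟩
  have hgr : ∀ g ∈ L, (((group Z rep g).image Y).card : ℝ) ≤ 1 + 2 * k / e := by
    intro g _
    refine le_trans ?_ (h.bucket_card g)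
    have : (group Z rep g).image Y ⊆ ((group Z rep g).image b).image fun β =>
        x (a g) + bucketMean (group Z rep g) b (radius x a) β • dir x a g := by
      intro y hy
      obtain ⟨z, hz, rfl⟩ := Finset.mem_image.1 hy
      refine Finset.mem_image.2 ⟨b z, Finset.mem_image_of_mem _ hz, ?_⟩
      obtain ⟨hzZ, rfl⟩ := Finset.mem_filter.1 hz
      rw [h.outer_eq z hzZ, (h.outer_rel he.le hzZ).2.1]
    exact_mod_cast (Finset.card_le_card this).trans Finset.card_image_le
  calc ((Z.image Y).card : ℝ) ≤ (L.biUnion fun g => (group Z rep g).image Y).card := by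
        exact_mod_cast Finset.card_le_card hsub
    _ ≤ ∑ g ∈ L, (((group Z rep g).image Y).card : ℝ) := by
        exact_mod_cast Finset.card_biUnion_le
    _ ≤ ∑ g ∈ L, (1 + 2 * k / e) := Finset.sum_le_sum hgr
    _ = L.card * (1 + 2 * k / e) := by rw [Finset.sum_const, nsmul_eq_mul]
    _ ≤ _ := mul_le_mul_of_nonneg_right hLc (by positivity)

/-- With `e = ε / 64`, each base of a `d`-th power is below `300 / ε`. The last factor `300` pays
for the remaining `k * (ε + 258 * k) ≤ 259 * k ^ 2`. -/
theorem size_bound_le {ε : ℝ} (hε : 0 < ε) (hε1 : ε < 1) (d : ℕ) {k : ℕ} (hk : 1 ≤ k) :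
    k * (1 + 4 / (ε / 64)) ^ d + 2 * k * (1 + 2 / (ε / 64)) ^ d * (1 + 2 * k / (ε / 64)) ≤
      (300 : ℝ) ^ (d + 1) * k ^ 2 / ε ^ (d + 1) := by
  have hk0 : (1 : ℝ) ≤ k := by exact_mod_cast hk
  have h1 : 1 + 4 / (ε / 64) ≤ 300 / ε := by
    rw [show 1 + 4 / (ε / 64) = (ε + 256) / ε by field_simp; norm_num]
    exact div_le_div_of_nonneg_right (by linarith) hε.le
  have h2 : 1 + 2 / (ε / 64) ≤ 300 / ε := by
    rw [show 1 + 2 / (ε / 64) = (ε + 128) / ε by field_simp; norm_num]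
    exact div_le_div_of_nonneg_right (by linarith) hε.le
  have h3 : 1 + 2 * k / (ε / 64) ≤ 129 * k / ε := by
    rw [show 1 + 2 * k / (ε / 64) = (ε + 128 * k) / ε by field_simp; ring]
    exact div_le_div_of_nonneg_right (by linarith) hε.le
  have p1 : (1 + 4 / (ε / 64)) ^ d ≤ (300 / ε) ^ d := pow_le_pow_left₀ (by positivity) h1 d
  have p2 : (1 + 2 / (ε / 64)) ^ d ≤ (300 / ε) ^ d := pow_le_pow_left₀ (by positivity) h2 d
  have hq : 0 < (300 / ε) ^ d := by positivity
  calc _ ≤ k * (300 / ε) ^ d + 2 * k * (300 / ε) ^ d * (129 * k / ε) := by gcongr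
    _ = (300 / ε) ^ d * (k * (ε + 258 * k) / ε) := by field_simp; ring
    _ ≤ (300 / ε) ^ d * (300 * k ^ 2 / ε) := by
        refine mul_le_mul_of_nonneg_left (div_le_div_of_nonneg_right ?_ hε.le) hq.le
        nlinarith
    _ = _ := by rw [div_pow]; field_simp; ring

theorem CoresetData.size_le [DecidableEq (Point d)] {ε : ℝ}
    (h : CoresetData x n k p (ε / 64) ρ Z S a rep b Y) (hε : 0 < ε) (hε1 : ε < 1) (hk : 1 ≤ k) :
    (((Finset.range n).image Y).card : ℝ) ≤ (300 : ℝ) ^ (d + 1) * k ^ 2 / ε ^ (d + 1) := by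
  refine le_trans ?_ (size_bound_le hε hε1 d hk)
  have h1 := h.inner_card_le (by positivity)
  have h2 := h.outer_card_le (by positivity)
  have h3 : ((Finset.range n).image Y).card ≤
      ((Finset.range n \ Z).image Y).card + (Z.image Y).card := by
    conv_lhs => rw [← Finset.sdiff_union_of_subset h.outer_subset, Finset.image_union]
    exact Finset.card_union_le _ _
  have h3' : (((Finset.range n).image Y).card : ℝ) ≤
      ((Finset.range n \ Z).image Y).card + (Z.image Y).card := by exact_mod_cast h3
  linarith

end Coreset

/-! ### From indexed families of points to multisets -/

section Output

variable {d n : ℕ}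

/-- The data points as a family indexed by all natural numbers. -/
def extend (x : Fin n → Point d) (i : ℕ) : Point d := if h : i < n then x ⟨i, h⟩ else 0

theorem extend_of_lt (x : Fin n → Point d) {i : ℕ} (h : i < n) : extend x i = x ⟨i, h⟩ := dif_pos h

theorem univ_map_val (x : Fin n ↪ Point d) :
    (Finset.univ.map x).val = (Finset.range n).val.map (extend x) := by
  have : (Finset.range n).val = (Finset.univ : Finset (Fin n)).val.map Fin.val := by
    have := congrArg Finset.val (Fin.map_valEmbedding_univ (n := n))
    rw [Nat.Iio_eq_range] at this
    exact this.symm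
  rw [this, Multiset.map_map, Finset.map_val]
  refine Multiset.map_congr rfl fun i _ => ?_
  simp [extend]

theorem isCoreset_of_abs_le {k p : ℕ} {ε : ℝ} (x : Fin n ↪ Point d) (Y : ℕ → Point d)
    (h : ∀ C : Finset (Point d), C.card = k →
      |topSumOn p n (fun z => Metric.infDist (Y z) (C : Set (Point d))) -
        topSumOn p n (fun z => Metric.infDist (extend x z) (C : Set (Point d)))| ≤
          ε * topSumOn p n fun z => Metric.infDist (extend x z) (C : Set (Point d))) :
    IsCoreset k p ε (Finset.univ.map x) ((Finset.range n).val.map Y) := by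
  refine ⟨by simp, fun C hC => ?_⟩
  have h1 : cost p (Finset.univ.map x).val C =
      topSumOn p n fun z => Metric.infDist (extend x z) (C : Set (Point d)) := by
    rw [cost, univ_map_val, Multiset.map_map]; rfl
  have h2 : cost p ((Finset.range n).val.map Y) C =
      topSumOn p n fun z => Metric.infDist (Y z) (C : Set (Point d)) := by
    rw [cost, Multiset.map_map]; rfl
  rw [h1, h2]
  obtain ⟨h3, h4⟩ := abs_le.1 (h C hC)
  constructor <;> linarith

theorem coresetSize_eq [DecidableEq (Point d)] (Y : ℕ → Point d) :
    coresetSize ((Finset.range n).val.map Y) = ((Finset.range n).image Y).card := by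
  unfold coresetSize Finset.image
  congr!

end Output

end PCentrum
end

noncomputable section
namespace PCentrum

/-! ### Programs with bounded loops -/

@[simp] theorem Memory.setNat_nat (s : Memory) (a i v b : ℕ) :
    (s.setNat a i v).nat b = if b = a then Function.update (s.nat a) i v else s.nat b := by
  unfold Memory.setNat
  by_cases h : b = a
  · subst h; simp
  · simp [h]

@[simp] theorem Memory.setNat_real (s : Memory) (a i v b : ℕ) :
    (s.setNat a i v).real b = s.real b := rfl

@[simp] theorem Memory.setReal_nat (s : Memory) (a i : ℕ) (v : ℝ) (b : ℕ) :
    (s.setReal a i v).nat b = s.nat b := rfl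

@[simp] theorem Memory.setReal_real (s : Memory) (a i : ℕ) (v : ℝ) (b : ℕ) :
    (s.setReal a i v).real b = if b = a then Function.update (s.real a) i v else s.real b := by
  unfold Memory.setReal
  by_cases h : b = a
  · subst h; simp
  · simp [h]

attribute [simp] NatExpr.eval RealExpr.eval Test.Holds

/-- Programs whose loops run through the numbers below a bound that is evaluated before the loop
starts and that is cut off at `n + d`; the loop counter is cell `0` of the array `v`, and the bound is
in cell `1`. -/
inductive Cmd : Type
  | skip
  | setNat (a : ℕ) (i e : NatExpr)
  | setReal (a : ℕ) (i : NatExpr) (e : RealExpr)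
  | seq (P Q : Cmd)
  | ite (b : Test) (P Q : Cmd)
  | for_ (v : ℕ) (e : NatExpr) (P : Cmd)

notation:60 P:61 ";;" Q:60 => Cmd.seq P Q

namespace Cmd

/-- The body of a loop, followed by the increment of the counter. -/
def advance (v : ℕ) (f : Memory → Memory) (s : Memory) : Memory :=
  (f s).setNat v 0 ((f s).nat v 0 + 1)

/-- The number of rounds of a loop. -/
def rounds (e : NatExpr) (s : Memory) : ℕ := min (e.eval s) (s.nat 0 0 + s.nat 0 1)

/-- The initialization of a loop. -/
def start (v : ℕ) (e : NatExpr) (s : Memory) : Memory := (s.setNat v 1 (e.eval s)).setNat v 0 0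

open Classical in
/-- The effect of a program. -/
def den : Cmd → Memory → Memory
  | skip, s => s
  | setNat a i e, s => s.setNat a (i.eval s) (e.eval s)
  | setReal a i e, s => s.setReal a (i.eval s) (e.eval s)
  | seq P Q, s => Q.den (P.den s)
  | ite b P Q, s => if b.Holds s then P.den s else Q.den s
  | for_ v e P, s => (advance v P.den)^[rounds e s] (start v e s)

theorem den_seq (P Q : Cmd) (s : Memory) : (P ;; Q).den s = Q.den (P.den s) := rfl

theorem den_ite_pos {b : Test} {P Q : Cmd} {s : Memory} (h : b.Holds s) :
    (ite b P Q).den s = P.den s := if_pos h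

theorem den_ite_neg {b : Test} {P Q : Cmd} {s : Memory} (h : ¬ b.Holds s) :
    (ite b P Q).den s = Q.den s := if_neg h

/-- The test that guards a loop. -/
def guard (v : ℕ) : Test :=
  .and (.natLe (.add (.read v (.const 0)) (.const 1)) (.read v (.const 1)))
    (.natLe (.add (.read v (.const 0)) (.const 1))
      (.add (.read 0 (.const 0)) (.read 0 (.const 1))))

/-- Translation to a program of the real RAM. -/
def toProg : Cmd → Prog
  | skip => .skip
  | setNat a i e => .setNat a i e
  | setReal a i e => .setReal a i e
  | seq P Q => .seq P.toProg Q.toProg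
  | ite b P Q => .ite b P.toProg Q.toProg
  | for_ v e P => .seq (.setNat v (.const 1) e) (.seq (.setNat v (.const 0) (.const 0))
      (.loop (guard v) (.seq P.toProg
        (.setNat v (.const 0) (.add (.read v (.const 0)) (.const 1))))))

/-- Whether a program writes into an array of naturals. -/
def wN : Cmd → ℕ → Bool
  | skip, _ => false
  | setNat a _ _, b => b == a
  | setReal _ _ _, _ => false
  | seq P Q, b => P.wN b || Q.wN b
  | ite _ P Q, b => P.wN b || Q.wN b
  | for_ v _ P, b => b == v || P.wN b

/-- Whether a program writes into an array of reals. -/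
def wR : Cmd → ℕ → Bool
  | skip, _ => false
  | setNat _ _ _, _ => false
  | setReal a _ _, b => b == a
  | seq P Q, b => P.wR b || Q.wR b
  | ite _ P Q, b => P.wR b || Q.wR b
  | for_ _ _ P, b => P.wR b

/-- Loop bodies change neither their counters nor the array `0`. -/
def WF : Cmd → Bool
  | skip => true
  | setNat _ _ _ => true
  | setReal _ _ _ => true
  | seq P Q => P.WF && Q.WF
  | ite _ P Q => P.WF && Q.WF
  | for_ v _ P => v != 0 && !P.wN v && !P.wN 0 && P.WF

open Polynomial in
/-- A bound for the number of steps as a polynomial in `n + d`. -/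
def time : Cmd → ℕ[X]
  | skip => C 1
  | setNat _ i e => C (i.steps + e.steps + 1)
  | setReal _ i e => C (i.steps + e.steps + 1)
  | seq P Q => P.time + Q.time
  | ite b P Q => C b.steps + (P.time + Q.time)
  | for_ v e P => C (e.steps + 5 + (guard v).steps) + X * (C ((guard v).steps + 6) + P.time)

/-- The two memories agree on all arrays that the program does not write into. -/
def AgreeOff (c : Cmd) (s s' : Memory) : Prop :=
  (∀ b, c.wN b = false → s'.nat b = s.nat b) ∧ ∀ b, c.wR b = false → s'.real b = s.real b

theorem AgreeOff.refl (c : Cmd) (s : Memory) : AgreeOff c s s := ⟨fun _ _ => rfl, fun _ _ => rfl⟩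

theorem AgreeOff.trans {c : Cmd} {s s' s'' : Memory} (h : AgreeOff c s s') (h' : AgreeOff c s' s'') :
    AgreeOff c s s'' :=
  ⟨fun b hb => (h'.1 b hb).trans (h.1 b hb), fun b hb => (h'.2 b hb).trans (h.2 b hb)⟩

theorem AgreeOff.mono {c c' : Cmd} {s s' : Memory} (h : AgreeOff c s s')
    (hN : ∀ b, c'.wN b = false → c.wN b = false) (hR : ∀ b, c'.wR b = false → c.wR b = false) :
    AgreeOff c' s s' :=
  ⟨fun b hb => h.1 b (hN b hb), fun b hb => h.2 b (hR b hb)⟩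

theorem agreeOff_start (v : ℕ) (e : NatExpr) (P : Cmd) (s : Memory) :
    AgreeOff (for_ v e P) s (start v e s) := by
  refine ⟨fun b hb => ?_, fun b _ => rfl⟩
  simp only [wN, Bool.or_eq_false_iff, beq_eq_false_iff_ne] at hb
  simp [start, hb.1]

theorem agreeOff_advance {v : ℕ} {e : NatExpr} {P : Cmd} {s : Memory}
    (h : AgreeOff P s (P.den s)) : AgreeOff (for_ v e P) s (advance v P.den s) := by
  refine ⟨fun b hb => ?_, fun b hb => ?_⟩
  · simp only [wN, Bool.or_eq_false_iff, beq_eq_false_iff_ne] at hb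
    simp [advance, hb.1, h.1 b hb.2]
  · simp only [wR] at hb
    simp [advance, h.2 b hb]

theorem agreeOff_den (c : Cmd) (s : Memory) : AgreeOff c s (c.den s) := by
  induction c generalizing s with
  | skip => exact AgreeOff.refl _ _
  | setNat a i e =>
    refine ⟨fun b hb => ?_, fun b _ => rfl⟩
    simp only [wN, beq_eq_false_iff_ne] at hb
    simp [den, hb]
  | setReal a i e =>
    refine ⟨fun b _ => rfl, fun b hb => ?_⟩
    simp only [wR, beq_eq_false_iff_ne] at hb
    simp [den, hb]
  | seq P Q ihP ihQ =>
    refine ⟨fun b hb => ?_, fun b hb => ?_⟩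
    · simp only [wN, Bool.or_eq_false_iff] at hb
      exact ((ihQ _).1 b hb.2).trans ((ihP _).1 b hb.1)
    · simp only [wR, Bool.or_eq_false_iff] at hb
      exact ((ihQ _).2 b hb.2).trans ((ihP _).2 b hb.1)
  | ite t P Q ihP ihQ =>
    refine ⟨fun b hb => ?_, fun b hb => ?_⟩
    · simp only [wN, Bool.or_eq_false_iff] at hb
      simp only [den]
      split_ifs
      · exact (ihP _).1 b hb.1
      · exact (ihQ _).1 b hb.2
    · simp only [wR, Bool.or_eq_false_iff] at hb
      simp only [den]
      split_ifs
      · exact (ihP _).2 b hb.1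
      · exact (ihQ _).2 b hb.2
  | for_ v e P ih =>
    simp only [den]
    induction rounds e s with
    | zero => exact agreeOff_start v e P s
    | succ N ihN =>
      rw [Function.iterate_succ_apply']
      exact ihN.trans (agreeOff_advance (ih _))

theorem den_nat_of_not_writes {c : Cmd} {b : ℕ} (h : c.wN b = false) (s : Memory) :
    (c.den s).nat b = s.nat b := (agreeOff_den c s).1 b h

theorem den_real_of_not_writes {c : Cmd} {b : ℕ} (h : c.wR b = false) (s : Memory) :
    (c.den s).real b = s.real b := (agreeOff_den c s).2 b h

/-- The memory in the `i`-th round of a loop. -/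
theorem iterate_advance {v : ℕ} {e : NatExpr} {P : Cmd} (hv : P.wN v = false) (s : Memory) (i : ℕ) :
    AgreeOff (for_ v e P) s ((advance v P.den)^[i] (start v e s)) ∧
      ((advance v P.den)^[i] (start v e s)).nat v 0 = i ∧
      ((advance v P.den)^[i] (start v e s)).nat v 1 = e.eval s := by
  induction i with
  | zero => exact ⟨agreeOff_start v e P s, by simp [start], by simp [start]⟩
  | succ i ih =>
    rw [Function.iterate_succ_apply']
    refine ⟨ih.1.trans (agreeOff_advance (agreeOff_den P _)), ?_, ?_⟩
    · simp [advance, den_nat_of_not_writes hv, ih.2.1]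
    · simp [advance, den_nat_of_not_writes hv, ih.2.2]

/-- The invariant rule for loops. -/
theorem den_for {v : ℕ} {e : NatExpr} {P : Cmd} {s : Memory} {N : ℕ} (hv : P.wN v = false)
    (hN : rounds e s = N) (I : ℕ → Memory → Prop)
    (hI : ∀ i s' j y, I i s' → I i (s'.setNat v j y)) (h0 : I 0 s)
    (hstep : ∀ i < N, ∀ s', AgreeOff (for_ v e P) s s' → s'.nat v 0 = i → I i s' →
      I (i + 1) (P.den s')) : I N ((for_ v e P).den s) := by
  simp only [den, hN]
  suffices ∀ i ≤ N, I i ((advance v P.den)^[i] (start v e s)) from this N le_rfl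
  intro i
  induction i with
  -- Initialization and increments of the counter write only into the array `v`, which the invariant
  -- ignores by `hI`.
  | zero => intro _; exact hI _ _ _ _ (hI _ _ _ _ h0)
  | succ i ih =>
    intro hi
    rw [Function.iterate_succ_apply']
    obtain ⟨h1, h2, -⟩ := iterate_advance (e := e) hv s i
    exact hI _ _ _ _ (hstep i hi _ h1 h2 (ih (by omega)))

theorem exec_loop {b : Test} {P : Prog} {f : Memory → Memory} {T : ℕ} (N : ℕ) (s : Memory)
    (h : ∀ i < N, b.Holds (f^[i] s) ∧ ∃ t ≤ T, Exec P (f^[i] s) t (f^[i + 1] s))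
    (hN : ¬ b.Holds (f^[N] s)) :
    ∃ t ≤ N * (b.steps + T) + b.steps, Exec (.loop b P) s t (f^[N] s) := by
  induction N generalizing s with
  | zero => exact ⟨b.steps, by simp, Exec.loop_false hN⟩
  | succ N ih =>
    obtain ⟨t', ht', he'⟩ := ih (f s) (fun i hi => h (i + 1) (by omega)) hN
    obtain ⟨hb, t, ht, he⟩ := h 0 (by omega)
    refine ⟨b.steps + t + t', ?_, Exec.loop_true hb he he'⟩
    rw [Nat.succ_mul]; omega

/-- Programs halt within their time bound. -/
theorem exec_toProg (c : Cmd) (hc : c.WF = true) (h0 : c.wN 0 = false) (s : Memory) {M : ℕ}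
    (hM : s.nat 0 0 + s.nat 0 1 = M) : ∃ t ≤ c.time.eval M, Exec c.toProg s t (c.den s) := by
  induction c generalizing s with
  | skip => exact ⟨1, by simp [time], Exec.skip s⟩
  | setNat a i e => exact ⟨_, by simp [time], Exec.setNat a i e s⟩
  | setReal a i e => exact ⟨_, by simp [time], Exec.setReal a i e s⟩
  | seq P Q ihP ihQ =>
    simp only [WF, Bool.and_eq_true] at hc
    simp only [wN, Bool.or_eq_false_iff] at h0
    obtain ⟨t, ht, he⟩ := ihP hc.1 h0.1 s hM
    obtain ⟨t', ht', he'⟩ := ihQ hc.2 h0.2 (P.den s) (by rw [den_nat_of_not_writes h0.1]; exact hM)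
    exact ⟨t + t', by simp only [time, Polynomial.eval_add]; omega, Exec.seq he he'⟩
  | ite b P Q ihP ihQ =>
    simp only [WF, Bool.and_eq_true] at hc
    simp only [wN, Bool.or_eq_false_iff] at h0
    simp only [time, Polynomial.eval_add, Polynomial.eval_C, den, toProg]
    by_cases hb : b.Holds s
    · obtain ⟨t, ht, he⟩ := ihP hc.1 h0.1 s hM
      rw [if_pos hb]
      exact ⟨b.steps + t, by omega, Exec.ite_true hb he⟩
    · obtain ⟨t, ht, he⟩ := ihQ hc.2 h0.2 s hM
      rw [if_neg hb]
      exact ⟨b.steps + t, by omega, Exec.ite_false hb he⟩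
  | for_ v e P ih =>
    simp only [WF, Bool.and_eq_true, bne_iff_ne, ne_eq, Bool.not_eq_true'] at hc
    obtain ⟨⟨⟨hv0, hv⟩, hP0⟩, hPWF⟩ := hc
    have hinv := iterate_advance (e := e) hv s
    have hM' : ∀ i, ((advance v P.den)^[i] (start v e s)).nat 0 0 +
        ((advance v P.den)^[i] (start v e s)).nat 0 1 = M := by
      intro i
      rw [(hinv i).1.1 0 h0]; exact hM
    -- A well-formed body changes neither its counter, nor the stored bound, nor `n` and `d` in the
    -- array `0`. So the guard, reevaluated in every round, holds in exactly the first `rounds e s`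
    -- rounds.
    have hguard : ∀ i, (guard v).Holds ((advance v P.den)^[i] (start v e s)) ↔
        i < rounds e s := by
      intro i
      simp only [guard, Test.Holds, NatExpr.eval, (hinv i).2.1, (hinv i).2.2, hM', rounds, hM,
        lt_min_iff]
      omega
    obtain ⟨t, ht, he⟩ := exec_loop (b := guard v) (P := .seq P.toProg
        (.setNat v (.const 0) (.add (.read v (.const 0)) (.const 1)))) (f := advance v P.den)
        (T := P.time.eval M + 6) (rounds e s) (start v e s) (by
          intro i hi
          refine ⟨(hguard i).2 hi, ?_⟩
          obtain ⟨t, ht, he⟩ := ih hPWF hP0 _ (hM' i)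
          refine ⟨_, ?_, Exec.seq he (by
            rw [Function.iterate_succ_apply']; exact Exec.setNat v _ _ _)⟩
          simp only [NatExpr.steps]; omega) (by rw [hguard]; omega)
    refine ⟨_, ?_, Exec.seq (Exec.setNat v (.const 1) e s)
      (Exec.seq (Exec.setNat v (.const 0) (.const 0) _) he)⟩
    simp only [NatExpr.steps, time, Polynomial.eval_add, Polynomial.eval_mul, Polynomial.eval_C,
      Polynomial.eval_X]
    -- The cut-off makes this true whatever the value of `e` is; each loop thus contributes one
    -- factor `X` to the time bound.
    have hr : rounds e s ≤ M := (min_le_right _ _).trans_eq hM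
    have := Nat.mul_le_mul_right ((guard v).steps + (P.time.eval M + 6)) hr
    have e1 : (guard v).steps + 6 + P.time.eval M = (guard v).steps + (P.time.eval M + 6) := by ring
    rw [e1]
    omega

/-! ### Loops that compute sums, tables and minima -/

/-- Sum of the values of `E` after `c`, over the rounds of a loop. -/
def sumLoop (v : ℕ) (e : NatExpr) (acc : ℕ) (c : Cmd) (E : RealExpr) : Cmd :=
  setReal acc (.const 0) (.ofNat (.const 0)) ;;
    for_ v e (c ;; setReal acc (.const 0) (.add (.read acc (.const 0)) E))

theorem AgreeOff.seq {P Q : Cmd} {s s' s'' : Memory} (h : AgreeOff P s s')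
    (h' : AgreeOff Q s' s'') : AgreeOff (P ;; Q) s s'' := by
  refine ⟨fun b hb => ?_, fun b hb => ?_⟩
  · simp only [wN, Bool.or_eq_false_iff] at hb
    exact (h'.1 b hb.2).trans (h.1 b hb.1)
  · simp only [wR, Bool.or_eq_false_iff] at hb
    exact (h'.2 b hb.2).trans (h.2 b hb.1)

theorem eval_setReal (e : NatExpr) (s : Memory) (a i : ℕ) (v : ℝ) :
    e.eval (s.setReal a i v) = e.eval s := by
  induction e with
  | const c => rfl
  | read a i ih => simp only [NatExpr.eval, ih, Memory.setReal_nat]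
  | add e f ihe ihf => simp only [NatExpr.eval, ihe, ihf]
  | sub e f ihe ihf => simp only [NatExpr.eval, ihe, ihf]

/-- The hypothesis `hf` is the interface common to all loop schemes: the body is evaluated in an
arbitrary memory of which only the counter and the arrays that the loop does not write into are
known. -/
theorem den_sumLoop {v : ℕ} {e : NatExpr} {acc : ℕ} {c : Cmd} {E : RealExpr} {s : Memory} {N : ℕ}
    (f : ℕ → ℝ) (hv : c.wN v = false) (hacc : c.wR acc = false) (hN : rounds e s = N)
    (hf : ∀ i < N, ∀ s', AgreeOff (sumLoop v e acc c E) s s' → s'.nat v 0 = i →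
      E.eval (c.den s') = f i) :
    ((sumLoop v e acc c E).den s).real acc 0 = ∑ i ∈ Finset.range N, f i := by
  set s₀ := (setReal acc (.const 0) (.ofNat (.const 0))).den s with hs₀
  have hN' : rounds e s₀ = N := by
    rw [← hN]
    simp [rounds, hs₀, den, eval_setReal]
  refine den_for (P := c ;; setReal acc (.const 0) (.add (.read acc (.const 0)) E))
    (by simp [wN, hv]) hN' (fun i s' => s'.real acc 0 = ∑ j ∈ Finset.range i, f j)
    (fun _ _ _ _ h => h) (by simp [hs₀, den]) ?_
  intro i hi s' ha hs' hI
  have hE := hf i hi s' ((agreeOff_den _ s).seq ha) hs'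
  simp only [den, NatExpr.eval, RealExpr.eval, Memory.setReal_real, if_true, Function.update_self,
    hE, den_real_of_not_writes hacc, hI, Finset.sum_range_succ]

/-- Table of the values of `E` after `c`, over the rounds of a loop. -/
def natTable (v : ℕ) (e : NatExpr) (A : ℕ) (c : Cmd) (E : NatExpr) : Cmd :=
  for_ v e (c ;; setNat A (.read v (.const 0)) E)

theorem den_natTable {v : ℕ} {e : NatExpr} {A : ℕ} {c : Cmd} {E : NatExpr} {s : Memory} {N : ℕ}
    (f : ℕ → ℕ) (hv : c.wN v = false) (hA : c.wN A = false) (hAv : v ≠ A) (hN : rounds e s = N)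
    (hf : ∀ i < N, ∀ s', AgreeOff (natTable v e A c E) s s' → s'.nat v 0 = i →
      E.eval (c.den s') = f i) :
    ∀ j < N, ((natTable v e A c E).den s).nat A j = f j := by
  refine den_for (P := c ;; setNat A (.read v (.const 0)) E) (by simp [wN, hv, hAv]) hN
    (fun i s' => ∀ j < i, s'.nat A j = f j) ?_ (by simp) ?_
  · intro i s' j y h l hl
    simpa [hAv.symm] using h l hl
  · intro i hi s' ha hs' hI j hj
    have hE := hf i hi s' ha hs'
    simp only [den, NatExpr.eval, Memory.setNat_nat, if_true, hE, den_nat_of_not_writes hv, hs',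
      den_nat_of_not_writes hA]
    rcases Nat.lt_succ_iff_lt_or_eq.1 hj with h | rfl
    · rw [Function.update_of_ne (by omega)]; exact hI j h
    · rw [Function.update_self]

/-- Table of the values of `E` after `c`, over the rounds of a loop. -/
def realTable (v : ℕ) (e : NatExpr) (A : ℕ) (c : Cmd) (E : RealExpr) : Cmd :=
  for_ v e (c ;; setReal A (.read v (.const 0)) E)

theorem den_realTable {v : ℕ} {e : NatExpr} {A : ℕ} {c : Cmd} {E : RealExpr} {s : Memory} {N : ℕ}
    (f : ℕ → ℝ) (hv : c.wN v = false) (hA : c.wR A = false) (hN : rounds e s = N)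
    (hf : ∀ i < N, ∀ s', AgreeOff (realTable v e A c E) s s' → s'.nat v 0 = i →
      E.eval (c.den s') = f i) :
    ∀ j < N, ((realTable v e A c E).den s).real A j = f j := by
  refine den_for (P := c ;; setReal A (.read v (.const 0)) E) (by simp [wN, hv]) hN
    (fun i s' => ∀ j < i, s'.real A j = f j) (fun _ _ _ _ h => h) (by simp) ?_
  intro i hi s' ha hs' hI j hj
  have hE := hf i hi s' ha hs'
  simp only [den, NatExpr.eval, Memory.setReal_real, if_true, hE, den_nat_of_not_writes hv, hs',
    den_real_of_not_writes hA]
  rcases Nat.lt_succ_iff_lt_or_eq.1 hj with h | rfl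
  · rw [Function.update_of_ne (by omega)]; exact hI j h
  · rw [Function.update_self]

/-- Two-dimensional table; the array `row` of naturals holds the starts of its rows. -/
def realTable₂ (v : ℕ) (e : NatExpr) (w : ℕ) (m : NatExpr) (A row : ℕ) (c : Cmd) (E : RealExpr) :
    Cmd :=
  for_ v e (for_ w m (c ;; setReal A (.add (.read row (.read v (.const 0))) (.read w (.const 0))) E))

/-- Cells of a table stored row by row do not collide, so that writing one entry preserves the
others. -/
theorem mul_add_injective {m i i' j j' : ℕ} (hj : j < m) (hj' : j' < m)
    (h : i * m + j = i' * m + j') : i = i' ∧ j = j' := by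
  have h1 : (i * m + j) / m = i := by
    rw [mul_comm, Nat.mul_add_div (by omega), Nat.div_eq_of_lt hj, add_zero]
  have h2 : (i' * m + j') / m = i' := by
    rw [mul_comm, Nat.mul_add_div (by omega), Nat.div_eq_of_lt hj', add_zero]
  have : i = i' := by rw [← h1, ← h2, h]
  subst this
  exact ⟨rfl, by omega⟩

theorem den_realTable₂ {v : ℕ} {e : NatExpr} {w : ℕ} {m : NatExpr} {A row : ℕ} {c : Cmd}
    {E : RealExpr} {s : Memory} {N M : ℕ} (f : ℕ → ℕ → ℝ) (hv : c.wN v = false)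
    (hw : c.wN w = false) (hrow : c.wN row = false) (hA : c.wR A = false) (hvw : v ≠ w)
    (hvr : v ≠ row) (hwr : w ≠ row) (hN : rounds e s = N)
    (hM : ∀ s', AgreeOff (realTable₂ v e w m A row c E) s s' → rounds m s' = M)
    (hR : ∀ i < N, s.nat row i = i * M)
    (hf : ∀ i < N, ∀ j < M, ∀ s', AgreeOff (realTable₂ v e w m A row c E) s s' → s'.nat v 0 = i →
      s'.nat w 0 = j → E.eval (c.den s') = f i j) :
    ∀ i < N, ∀ j < M, ((realTable₂ v e w m A row c E).den s).real A (i * M + j) = f i j := by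
  refine den_for (P := for_ w m (c ;; setReal A
      (.add (.read row (.read v (.const 0))) (.read w (.const 0))) E))
    (by simp [wN, hv, hvw]) hN
    (fun i s' => ∀ i' < i, ∀ j < M, s'.real A (i' * M + j) = f i' j) (fun _ _ _ _ h => h)
    (by simp) ?_
  intro i hi s' ha hs' hI i' hi' j hj
  have key := den_for (v := w) (e := m) (s := s') (N := M) (P := c ;; setReal A
      (.add (.read row (.read v (.const 0))) (.read w (.const 0))) E)
    (by simp [wN, hw]) (hM s' ha)
    (fun j s'' => (∀ i' < i, ∀ j' < M, s''.real A (i' * M + j') = f i' j') ∧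
      ∀ j' < j, s''.real A (i * M + j') = f i j') (fun _ _ _ _ h => h) ⟨hI, by simp⟩ ?_
  · rcases Nat.lt_succ_iff_lt_or_eq.1 hi' with h | rfl
    · exact key.1 i' h j hj
    · exact key.2 j hj
  · intro j hj s'' ha' hs'' hJ
    have haa : AgreeOff (realTable₂ v e w m A row c E) s s'' :=
      ha.trans (ha'.mono (c' := realTable₂ v e w m A row c E)
        (fun b hb => by simp only [realTable₂, wN, Bool.or_eq_false_iff] at hb ⊢; exact hb.2)
        (fun b hb => hb))
    have hv' : s''.nat v 0 = i := by
      rw [ha'.1 v (by simp [wN, hv, hvw]), hs']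
    have hr' : s''.nat row i = i * M := by
      rw [haa.1 row (by simp [realTable₂, wN, hrow, hvr.symm, hwr.symm]), hR i hi]
    have hE := hf i hi j hj s'' haa hv' hs''
    simp only [den, NatExpr.eval, Memory.setReal_real, if_true, hE, den_nat_of_not_writes hv,
      den_nat_of_not_writes hw, den_nat_of_not_writes hrow, hs'', hv', hr',
      den_real_of_not_writes hA]
    refine ⟨fun i' hi' j' hj' => ?_, fun j' hj' => ?_⟩
    · rw [Function.update_of_ne]
      · exact hJ.1 i' hi' j' hj'
      · intro h
        have := (mul_add_injective hj' hj h).1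
        omega
    · rcases Nat.lt_succ_iff_lt_or_eq.1 hj' with h | rfl
      · rw [Function.update_of_ne (by omega)]; exact hJ.2 j' h
      · rw [Function.update_self]

/-- Search for the smallest value of `K` over the rounds with `T`; cell `0` of the array `B` receives
the number of the round, cell `1` tells whether there is one, and cell `0` of `R` receives the value. -/
def argmin (v : ℕ) (e : NatExpr) (B R : ℕ) (c : Cmd) (T : Test) (K : RealExpr) : Cmd :=
  setNat B (.const 1) (.const 0) ;;
    for_ v e (c ;; ite (.and T (.not (.and (.natLe (.const 1) (.read B (.const 1)))
        (.realLe (.read R (.const 0)) K))))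
      (setReal R (.const 0) K ;; setNat B (.const 0) (.read v (.const 0)) ;;
        setNat B (.const 1) (.const 1)) skip)

/-- The result of a search for a minimum. -/
def IsArgmin (N : ℕ) (p : ℕ → Prop) (key : ℕ → ℝ) (found idx : ℕ) (val : ℝ) : Prop :=
  (found = 0 ∧ ∀ i < N, ¬ p i) ∨
    (found = 1 ∧ idx < N ∧ p idx ∧ val = key idx ∧ ∀ i < N, p i → key idx ≤ key i)

theorem IsArgmin.of_exists {N : ℕ} {p : ℕ → Prop} {key : ℕ → ℝ} {found idx : ℕ} {val : ℝ}
    (h : IsArgmin N p key found idx val) (hex : ∃ i < N, p i) :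
    found = 1 ∧ idx < N ∧ p idx ∧ val = key idx ∧ ∀ i < N, p i → key idx ≤ key i := by
  obtain ⟨i, hi, hp⟩ := hex
  exact h.resolve_left fun h' => h'.2 i hi hp

/-- The invariant is `IsArgmin` for the rounds so far. The stored value is kept if it is at most the
new one, so the first minimizer wins. The flag in `B` is cleared before the loop bound is evaluated,
which is why `hN` refers to the memory after that write. -/
theorem den_argmin {v : ℕ} {e : NatExpr} {B R : ℕ} {c : Cmd} {T : Test} {K : RealExpr}
    {s : Memory} {N : ℕ} (p : ℕ → Prop) (key : ℕ → ℝ) (hv : c.wN v = false) (hB : c.wN B = false)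
    (hR : c.wR R = false) (hvB : v ≠ B) (hN : rounds e (s.setNat B 1 0) = N)
    (hf : ∀ i < N, ∀ s', AgreeOff (argmin v e B R c T K) s s' → s'.nat v 0 = i →
      (T.Holds (c.den s') ↔ p i) ∧ (p i → K.eval (c.den s') = key i)) :
    IsArgmin N p key (((argmin v e B R c T K).den s).nat B 1)
      (((argmin v e B R c T K).den s).nat B 0) (((argmin v e B R c T K).den s).real R 0) := by
  refine den_for (P := (c ;; ite (.and T (.not (.and (.natLe (.const 1) (.read B (.const 1)))
        (.realLe (.read R (.const 0)) K))))
      (setReal R (.const 0) K ;; setNat B (.const 0) (.read v (.const 0)) ;;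
        setNat B (.const 1) (.const 1)) skip)) (by simp [wN, hv, hvB])
    (s := (setNat B (.const 1) (.const 0)).den s) hN
    (fun i s' => IsArgmin i p key (s'.nat B 1) (s'.nat B 0) (s'.real R 0)) ?_ ?_ ?_
  · intro i s' j y h
    simpa [hvB.symm] using h
  · left; simp [den]
  · intro i hi s' ha hs' hI
    obtain ⟨h1, h2⟩ := hf i hi s' ((agreeOff_den _ s).seq ha) hs'
    have hcond : Test.Holds (c.den s') (.and T (.not (.and (.natLe (.const 1) (.read B (.const 1)))
        (.realLe (.read R (.const 0)) K)))) ↔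
        p i ∧ ¬ (1 ≤ s'.nat B 1 ∧ s'.real R 0 ≤ K.eval (c.den s')) := by
      simp only [Test.Holds, h1, NatExpr.eval, RealExpr.eval, den_nat_of_not_writes hB,
        den_real_of_not_writes hR]
    rw [den_seq]
    by_cases hif : p i ∧ ¬ (1 ≤ s'.nat B 1 ∧ s'.real R 0 ≤ K.eval (c.den s'))
    · rw [den_ite_pos (hcond.2 hif)]
      simp only [den, NatExpr.eval]
      right
      refine ⟨by simp, ?_, ?_, ?_, ?_⟩
      · simp [den_nat_of_not_writes hv, hs']
      · simpa [den_nat_of_not_writes hv, hs'] using hif.1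
      · simpa [den_nat_of_not_writes hv, hs'] using h2 hif.1
      · simp only [Memory.setNat_nat, Memory.setReal_nat, if_true,
          den_nat_of_not_writes hv, hs', ne_eq, not_false_eq_true,
          Function.update_of_ne, Function.update_self, zero_ne_one]
        intro j hj hpj
        rcases Nat.lt_succ_iff_lt_or_eq.1 hj with h | rfl
        · rcases hI with hI | hI
          · exact absurd hpj (hI.2 j h)
          · refine le_trans ?_ (hI.2.2.2.2 j h hpj)
            have := hif.2
            rw [hI.1, hI.2.2.2.1, h2 hif.1] at this
            simp at this
            exact this.le
        · exact le_rfl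
    · rw [den_ite_neg fun h => hif (hcond.1 h)]
      simp only [den, den_nat_of_not_writes hB, den_real_of_not_writes hR]
      rcases hI with hI | hI
      · left
        refine ⟨hI.1, fun j hj hpj => ?_⟩
        rcases Nat.lt_succ_iff_lt_or_eq.1 hj with h | rfl
        · exact hI.2 j h hpj
        · exact hif ⟨hpj, by rw [hI.1]; simp⟩
      · right
        refine ⟨hI.1, by omega, hI.2.2.1, hI.2.2.2.1, fun j hj hpj => ?_⟩
        rcases Nat.lt_succ_iff_lt_or_eq.1 hj with h | rfl
        · exact hI.2.2.2.2 j h hpj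
        · have : 1 ≤ s'.nat B 1 ∧ s'.real R 0 ≤ K.eval (c.den s') := by
            by_contra hcon
            exact hif ⟨hpj, hcon⟩
          rw [hI.2.2.2.1, h2 hpj] at this
          exact this.2

end Cmd
end PCentrum
end

noncomputable section
namespace PCentrum
open Cmd

/-! ### The program: tables of distances

Arrays of naturals: `3` and `4` hold the multiples of `n` and `d`, `5` flags the outer points,
`6` the centers of local search (`7` is a modified copy), `8` the center of each point, `9` the
leaders, `10` flags the points in buckets, `11` holds the current bucket of each group, `12` the
buckets, `13` flags the points that greedy covering has left so far, `14` to `17` are auxiliary; the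
arrays `20` to `29` hold results of searches, the arrays from `30` on loop counters.

Arrays of reals: `3` holds the distances, `4` the radius of greedy covering, `5` sums of squares,
`6` and `7` other sums, `8` the directions, `9` the radii, `10` the largest sums of buckets in each
group, `11` the sums over buckets, `12` the images of the points, `13` auxiliary values, `14` the
accuracy, `15` the mean radii of buckets; the arrays `20` to `29` hold minimal values of searches. -/

/-- Cell `0` of an array of naturals. -/
abbrev var (a : ℕ) : NatExpr := .read a (.const 0)

/-- Cell `0` of an array of reals. -/
abbrev rvar (a : ℕ) : RealExpr := .read a (.const 0)

/-- The number of points. -/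
abbrev numN : NatExpr := .read 0 (.const 0)

/-- The dimension. -/
abbrev numD : NatExpr := .read 0 (.const 1)

/-- The number of centers. -/
abbrev numK : NatExpr := .read 0 (.const 2)

/-- The number of distances in the objective. -/
abbrev numP : NatExpr := .read 0 (.const 3)

/-- An instance of the problem. -/
structure Inst where
  d : ℕ
  n : ℕ
  k : ℕ
  p : ℕ
  ε : ℝ
  x : ℕ → Point d

/-- The coordinates of the point `P` form the row `i` of the array `A`. -/
def HasRow {d : ℕ} (s : Memory) (A i : ℕ) (P : Point d) : Prop :=
  ∀ l : Fin d, s.real A (i * d + l) = P l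

/-- The memory holds the input. -/
structure HasInput (I : Inst) (s : Memory) : Prop where
  n_eq : s.nat 0 0 = I.n
  d_eq : s.nat 0 1 = I.d
  k_eq : s.nat 0 2 = I.k
  p_eq : s.nat 0 3 = I.p
  eps_eq : s.real 0 0 = I.ε
  row : ∀ i < I.n, HasRow s 1 i (I.x i)

/-- The memory holds the input and the starts of rows. -/
structure HasMul (I : Inst) (s : Memory) : Prop extends HasInput I s where
  mulN : ∀ i < I.n, s.nat 3 i = i * I.n
  mulD : ∀ i < I.n, s.nat 4 i = i * I.d

/-- The memory holds the input, the starts of rows and the distances. -/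
structure HasDist (I : Inst) (s : Memory) : Prop extends HasMul I s where
  dist_eq : ∀ i < I.n, ∀ j < I.n, s.real 3 (i * I.n + j) = dist (I.x i) (I.x j)

variable {I : Inst} {s s' : Memory}

/-- A frame rule: the input survives every program that does not write into its arrays. For concrete
programs the side conditions hold by evaluation, whence the default proofs; the analogous rules
below extend this to the tables. -/
theorem HasInput.of_agreeOff {c : Cmd} (h : HasInput I s) (ha : AgreeOff c s s')
    (h0 : c.wN 0 = false := by rfl) (h0' : c.wR 0 = false := by rfl)
    (h1' : c.wR 1 = false := by rfl) : HasInput I s' := by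
  obtain ⟨a1, a2, a3, a4, a5, a6⟩ := h
  constructor
  · rwa [ha.1 0 h0]
  · rwa [ha.1 0 h0]
  · rwa [ha.1 0 h0]
  · rwa [ha.1 0 h0]
  · rwa [ha.2 0 h0']
  · intro i hi l
    rw [ha.2 1 h1']; exact a6 i hi l

theorem HasMul.of_agreeOff {c : Cmd} (h : HasMul I s) (ha : AgreeOff c s s')
    (h0 : c.wN 0 = false := by rfl) (h3 : c.wN 3 = false := by rfl)
    (h4 : c.wN 4 = false := by rfl) (h0' : c.wR 0 = false := by rfl)
    (h1' : c.wR 1 = false := by rfl) : HasMul I s' where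
  toHasInput := h.toHasInput.of_agreeOff ha h0 h0' h1'
  mulN i hi := by rw [ha.1 3 h3]; exact h.mulN i hi
  mulD i hi := by rw [ha.1 4 h4]; exact h.mulD i hi

theorem HasDist.of_agreeOff {c : Cmd} (h : HasDist I s) (ha : AgreeOff c s s')
    (h0 : c.wN 0 = false := by rfl) (h3 : c.wN 3 = false := by rfl)
    (h4 : c.wN 4 = false := by rfl) (h0' : c.wR 0 = false := by rfl)
    (h1' : c.wR 1 = false := by rfl) (h3' : c.wR 3 = false := by rfl) : HasDist I s' where
  toHasMul := h.toHasMul.of_agreeOff ha h0 h3 h4 h0' h1'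
  dist_eq i hi j hj := by rw [ha.2 3 h3']; exact h.dist_eq i hi j hj

theorem HasInput.rounds_numN (h : HasInput I s) : rounds numN s = I.n := by
  simp [rounds, h.n_eq]

theorem HasInput.rounds_numD (h : HasInput I s) : rounds numD s = I.d := by
  simp [rounds, h.d_eq]

theorem HasInput.rounds_of_le (h : HasInput I s) {e : NatExpr} {N : ℕ} (he : e.eval s = N)
    (hN : N ≤ I.n) : rounds e s = N := by
  simp only [rounds, he, h.n_eq]
  omega

theorem HasRow.of_agreeOff {d A i : ℕ} {P : Point d} {c : Cmd} (h : HasRow s A i P)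
    (ha : AgreeOff c s s') (hA : c.wR A = false := by rfl) : HasRow s' A i P := by
  intro l
  rw [ha.2 A hA]; exact h l

/-- The starts of the rows. -/
def mulCmd : Cmd :=
  setNat 3 (.const 0) (.const 0) ;; setNat 4 (.const 0) (.const 0) ;;
    for_ 30 numN
      (setNat 3 (.add (var 30) (.const 1)) (.add (.read 3 (var 30)) numN) ;;
        setNat 4 (.add (var 30) (.const 1)) (.add (.read 4 (var 30)) numD))

/-- The machine cannot multiply naturals, so the row starts arise by repeated addition. Round `i`
writes entry `i + 1`; hence the invariant covers all `j ≤ i`. -/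
theorem hasMul_mulCmd (h : HasInput I s) : HasMul I (mulCmd.den s) := by
  have h' : HasInput I (mulCmd.den s) := h.of_agreeOff (agreeOff_den mulCmd s)
  set s₁ := (setNat 4 (.const 0) (.const 0)).den ((setNat 3 (.const 0) (.const 0)).den s) with hs₁
  have h₁ : HasInput I s₁ := h.of_agreeOff
    (agreeOff_den (setNat 3 (.const 0) (.const 0) ;; setNat 4 (.const 0) (.const 0)) s)
  have key := den_for (v := 30) (e := numN) (s := s₁)
    (P := (setNat 3 (.add (var 30) (.const 1)) (.add (.read 3 (var 30)) numN) ;;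
        setNat 4 (.add (var 30) (.const 1)) (.add (.read 4 (var 30)) numD))) rfl
    h₁.rounds_numN
    (fun i t => ∀ j ≤ i, t.nat 3 j = j * I.n ∧ t.nat 4 j = j * I.d)
    (fun i t j y hh => by simpa using hh) (by simp [hs₁, den]) (by
      intro i hi t ha ht hI j hj
      have hin : HasInput I t := h₁.of_agreeOff ha
      simp only [den, NatExpr.eval, Memory.setNat_nat, ht, hin.n_eq, hin.d_eq, Nat.reduceEqDiff,
        OfNat.zero_ne_ofNat, reduceIte]
      rcases Nat.le_succ_iff.1 hj with hle | rfl
      · simp only [Function.update_of_ne (show j ≠ i + 1 by omega)]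
        exact hI j hle
      · simp only [Nat.succ_eq_add_one, Function.update_self, (hI i le_rfl).1, (hI i le_rfl).2]
        constructor <;> ring)
  exact ⟨h', fun i hi => (key i hi.le).1, fun i hi => (key i hi.le).2⟩

/-- The square of the distance of the row of `A` whose number is in `a` and the row of `B` whose
number is in `b`. -/
def sqDistCmd (A a B b : ℕ) : Cmd :=
  sumLoop 39 numD 5 skip
    (.mul (.sub (.read A (.add (.read 4 (var a)) (var 39))) (.read B (.add (.read 4 (var b)) (var 39))))
      (.sub (.read A (.add (.read 4 (var a)) (var 39))) (.read B (.add (.read 4 (var b)) (var 39)))))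

theorem den_sqDistCmd {A a B b i j : ℕ} {P Q : Point I.d} (h : HasMul I s) (hi : s.nat a 0 = i)
    (hj : s.nat b 0 = j) (hin : i < I.n) (hjn : j < I.n) (hP : HasRow s A i P)
    (hQ : HasRow s B j Q) (ha : a ≠ 39) (hb : b ≠ 39) (hA : A ≠ 5) (hB : B ≠ 5) :
    ((sqDistCmd A a B b).den s).real 5 0 = dist P Q ^ 2 := by
  unfold sqDistCmd
  rw [den_sumLoop (N := I.d) (fun l => if hl : l < I.d then (P ⟨l, hl⟩ - Q ⟨l, hl⟩) ^ 2 else 0)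
    rfl rfl h.rounds_numD, Finset.sum_range, EuclideanSpace.dist_eq, Real.sq_sqrt
    (Finset.sum_nonneg fun _ _ => sq_nonneg _)]
  · refine Finset.sum_congr rfl fun l _ => ?_
    simp [Real.dist_eq]
  · intro l hl t hag ht
    have h4 : t.nat 4 = s.nat 4 := hag.1 4 rfl
    have hta : t.nat a = s.nat a := hag.1 a (by simp [sumLoop, wN, ha])
    have htb : t.nat b = s.nat b := hag.1 b (by simp [sumLoop, wN, hb])
    have htA : t.real A = s.real A := hag.2 A (by simp [sumLoop, wR, hA])
    have htB : t.real B = s.real B := hag.2 B (by simp [sumLoop, wR, hB])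
    simp only [den, NatExpr.eval, RealExpr.eval, h4, hta, htb, htA, htB, hi, hj, ht, h.mulD i hin,
      h.mulD j hjn, hl, dif_pos]
    rw [hP ⟨l, hl⟩, hQ ⟨l, hl⟩]
    ring

/-- The distances of the data points. -/
def distCmd : Cmd :=
  realTable₂ 30 numN 31 numN 3 3 (sqDistCmd 1 30 1 31) (.sqrt (rvar 5))

theorem hasDist_distCmd (h : HasMul I s) : HasDist I (distCmd.den s) := by
  refine ⟨h.of_agreeOff (agreeOff_den distCmd s), ?_⟩
  refine den_realTable₂ (N := I.n) (fun i j => dist (I.x i) (I.x j)) rfl rfl rfl rfl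
    (by norm_num) (by norm_num) (by norm_num) h.rounds_numN ?_ h.mulN ?_
  · intro t ha
    exact (h.of_agreeOff ha).rounds_numN
  · intro i hi j hj t ha h1 h2
    have ht := h.of_agreeOff ha
    simp only [RealExpr.eval, NatExpr.eval]
    rw [den_sqDistCmd ht h1 h2 hi hj (ht.row i hi) (ht.row j hj) (by norm_num) (by norm_num)
      (by norm_num) (by norm_num), Real.sqrt_sq dist_nonneg]

end PCentrum
end

noncomputable section
namespace PCentrum
open Cmd

/-! ### The program: greedy covering -/

/-- The indices below `n` with a nonzero flag. -/
def flagged (n : ℕ) (f : ℕ → ℕ) : Finset ℕ := (Finset.range n).filter fun i => 1 ≤ f i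

theorem mem_flagged {n : ℕ} {f : ℕ → ℕ} {i : ℕ} : i ∈ flagged n f ↔ i < n ∧ 1 ≤ f i := by
  simp [flagged]

theorem flagged_subset (n : ℕ) (f : ℕ → ℕ) : flagged n f ⊆ Finset.range n :=
  Finset.filter_subset _ _

theorem flagged_congr {n : ℕ} {f g : ℕ → ℕ} (h : ∀ i < n, f i = g i) :
    flagged n f = flagged n g := by
  ext i
  simp only [mem_flagged]
  constructor <;> rintro ⟨h1, h2⟩
  · exact ⟨h1, h i h1 ▸ h2⟩
  · exact ⟨h1, (h i h1).symm ▸ h2⟩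

/-- The sum of the values of `E` over the rounds of a loop in which a test succeeds. -/
def condSum (v : ℕ) (e : NatExpr) (acc : ℕ) (T : Test) (E : RealExpr) : Cmd :=
  sumLoop v e acc (ite T (setReal 13 (.const 0) E)
    (setReal 13 (.const 0) (.ofNat (.const 0)))) (rvar 13)

theorem den_condSum {v : ℕ} {e : NatExpr} {acc : ℕ} {T : Test} {E : RealExpr} {s : Memory} {N : ℕ}
    (p : ℕ → Prop) [DecidablePred p] (f : ℕ → ℝ) (hacc : acc ≠ 13) (hN : rounds e s = N)
    (hf : ∀ i < N, ∀ s', AgreeOff (condSum v e acc T E) s s' → s'.nat v 0 = i →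
      (T.Holds s' ↔ p i) ∧ (p i → E.eval s' = f i)) :
    ((condSum v e acc T E).den s).real acc 0 = ∑ i ∈ (Finset.range N).filter p, f i := by
  unfold condSum
  rw [den_sumLoop (N := N) (fun i => if p i then f i else 0) rfl (by simp [wR, hacc]) hN,
    Finset.sum_filter]
  intro i hi s' ha hs'
  obtain ⟨h, h'⟩ := hf i hi s' ha hs'
  by_cases hp : p i
  · rw [den_ite_pos (h.2 hp), if_pos hp]; simp [den, h' hp]
  · rw [den_ite_neg fun hh => hp (h.1 hh), if_neg hp]; simp [den]

/-- The number of rounds of a loop in which a test succeeds. -/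
def countLoop (v : ℕ) (e : NatExpr) (acc : ℕ) (T : Test) : Cmd :=
  condSum v e acc T (.ofNat (.const 1))

theorem den_countLoop {v : ℕ} {e : NatExpr} {acc : ℕ} {T : Test} {s : Memory} {N : ℕ}
    (p : ℕ → Prop) [DecidablePred p] (hacc : acc ≠ 13) (hN : rounds e s = N)
    (hf : ∀ i < N, ∀ s', AgreeOff (countLoop v e acc T) s s' → s'.nat v 0 = i →
      (T.Holds s' ↔ p i)) :
    ((countLoop v e acc T).den s).real acc 0 = ((Finset.range N).filter p).card := by
  unfold countLoop
  rw [den_condSum (N := N) p (fun _ => 1) hacc hN fun i hi s' ha hs' =>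
    ⟨hf i hi s' ha hs', fun _ => by simp⟩]
  simp

/-- The distance of the points whose numbers are in `a` and `b`. -/
abbrev distExpr (a b : ℕ) : RealExpr := .read 3 (.add (.read 3 (var a)) (var b))

theorem HasDist.eval_distExpr {I : Inst} {s : Memory} (h : HasDist I s) {a b i j : ℕ}
    (ha : s.nat a 0 = i) (hb : s.nat b 0 = j) (hi : i < I.n) (hj : j < I.n) :
    (distExpr a b).eval s = dist (I.x i) (I.x j) := by
  simp only [RealExpr.eval, NatExpr.eval, ha, hb, h.mulN i hi, h.dist_eq i hi j hj]

/-- Selection of the ball that contains most of the flagged points. -/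
def pickCmd : Cmd :=
  argmin 32 numN 20 20
    (countLoop 33 numN 6 (.and (.natLe (.const 1) (.read 13 (var 33)))
      (.realLe (distExpr 32 33) (rvar 4))))
    (.natLe (.const 0) (.const 0)) (.sub (.ofNat (.const 0)) (rvar 6))

/-- Removal of the flags in the ball of double radius. -/
def removeCmd : Cmd :=
  for_ 33 numN (ite (.realLe (distExpr 20 33) (.mul (.ofNat (.const 2)) (rvar 4)))
    (setNat 13 (var 33) (.const 0)) skip)

/-- Greedy covering. -/
def greedyCmd : Cmd :=
  natTable 33 numN 13 skip (.const 1) ;; for_ 34 numK (pickCmd ;; removeCmd)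

variable {I : Inst} {s : Memory} {ρ : ℝ}

/-- The largest count is found as the smallest negated count, which is why counts are kept as reals.
-/
theorem pickCmd_spec (h : HasDist I s) (hρ : s.real 4 0 = ρ) (hn : 0 < I.n) :
    (pickCmd.den s).nat 20 0 < I.n ∧ ∀ w < I.n,
      ((flagged I.n (s.nat 13)).filter fun u => dist (I.x w) (I.x u) ≤ ρ).card ≤
      ((flagged I.n (s.nat 13)).filter fun u =>
        dist (I.x ((pickCmd.den s).nat 20 0)) (I.x u) ≤ ρ).card := by
  have key := den_argmin (v := 32) (e := numN) (B := 20) (R := 20)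
    (c := countLoop 33 numN 6 (.and (.natLe (.const 1) (.read 13 (var 33)))
      (.realLe (distExpr 32 33) (rvar 4)))) (T := .natLe (.const 0) (.const 0))
    (K := .sub (.ofNat (.const 0)) (rvar 6)) (s := s) (N := I.n) (fun _ => True)
    (fun w => -(((flagged I.n (s.nat 13)).filter fun u => dist (I.x w) (I.x u) ≤ ρ).card : ℝ))
    rfl rfl rfl (by norm_num)
    (h.of_agreeOff (agreeOff_den (setNat 20 (.const 1) (.const 0)) s)).rounds_numN (by
      intro w hw t ha hw'
      have ht : HasDist I t := h.of_agreeOff ha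
      refine ⟨by simp, fun _ => ?_⟩
      simp only [RealExpr.eval, NatExpr.eval]
      rw [den_countLoop (N := I.n)
        (fun u => 1 ≤ s.nat 13 u ∧ dist (I.x w) (I.x u) ≤ ρ) (by norm_num) ht.rounds_numN,
        flagged, Finset.filter_filter]
      · simp
      · intro u hu t' ha' hu'
        have ht' : HasDist I t' := ht.of_agreeOff ha'
        simp only [Test.Holds, ht'.eval_distExpr ((congrFun (ha'.1 32 rfl) 0).trans hw') hu' hw hu]
        simp only [NatExpr.eval, RealExpr.eval, hu', ha'.1 13 rfl, ha.1 13 rfl, ha'.2 4 rfl,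
          ha.2 4 rfl, hρ])
  obtain ⟨-, h2, -, -, h5⟩ := key.of_exists ⟨0, hn, trivial⟩
  refine ⟨h2, fun w hw => ?_⟩
  have := h5 w hw trivial
  exact_mod_cast neg_le_neg_iff.1 this

theorem removeCmd_spec (h : HasDist I s) (hρ : s.real 4 0 = ρ) {v : ℕ} (hv : s.nat 20 0 = v)
    (hvn : v < I.n) : flagged I.n ((removeCmd.den s).nat 13) =
      (flagged I.n (s.nat 13)).filter fun u => ¬ dist (I.x v) (I.x u) ≤ 2 * ρ := by
  have key := den_for (v := 33) (e := numN) (s := s) (P :=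
    (ite (.realLe (distExpr 20 33) (.mul (.ofNat (.const 2)) (rvar 4)))
    (setNat 13 (var 33) (.const 0)) skip)) rfl h.rounds_numN
    (fun i t => ∀ u, t.nat 13 u =
      if u < i ∧ dist (I.x v) (I.x u) ≤ 2 * ρ then 0 else s.nat 13 u)
    (fun i t j y hh => by simpa using hh) (by simp) (by
      intro i hi t ha ht hI u
      have hD : HasDist I t := h.of_agreeOff ha
      have hT : Test.Holds t (.realLe (distExpr 20 33) (.mul (.ofNat (.const 2)) (rvar 4))) ↔
          dist (I.x v) (I.x i) ≤ 2 * ρ := by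
        simp only [Test.Holds, hD.eval_distExpr ((congrFun (ha.1 20 rfl) 0).trans hv) ht hvn hi]
        simp [ha.2 4 rfl, hρ]
      by_cases hc : dist (I.x v) (I.x i) ≤ 2 * ρ
      · rw [den_ite_pos (hT.2 hc)]
        simp only [den, NatExpr.eval, ht, Memory.setNat_nat, if_true]
        by_cases hu : u = i
        · subst hu
          simp [hc]
        · rw [Function.update_of_ne hu, hI u]
          have : u < i + 1 ↔ u < i := by omega
          simp only [this]
      · rw [den_ite_neg fun hh => hc (hT.1 hh)]
        simp only [den]
        rw [hI u]
        by_cases hu : u = i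
        · subst hu
          simp [hc]
        · have : u < i + 1 ↔ u < i := by omega
          simp only [this])
  ext u
  simp only [Finset.mem_filter, mem_flagged]
  rw [show (removeCmd.den s).nat 13 u = _ from key u]
  split_ifs with hif
  · simp [hif.2]
  · constructor
    · rintro ⟨h1, h2⟩
      exact ⟨⟨h1, h2⟩, fun h3 => hif ⟨h1, h3⟩⟩
    · rintro ⟨h1, -⟩
      exact h1

theorem greedyCmd_spec (h : HasDist I s) (hρ : s.real 4 0 = ρ) (hn : 0 < I.n) (hk : I.k ≤ I.n) :
    GreedyInv I.x I.n I.k ρ I.k (flagged I.n ((greedyCmd.den s).nat 13)) := by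
  set s₁ := (natTable 33 numN 13 skip (.const 1)).den s with hs₁
  have ha₁ := agreeOff_den (natTable 33 numN 13 skip (.const 1)) s
  have h₁ : HasDist I s₁ := h.of_agreeOff ha₁
  have hall : flagged I.n (s₁.nat 13) = Finset.range I.n := by
    have := den_natTable (v := 33) (e := numN) (A := 13) (c := skip) (E := .const 1) (s := s)
      (fun _ => 1) rfl rfl (by norm_num) h.rounds_numN (fun _ _ _ _ _ => rfl)
    refine Finset.filter_true_of_mem fun i hi => ?_
    rw [this i (Finset.mem_range.1 hi)]
  refine den_for (v := 34) (e := numK) (s := s₁) (P := pickCmd ;; removeCmd) rfl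
    (h₁.rounds_of_le h₁.k_eq hk)
    (fun i t => GreedyInv I.x I.n I.k ρ i (flagged I.n (t.nat 13)))
    (fun i t j y hh => by simpa using hh) ?_ ?_
  · rw [hall]; exact GreedyInv.zero _ _ _ _
  · intro i hi t ha _ hI
    have hD : HasDist I t := h₁.of_agreeOff ha
    have hρt : t.real 4 0 = ρ := by rw [ha.2 4 rfl, ha₁.2 4 rfl, hρ]
    have hap := agreeOff_den pickCmd t
    obtain ⟨p1, p2⟩ := pickCmd_spec hD hρt hn
    have hr := removeCmd_spec (s := pickCmd.den t) (ρ := ρ) (hD.of_agreeOff hap)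
      (by rw [hap.2 4 rfl]; exact hρt) rfl p1
    rw [hap.1 13 rfl] at hr
    exact hI.succ ⟨_, p1, p2, hr⟩

/-- One candidate for the radius. -/
def tryCmd : Cmd :=
  setReal 4 (.const 0) (distExpr 30 31) ;; greedyCmd ;;
    countLoop 33 numN 6 (.natLe (.const 1) (.read 13 (var 33))) ;;
    ite (.and (.realLe (rvar 6) (.ofNat numP))
        (.not (.and (.natLe (.const 1) (var 22)) (.realLe (rvar 22) (rvar 4)))))
      (setReal 22 (.const 0) (rvar 4) ;; setNat 22 (.const 0) (.const 1) ;;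
        natTable 33 numN 5 skip (.read 13 (var 33))) skip

/-- The smallest radius for which greedy covering leaves at most `p` points, and these points. -/
def coverCmd : Cmd :=
  setNat 22 (.const 0) (.const 0) ;; for_ 30 numN (for_ 31 numN tryCmd)

/-- The best radius so far and the points that it leaves. -/
def IsCover (I : Inst) (s : Memory) : Prop :=
  s.nat 22 0 = 0 ∨ (s.nat 22 0 = 1 ∧ 0 ≤ s.real 22 0 ∧ (flagged I.n (s.nat 5)).card ≤ I.p ∧
    GreedyInv I.x I.n I.k (s.real 22 0) I.k (flagged I.n (s.nat 5)))

/-- A radius for which greedy covering is bound to succeed. -/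
def IsFeasible (I : Inst) (ρ : ℝ) : Prop :=
  ∃ 𝒯, IsClusterFamily I.x I.n ρ 𝒯 ∧ 𝒯.card ≤ I.k ∧
    (Finset.range I.n \ 𝒯.biUnion id).card ≤ I.p

/-- The best radius so far is at most `ρ`. -/
def Beats (s : Memory) (ρ : ℝ) : Prop := s.nat 22 0 = 1 ∧ s.real 22 0 ≤ ρ

/-- A feasible radius passes the test on the number of remaining points by
`GreedyInv.card_le_of_family`. If it is nevertheless not stored, a radius at most as large is stored
already. -/
theorem tryCmd_spec (h : HasDist I s) (hk : I.k ≤ I.n) {i j : ℕ} (hi : s.nat 30 0 = i)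
    (hj : s.nat 31 0 = j) (hin : i < I.n) (hjn : j < I.n) (hc : IsCover I s) :
    IsCover I (tryCmd.den s) ∧ (∀ ρ, Beats s ρ → Beats (tryCmd.den s) ρ) ∧
      (IsFeasible I (dist (I.x i) (I.x j)) → Beats (tryCmd.den s) (dist (I.x i) (I.x j))) := by
  set ρ := dist (I.x i) (I.x j) with hρ
  set s₁ := (setReal 4 (.const 0) (distExpr 30 31)).den s with hs₁
  have a₁ := agreeOff_den (setReal 4 (.const 0) (distExpr 30 31)) s
  have h₁ : HasDist I s₁ := h.of_agreeOff a₁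
  have hρ₁ : s₁.real 4 0 = ρ := by
    have := h.eval_distExpr hi hj hin hjn
    simp only [hs₁, den, this]
    simp [hρ]
  set s₂ := greedyCmd.den s₁ with hs₂
  have a₂ := agreeOff_den greedyCmd s₁
  have h₂ : HasDist I s₂ := h₁.of_agreeOff a₂
  have hg : GreedyInv I.x I.n I.k ρ I.k (flagged I.n (s₂.nat 13)) :=
    greedyCmd_spec h₁ hρ₁ (by omega) hk
  set cc := countLoop 33 numN 6 (.natLe (.const 1) (.read 13 (var 33))) with hcc
  set s₃ := cc.den s₂ with hs₃
  have a₃ := agreeOff_den cc s₂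
  have h₃ : HasDist I s₃ := h₂.of_agreeOff a₃
  have hcount : s₃.real 6 0 = (flagged I.n (s₂.nat 13)).card := by
    rw [hs₃, hcc, den_countLoop (N := I.n) (fun u => 1 ≤ s₂.nat 13 u) (by norm_num)
      h₂.rounds_numN]
    · rfl
    · intro u hu t ha hu'
      simp only [Test.Holds, NatExpr.eval, hu', ha.1 13 rfl]
  have e13 : s₃.nat 13 = s₂.nat 13 := a₃.1 13 rfl
  have e4 : s₃.real 4 0 = ρ := by rw [a₃.2 4 rfl, a₂.2 4 rfl, hρ₁]
  have e22 : s₃.nat 22 = s.nat 22 := by rw [a₃.1 22 rfl, a₂.1 22 rfl, a₁.1 22 rfl]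
  have e22' : s₃.real 22 = s.real 22 := by rw [a₃.2 22 rfl, a₂.2 22 rfl, a₁.2 22 rfl]
  have e5 : s₃.nat 5 = s.nat 5 := by rw [a₃.1 5 rfl, a₂.1 5 rfl, a₁.1 5 rfl]
  have hcond : Test.Holds s₃ (.and (.realLe (rvar 6) (.ofNat numP))
        (.not (.and (.natLe (.const 1) (var 22)) (.realLe (rvar 22) (rvar 4))))) ↔
      (flagged I.n (s₂.nat 13)).card ≤ I.p ∧ ¬ (1 ≤ s.nat 22 0 ∧ s.real 22 0 ≤ ρ) := by
    simp only [Test.Holds, RealExpr.eval, NatExpr.eval, hcount, h₃.p_eq, e22, e22', e4,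
      Nat.cast_le]
  have hden : tryCmd.den s = (ite (.and (.realLe (rvar 6) (.ofNat numP))
        (.not (.and (.natLe (.const 1) (var 22)) (.realLe (rvar 22) (rvar 4)))))
      (setReal 22 (.const 0) (rvar 4) ;; setNat 22 (.const 0) (.const 1) ;;
        natTable 33 numN 5 skip (.read 13 (var 33))) skip).den s₃ := rfl
  rw [hden]
  have hfeas : IsFeasible I ρ → (flagged I.n (s₂.nat 13)).card ≤ I.p := by
    rintro ⟨𝒯, h𝒯, hc𝒯, hp⟩
    exact (hg.card_le_of_family h𝒯 hc𝒯).trans hp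
  by_cases hif : (flagged I.n (s₂.nat 13)).card ≤ I.p ∧ ¬ (1 ≤ s.nat 22 0 ∧ s.real 22 0 ≤ ρ)
  · rw [den_ite_pos (hcond.2 hif), den_seq, den_seq]
    set s₄ := (setNat 22 (.const 0) (.const 1)).den ((setReal 22 (.const 0) (rvar 4)).den s₃)
      with hs₄
    have h₄ : HasDist I s₄ := h₃.of_agreeOff
      (agreeOff_den (setReal 22 (.const 0) (rvar 4) ;; setNat 22 (.const 0) (.const 1)) s₃)
    have a₅ := agreeOff_den (natTable 33 numN 5 skip (.read 13 (var 33))) s₄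
    have f1 : ((natTable 33 numN 5 skip (.read 13 (var 33))).den s₄).nat 22 0 = 1 := by
      rw [a₅.1 22 rfl]; simp [hs₄, den]
    have f2 : ((natTable 33 numN 5 skip (.read 13 (var 33))).den s₄).real 22 0 = ρ := by
      rw [a₅.2 22 rfl]; simp [hs₄, den, e4]
    have f3 : flagged I.n (((natTable 33 numN 5 skip (.read 13 (var 33))).den s₄).nat 5) =
        flagged I.n (s₂.nat 13) := by
      refine flagged_congr ?_
      refine den_natTable (s₂.nat 13) rfl rfl (by norm_num) h₄.rounds_numN ?_
      intro u hu t ha hu'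
      simp only [den, NatExpr.eval, hu', ha.1 13 rfl]
      simp [hs₄, den, e13]
    refine ⟨Or.inr ⟨f1, ?_, ?_, ?_⟩, fun ρ' hb => ⟨f1, ?_⟩, fun _ => ⟨f1, f2.le⟩⟩
    · rw [f2]; exact dist_nonneg
    · rw [f3]; exact hif.1
    · rw [f2, f3]; exact hg
    · rw [f2]
      have : ρ < s.real 22 0 := by
        by_contra! hle
        exact hif.2 ⟨hb.1.ge, hle⟩
      exact this.le.trans hb.2
  · rw [den_ite_neg fun hh => hif (hcond.1 hh)]
    simp only [den]
    refine ⟨?_, ?_, ?_⟩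
    · unfold IsCover
      rw [e22, e22', e5]; exact hc
    · intro ρ' hb
      exact ⟨by rw [e22]; exact hb.1, by rw [e22']; exact hb.2⟩
    · intro hf
      have h1 : 1 ≤ s.nat 22 0 ∧ s.real 22 0 ≤ ρ := by
        by_contra hcon
        exact hif ⟨hfeas hf, hcon⟩
      refine ⟨?_, by rw [e22']; exact h1.2⟩
      rw [e22]
      rcases hc with hc | hc
      · omega
      · exact hc.1

theorem IsCover.setNat (hc : IsCover I s) {v j y : ℕ} (hv : v ≠ 22) (hv' : v ≠ 5) :
    IsCover I (s.setNat v j y) := by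
  unfold IsCover at hc ⊢
  simpa [hv.symm, hv'.symm] using hc

/-- Success of greedy covering need not be monotone in the radius. All interpoint distances are
tried, and the result is at most every feasible one. -/
theorem coverCmd_spec (h : HasDist I s) (hk : I.k ≤ I.n) :
    IsCover I (coverCmd.den s) ∧ ∀ i < I.n, ∀ j < I.n, IsFeasible I (dist (I.x i) (I.x j)) →
      Beats (coverCmd.den s) (dist (I.x i) (I.x j)) := by
  set s₁ := (setNat 22 (.const 0) (.const 0)).den s with hs₁
  have h₁ : HasDist I s₁ := h.of_agreeOff (agreeOff_den (setNat 22 (.const 0) (.const 0)) s)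
  refine den_for (v := 30) (e := numN) (s := s₁) (P := for_ 31 numN tryCmd) rfl h₁.rounds_numN
    (fun i t => IsCover I t ∧ ∀ i' < i, ∀ j < I.n, IsFeasible I (dist (I.x i') (I.x j)) →
      Beats t (dist (I.x i') (I.x j))) ?_ ?_ ?_
  · intro i t j y hh
    exact ⟨hh.1.setNat (by norm_num) (by norm_num), by simpa [Beats] using hh.2⟩
  · exact ⟨Or.inl (by simp [hs₁, den]), by simp⟩
  · intro i hi t ha hti hI
    have ht : HasDist I t := h₁.of_agreeOff ha
    have key := den_for (v := 31) (e := numN) (s := t) (P := tryCmd) rfl ht.rounds_numN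
      (fun j t' => IsCover I t' ∧ (∀ ρ, Beats t ρ → Beats t' ρ) ∧
        ∀ j' < j, IsFeasible I (dist (I.x i) (I.x j')) → Beats t' (dist (I.x i) (I.x j')))
      (fun j t' l y hh => ⟨hh.1.setNat (by norm_num) (by norm_num), by simpa [Beats] using hh.2⟩)
      ⟨hI.1, fun _ hb => hb, by simp⟩ (by
        intro j hj t' ha' htj hJ
        obtain ⟨q1, q2, q3⟩ := tryCmd_spec (s := t') (ht.of_agreeOff ha') hk
          ((congrFun (ha'.1 30 rfl) 0).trans hti) htj hi hj hJ.1
        refine ⟨q1, fun ρ hb => q2 ρ (hJ.2.1 ρ hb), fun j' hj' hf => ?_⟩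
        rcases Nat.lt_succ_iff_lt_or_eq.1 hj' with hlt | rfl
        · exact q2 _ (hJ.2.2 j' hlt hf)
        · exact q3 hf)
    refine ⟨key.1, fun i' hi' j hj hf => ?_⟩
    rcases Nat.lt_succ_iff_lt_or_eq.1 hi' with hlt | rfl
    · exact key.2.1 _ (hI.2 i' hlt j hj hf)
    · exact key.2.2 j hj hf

/-- The outer points and the radius found by greedy covering. -/
theorem coverCmd_correct (h : HasDist I s) (hk1 : 1 ≤ I.k) (hk : I.k ≤ I.n) (hp : I.p ≤ I.n)
    (hp1 : 1 ≤ I.p) (hex : ∃ C : Finset (Point I.d), C.card = I.k) :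
    0 ≤ (coverCmd.den s).real 22 0 ∧ (flagged I.n ((coverCmd.den s).nat 5)).card ≤ I.p ∧
      GreedyInv I.x I.n I.k ((coverCmd.den s).real 22 0) I.k
        (flagged I.n ((coverCmd.den s).nat 5)) ∧
      ∀ C : Finset (Point I.d), C.card = I.k → I.p * (coverCmd.den s).real 22 0 ≤
        2 * topSumOn I.p I.n fun z => Metric.infDist (I.x z) (C : Set (Point I.d)) := by
  obtain ⟨h1, h2⟩ := coverCmd_spec h hk
  have hbeat : ∀ C : Finset (Point I.d), C.card = I.k → (coverCmd.den s).nat 22 0 = 1 ∧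
      I.p * (coverCmd.den s).real 22 0 ≤
        2 * topSumOn I.p I.n fun z => Metric.infDist (I.x z) (C : Set (Point I.d)) := by
    intro C hC
    obtain ⟨i, hi, j, hj, 𝒯, h𝒯, hc, hout, hcost⟩ :=
      exists_clusterFamily I.x hp hp1 (C := C) (Finset.card_pos.1 (by omega))
    obtain ⟨b1, b2⟩ := h2 i hi j hj ⟨𝒯, h𝒯, hC ▸ hc, hout⟩
    refine ⟨b1, le_trans ?_ hcost⟩
    exact mul_le_mul_of_nonneg_left b2 (Nat.cast_nonneg _)
  -- One set of `k` centers is needed to know that some radius was found at all; otherwise the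
  -- stored cells would be meaningless.
  obtain ⟨C₀, hC₀⟩ := hex
  have hf := (hbeat C₀ hC₀).1
  rcases h1 with h1 | h1
  · omega
  · exact ⟨h1.2.1, h1.2.2.1, h1.2.2.2, fun C hC => (hbeat C hC).2⟩

end PCentrum
end

noncomputable section
namespace PCentrum
open Cmd

/-! ### The program: local search -/

/-- The flagged point (flags in the array `fl`) nearest to the point whose number is in `a`. -/
def nearestCmd (fl a : ℕ) : Cmd :=
  argmin 36 numN 23 23 skip (.natLe (.const 1) (.read fl (var 36))) (distExpr a 36)

variable {I : Inst} {s : Memory}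

theorem nearestCmd_spec (h : HasDist I s) {fl a z : ℕ} (hfl : fl ≠ 36) (hfl' : fl ≠ 23)
    (ha' : a ≠ 36) (ha'' : a ≠ 23) (hz : s.nat a 0 = z) (hzn : z < I.n)
    (hne : (flagged I.n (s.nat fl)).Nonempty) :
    ((nearestCmd fl a).den s).nat 23 0 ∈ flagged I.n (s.nat fl) ∧
      ((nearestCmd fl a).den s).real 23 0 =
        dist (I.x z) (I.x (((nearestCmd fl a).den s).nat 23 0)) ∧
      ((nearestCmd fl a).den s).real 23 0 =
        Metric.infDist (I.x z) (I.x '' (flagged I.n (s.nat fl) : Set ℕ)) := by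
  have key := den_argmin (v := 36) (e := numN) (B := 23) (R := 23) (c := skip)
    (T := .natLe (.const 1) (.read fl (var 36))) (K := distExpr a 36) (s := s) (N := I.n)
    (fun u => 1 ≤ s.nat fl u) (fun u => dist (I.x z) (I.x u)) rfl rfl rfl (by norm_num)
    (h.of_agreeOff (agreeOff_den (setNat 23 (.const 1) (.const 0)) s)).rounds_numN (by
      intro u hu t hag hu'
      have ht : HasDist I t := h.of_agreeOff hag
      have e1 : t.nat fl = s.nat fl := hag.1 fl (by simp [argmin, wN, hfl, hfl'])
      have e2 : t.nat a = s.nat a := hag.1 a (by simp [argmin, wN, ha', ha''])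
      refine ⟨by simp [den, e1, hu'], fun _ => ?_⟩
      exact ht.eval_distExpr (by rw [e2]; exact hz) hu' hzn hu)
  obtain ⟨u₀, hu₀⟩ := hne
  obtain ⟨-, h2, h3, h4, h5⟩ := key.of_exists ⟨u₀, mem_flagged.1 hu₀⟩
  refine ⟨mem_flagged.2 ⟨h2, h3⟩, h4, ?_⟩
  rw [infDist_image_eq (mem_flagged.2 ⟨h2, h3⟩)]
  · exact h4
  · intro u hu
    exact h5 u (mem_flagged.1 hu).1 (mem_flagged.1 hu).2

/-- The sum of the distances of the outer points to the points with flags in the array `7`. -/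
def costCmd : Cmd :=
  sumLoop 35 numN 7 (nearestCmd 7 35 ;; ite (.natLe (.const 1) (.read 5 (var 35))) skip
    (setReal 23 (.const 0) (.ofNat (.const 0)))) (rvar 23)

/-- A nearest center is searched for every point, and the value is reset to `0` for inner points, so
that the loop over all indices sums over the outer ones only. -/
theorem costCmd_spec (h : HasDist I s) (hne : (flagged I.n (s.nat 7)).Nonempty) :
    (costCmd.den s).real 7 0 =
      medianCost I.x (flagged I.n (s.nat 5)) (flagged I.n (s.nat 7)) := by
  unfold costCmd
  rw [den_sumLoop (N := I.n) (fun z => if 1 ≤ s.nat 5 z then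
    Metric.infDist (I.x z) (I.x '' (flagged I.n (s.nat 7) : Set ℕ)) else 0) rfl rfl h.rounds_numN,
    ← Finset.sum_filter]
  · rfl
  · intro z hz t ha hz'
    have ht : HasDist I t := h.of_agreeOff ha
    have e7 : t.nat 7 = s.nat 7 := ha.1 7 rfl
    have key := nearestCmd_spec (fl := 7) (a := 35) ht (by norm_num) (by norm_num) (by norm_num)
      (by norm_num) hz' hz (by rw [e7]; exact hne)
    have hag := agreeOff_den (nearestCmd 7 35) t
    have e5 : ((nearestCmd 7 35).den t).nat 5 z = s.nat 5 z := by rw [hag.1 5 rfl, ha.1 5 rfl]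
    have e35 : ((nearestCmd 7 35).den t).nat 35 0 = z := by rw [hag.1 35 rfl, hz']
    have hT : Test.Holds ((nearestCmd 7 35).den t) (.natLe (.const 1) (.read 5 (var 35))) ↔
        1 ≤ s.nat 5 z := by
      simp only [Test.Holds, NatExpr.eval, e35, e5]
    rw [den_seq]
    by_cases hc : 1 ≤ s.nat 5 z
    · rw [den_ite_pos (hT.2 hc), if_pos hc]
      simp only [den, RealExpr.eval, NatExpr.eval]
      rw [key.2.2, e7]
    · rw [den_ite_neg fun hh => hc (hT.1 hh), if_neg hc]
      simp [den]

/-- The cost after the flag of the point in `38` has been set to `c`. -/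
def flipCostCmd (c : ℕ) : Cmd :=
  natTable 37 numN 7 skip (.read 6 (var 37)) ;; setNat 7 (var 38) (.const c) ;; costCmd

theorem flagged_update_zero (n : ℕ) (f : ℕ → ℕ) (v : ℕ) :
    flagged n (Function.update f v 0) = (flagged n f).erase v := by
  ext u
  simp only [mem_flagged, Finset.mem_erase]
  by_cases hu : u = v
  · subst hu; simp
  · simp [hu]

theorem flagged_update_one {n v : ℕ} (f : ℕ → ℕ) (hv : v < n) :
    flagged n (Function.update f v 1) = insert v (flagged n f) := by
  ext u
  simp only [mem_flagged, Finset.mem_insert]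
  by_cases hu : u = v
  · subst hu; simp [hv]
  · simp [hu]

theorem flipCostCmd_spec (h : HasDist I s) {c v : ℕ} (hv : s.nat 38 0 = v)
    (hne : (flagged I.n (Function.update (s.nat 6) v c)).Nonempty) :
    ((flipCostCmd c).den s).real 7 0 =
      medianCost I.x (flagged I.n (s.nat 5)) (flagged I.n (Function.update (s.nat 6) v c)) := by
  unfold flipCostCmd
  rw [den_seq, den_seq]
  have a₁ := agreeOff_den (natTable 37 numN 7 skip (.read 6 (var 37))) s
  have t₁ := den_natTable (v := 37) (e := numN) (A := 7) (c := skip) (E := .read 6 (var 37)) (s := s)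
    (s.nat 6) rfl rfl (by norm_num) h.rounds_numN (by
      intro u _ t ha hu
      simp [den, ha.1 6 rfl, hu])
  set s₁ := (natTable 37 numN 7 skip (.read 6 (var 37))).den s
  have a₂ := agreeOff_den (setNat 7 (var 38) (.const c)) s₁
  have e7 : flagged I.n (((setNat 7 (var 38) (.const c)).den s₁).nat 7) =
      flagged I.n (Function.update (s.nat 6) v c) := by
    refine flagged_congr fun u hu => ?_
    simp only [den, NatExpr.eval, a₁.1 38 rfl, hv, Memory.setNat_nat, if_true]
    by_cases huv : u = v
    · subst huv; simp
    · rw [Function.update_of_ne huv, Function.update_of_ne huv]; exact t₁ u hu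
  have h₂ : HasDist I ((setNat 7 (var 38) (.const c)).den s₁) := (h.of_agreeOff a₁).of_agreeOff a₂
  rw [costCmd_spec h₂ (by rw [e7]; exact hne), e7, a₂.1 5 rfl, a₁.1 5 rfl]

/-- Removal of the center whose removal is cheapest. -/
def removeBestCmd : Cmd :=
  argmin 38 numN 24 24 (flipCostCmd 0) (.natLe (.const 1) (.read 6 (var 38))) (rvar 7) ;;
    setNat 6 (var 24) (.const 0)

/-- Insertion of the best new center. -/
def addBestCmd : Cmd :=
  argmin 38 numN 24 24 (flipCostCmd 1) (.natLe (.read 6 (var 38)) (.const 0)) (rvar 7) ;;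
    setNat 6 (var 24) (.const 1)

theorem removeBestCmd_spec (h : HasDist I s) (hc : 2 ≤ (flagged I.n (s.nat 6)).card) :
    RemoveBest I.x (flagged I.n (s.nat 5)) (flagged I.n (s.nat 6))
      (flagged I.n ((removeBestCmd.den s).nat 6)) := by
  set am := argmin 38 numN 24 24 (flipCostCmd 0) (.natLe (.const 1) (.read 6 (var 38))) (rvar 7)
    with ham
  -- Every trial removal has to leave a center, since the search for a nearest one has no result
  -- otherwise.
  have hne : ∀ v, (flagged I.n (Function.update (s.nat 6) v 0)).Nonempty := by
    intro v
    rw [flagged_update_zero]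
    exact Finset.card_pos.1 (by have := Finset.pred_card_le_card_erase (s := flagged I.n (s.nat 6))
                                  (a := v); omega)
  have key := den_argmin (v := 38) (e := numN) (B := 24) (R := 24) (c := flipCostCmd 0)
    (T := .natLe (.const 1) (.read 6 (var 38))) (K := rvar 7) (s := s) (N := I.n)
    (fun u => 1 ≤ s.nat 6 u) (fun u => medianCost I.x (flagged I.n (s.nat 5))
      (flagged I.n (Function.update (s.nat 6) u 0))) rfl rfl rfl (by norm_num)
    (h.of_agreeOff (agreeOff_den (setNat 24 (.const 1) (.const 0)) s)).rounds_numN (by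
      intro u hu t ha hu'
      have ht : HasDist I t := h.of_agreeOff ha
      have hag := agreeOff_den (flipCostCmd 0) t
      constructor
      · simp only [Test.Holds, NatExpr.eval, hag.1 6 rfl, hag.1 38 rfl, hu', ha.1 6 rfl]
      · intro _
        have e6 : t.nat 6 = s.nat 6 := ha.1 6 rfl
        have := flipCostCmd_spec (c := 0) ht hu' (by rw [e6]; exact hne u)
        rw [e6, ha.1 5 rfl] at this
        simpa only [RealExpr.eval, NatExpr.eval] using this)
  obtain ⟨u₀, hu₀⟩ : (flagged I.n (s.nat 6)).Nonempty := Finset.card_pos.1 (by omega)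
  obtain ⟨-, h2, h3, -, h5⟩ := key.of_exists ⟨u₀, mem_flagged.1 hu₀⟩
  have e6 : (removeBestCmd.den s).nat 6 = Function.update (s.nat 6) ((am.den s).nat 24 0) 0 := by
    have hag := agreeOff_den am s
    simp [removeBestCmd, den_seq, ← ham, den, hag.1 6 rfl]
  rw [e6, flagged_update_zero]
  refine ⟨⟨_, mem_flagged.2 ⟨h2, h3⟩, rfl⟩, fun u hu => ?_⟩
  have := h5 u (mem_flagged.1 hu).1 (mem_flagged.1 hu).2
  simpa only [flagged_update_zero] using this

theorem addBestCmd_spec (h : HasDist I s) (hc : (flagged I.n (s.nat 6)).card < I.n) :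
    AddBest I.x I.n (flagged I.n (s.nat 5)) (flagged I.n (s.nat 6))
      (flagged I.n ((addBestCmd.den s).nat 6)) := by
  set am := argmin 38 numN 24 24 (flipCostCmd 1) (.natLe (.read 6 (var 38)) (.const 0)) (rvar 7)
    with ham
  have hmem : ∀ v, v ∈ Finset.range I.n \ flagged I.n (s.nat 6) ↔ v < I.n ∧ s.nat 6 v ≤ 0 := by
    intro v
    simp only [Finset.mem_sdiff, Finset.mem_range, mem_flagged]
    omega
  have key := den_argmin (v := 38) (e := numN) (B := 24) (R := 24) (c := flipCostCmd 1)
    (T := .natLe (.read 6 (var 38)) (.const 0)) (K := rvar 7) (s := s) (N := I.n)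
    (fun u => s.nat 6 u ≤ 0) (fun u => medianCost I.x (flagged I.n (s.nat 5))
      (flagged I.n (Function.update (s.nat 6) u 1))) rfl rfl rfl (by norm_num)
    (h.of_agreeOff (agreeOff_den (setNat 24 (.const 1) (.const 0)) s)).rounds_numN (by
      intro u hu t ha hu'
      have ht : HasDist I t := h.of_agreeOff ha
      have hag := agreeOff_den (flipCostCmd 1) t
      constructor
      · simp only [Test.Holds, NatExpr.eval, hag.1 6 rfl, hag.1 38 rfl, hu', ha.1 6 rfl]
      · intro _
        have e6 : t.nat 6 = s.nat 6 := ha.1 6 rfl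
        have := flipCostCmd_spec (c := 1) ht hu' (by
          rw [flagged_update_one _ hu]; exact Finset.insert_nonempty _ _)
        rw [e6, ha.1 5 rfl] at this
        simpa only [RealExpr.eval, NatExpr.eval] using this)
  obtain ⟨u₀, hu₀⟩ : (Finset.range I.n \ flagged I.n (s.nat 6)).Nonempty := by
    refine Finset.card_pos.1 ?_
    rw [Finset.card_sdiff_of_subset (flagged_subset _ _), Finset.card_range]
    omega
  obtain ⟨-, h2, h3, -, h5⟩ := key.of_exists ⟨u₀, (hmem u₀).1 hu₀⟩
  have e6 : (addBestCmd.den s).nat 6 = Function.update (s.nat 6) ((am.den s).nat 24 0) 1 := by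
    have hag := agreeOff_den am s
    simp [addBestCmd, den_seq, ← ham, den, hag.1 6 rfl]
  rw [e6, flagged_update_one _ h2]
  refine ⟨⟨_, (hmem _).2 ⟨h2, h3⟩, rfl⟩, fun u hu => ?_⟩
  obtain ⟨hu1, hu2⟩ := (hmem u).1 hu
  have := h5 u hu1 hu2
  rwa [flagged_update_one _ h2, flagged_update_one _ hu1] at this

/-- Removals down to `2 k` centers, and `n ^ 2` rounds of local search. -/
def searchCmd : Cmd :=
  natTable 37 numN 6 skip (.const 1) ;;
    for_ 40 (.sub numN (.add numK numK)) removeBestCmd ;;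
    for_ 40 numN (for_ 41 numN (addBestCmd ;; removeBestCmd))

/-- One loop has at most `n + d` rounds, so the `n * n` rounds of local search come from two nested
loops, and the invariant in the inner one is indexed by `i * n + j`. The strict inequality `2 * k <
n` guarantees a point to insert. -/
theorem searchCmd_spec (h : HasDist I s) (hk1 : 1 ≤ I.k) (hk : 2 * I.k < I.n) :
    SearchInv I.x I.n (flagged I.n (s.nat 5)) I.k (I.n * I.n)
      (flagged I.n ((searchCmd.den s).nat 6)) := by
  set Z := flagged I.n (s.nat 5) with hZ
  have a₁ := agreeOff_den (natTable 37 numN 6 skip (.const 1)) s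
  have hall : flagged I.n (((natTable 37 numN 6 skip (.const 1)).den s).nat 6) =
      Finset.range I.n := by
    have := den_natTable (v := 37) (e := numN) (A := 6) (c := skip) (E := .const 1) (s := s)
      (fun _ => 1) rfl rfl (by norm_num) h.rounds_numN (fun _ _ _ _ _ => rfl)
    refine Finset.filter_true_of_mem fun i hi => ?_
    rw [this i (Finset.mem_range.1 hi)]
  unfold searchCmd
  rw [den_seq, den_seq]
  set s₁ := (natTable 37 numN 6 skip (.const 1)).den s with hs₁
  have h₁ : HasDist I s₁ := h.of_agreeOff a₁
  have a₂ := agreeOff_den (for_ 40 (.sub numN (.add numK numK)) removeBestCmd) s₁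
  have hrem : RemovalInv I.x I.n Z I.k (I.n - 2 * I.k) (flagged I.n
      (((for_ 40 (.sub numN (.add numK numK)) removeBestCmd).den s₁).nat 6)) := by
    refine den_for (v := 40) (s := s₁) (P := removeBestCmd) rfl
      (h₁.rounds_of_le (N := I.n - 2 * I.k) ?_ (by omega))
      (fun i t => RemovalInv I.x I.n Z I.k i (flagged I.n (t.nat 6)))
      (fun i t j y hh => by simpa using hh) ?_ ?_
    · simp only [NatExpr.eval, h₁.n_eq, h₁.k_eq]; omega
    · rw [hall]; exact RemovalInv.zero (flagged_subset _ _) _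
    · intro i hi t ha _ hI
      have hD : HasDist I t := h₁.of_agreeOff ha
      have := removeBestCmd_spec hD (by rw [hI.card_eq]; omega)
      rw [show flagged I.n (t.nat 5) = Z by rw [ha.1 5 rfl, a₁.1 5 rfl]] at this
      exact hI.succ (by omega) this
  set s₂ := (for_ 40 (.sub numN (.add numK numK)) removeBestCmd).den s₁
  have h₂ : HasDist I s₂ := h₁.of_agreeOff a₂
  have e5 : s₂.nat 5 = s.nat 5 := by rw [a₂.1 5 rfl, a₁.1 5 rfl]
  refine den_for (v := 40) (e := numN) (s := s₂) (P := for_ 41 numN (addBestCmd ;; removeBestCmd))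
    rfl h₂.rounds_numN (fun i t => SearchInv I.x I.n Z I.k (i * I.n) (flagged I.n (t.nat 6)))
    (fun i t j y hh => by simpa using hh) ?_ ?_
  · rw [zero_mul]; exact hrem.searchInv hk.le
  · intro i hi t ha _ hI
    have ht : HasDist I t := h₂.of_agreeOff ha
    rw [Nat.succ_mul]
    refine den_for (v := 41) (e := numN) (s := t) (P := addBestCmd ;; removeBestCmd) rfl
      ht.rounds_numN (fun j t' => SearchInv I.x I.n Z I.k (i * I.n + j) (flagged I.n (t'.nat 6)))
      (fun i t j y hh => by simpa using hh) hI ?_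
    intro j hj t' ha' _ hJ
    have ht' : HasDist I t' := ht.of_agreeOff ha'
    have e5' : flagged I.n (t'.nat 5) = Z := by rw [ha'.1 5 rfl, ha.1 5 rfl, e5]
    have hadd := addBestCmd_spec ht' (by rw [hJ.card_eq]; exact hk)
    have aa := agreeOff_den addBestCmd t'
    have hcard : 2 ≤ (flagged I.n ((addBestCmd.den t').nat 6)).card := by
      obtain ⟨⟨v, hv, he⟩, -⟩ := hadd
      rw [he, Finset.card_insert_of_notMem (Finset.mem_sdiff.1 hv).2, hJ.card_eq]
      omega
    have hrm := removeBestCmd_spec (ht'.of_agreeOff aa) hcard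
    rw [aa.1 5 rfl, e5'] at hrm
    rw [e5'] at hadd
    exact hJ.succ hk1 hadd hrm

end PCentrum
end

noncomputable section
namespace PCentrum
open Cmd

/-! ### The program: centers, directions and leaders -/

/-- The nearest center of each point. -/
def centerCmd : Cmd := natTable 35 numN 8 (nearestCmd 6 35) (var 23)

/-- The distance of each point to its center. -/
def radiusCmd : Cmd :=
  realTable 35 numN 9 (setNat 14 (.const 0) (.read 8 (var 35))) (distExpr 35 14)

/-- The direction of each point as seen from its center. -/
def dirCmd : Cmd :=
  realTable₂ 35 numN 36 numD 8 4 skip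
    (.div (.sub (.read 1 (.add (.read 4 (var 35)) (var 36)))
      (.read 1 (.add (.read 4 (.read 8 (var 35))) (var 36)))) (.read 9 (var 35)))

variable {I : Inst} {s : Memory}

theorem centerCmd_spec (h : HasDist I s) (hne : (flagged I.n (s.nat 6)).Nonempty) :
    ∀ z < I.n, (centerCmd.den s).nat 8 z ∈ flagged I.n (s.nat 6) ∧
      dist (I.x z) (I.x ((centerCmd.den s).nat 8 z)) =
        Metric.infDist (I.x z) (I.x '' (flagged I.n (s.nat 6) : Set ℕ)) := by
  refine den_for (v := 35) (e := numN) (s := s) (P := nearestCmd 6 35 ;; setNat 8 (var 35) (var 23))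
    rfl h.rounds_numN (fun i t => ∀ z < i, t.nat 8 z ∈ flagged I.n (s.nat 6) ∧
      dist (I.x z) (I.x (t.nat 8 z)) =
        Metric.infDist (I.x z) (I.x '' (flagged I.n (s.nat 6) : Set ℕ)))
    (fun i t j y hh => by simpa using hh) (by simp) ?_
  intro i hi t ha ht hI z hz
  have e6 : t.nat 6 = s.nat 6 := ha.1 6 rfl
  have key := nearestCmd_spec (fl := 6) (a := 35) (h.of_agreeOff ha) (by norm_num) (by norm_num)
      (by norm_num) (by norm_num) ht hi (by rw [e6]; exact hne)
  have hag := agreeOff_den (nearestCmd 6 35) t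
  rw [e6] at key
  simp only [den, NatExpr.eval, hag.1 35 rfl, ht, Memory.setNat_nat, if_true, hag.1 8 rfl]
  rcases Nat.lt_succ_iff_lt_or_eq.1 hz with hlt | rfl
  · rw [Function.update_of_ne (by omega)]; exact hI z hlt
  · rw [Function.update_self]
    exact ⟨key.1, key.2.1.symm.trans key.2.2⟩

theorem radiusCmd_spec (h : HasDist I s) (hc : ∀ z < I.n, s.nat 8 z < I.n) :
    ∀ z < I.n, (radiusCmd.den s).real 9 z = radius I.x (s.nat 8) z := by
  refine den_realTable (radius I.x (s.nat 8)) rfl rfl h.rounds_numN ?_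
  intro z hz t ha hz'
  set c := setNat 14 (.const 0) (.read 8 (var 35))
  have hag := agreeOff_den c t
  have e8 : t.nat 8 = s.nat 8 := ha.1 8 rfl
  refine ((h.of_agreeOff ha).of_agreeOff hag).eval_distExpr (i := z) (j := s.nat 8 z) ?_ ?_ hz
    (hc z hz)
  · rw [hag.1 35 rfl, hz']
  · simp [c, den, hz', e8]

theorem dirCmd_spec (h : HasDist I s) (hc : ∀ z < I.n, s.nat 8 z < I.n)
    (hr : ∀ z < I.n, s.real 9 z = radius I.x (s.nat 8) z) :
    ∀ z < I.n, HasRow (dirCmd.den s) 8 z (dir I.x (s.nat 8) z) := by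
  intro z hz l
  rw [show (dirCmd.den s).real 8 (z * I.d + l) = _ from den_realTable₂ (N := I.n) (M := I.d)
    (fun z l => if hl : l < I.d then dir I.x (s.nat 8) z ⟨l, hl⟩ else 0) rfl rfl rfl rfl
    (by norm_num) (by norm_num) (by norm_num) h.rounds_numN
    (fun t ha => (h.of_agreeOff ha).rounds_numD) h.mulD ?_ z hz l l.2]
  · simp
  · intro z hz l hl t ha hz' hl'
    have ht : HasDist I t := h.of_agreeOff ha
    have e8 : t.nat 8 = s.nat 8 := ha.1 8 rfl
    have e9 : t.real 9 = s.real 9 := ha.2 9 rfl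
    simp only [den, RealExpr.eval, NatExpr.eval, hz', hl', e8, e9, ht.mulD z hz,
      ht.mulD _ (hc z hz), hr z hz, hl, dif_pos]
    rw [ht.row z hz ⟨l, hl⟩, ht.row _ (hc z hz) ⟨l, hl⟩]
    -- Division by zero gives zero both on the machine and in `dir`, so radius zero needs no
    -- separate case.
    simp [dir, div_eq_inv_mul]

/-- The test whether the point in `43` is a leader that is related to the point in `42`. -/
def leaderTest : Test :=
  .and (.and (.natLe (.read 9 (var 43)) (var 43)) (.natLe (var 43) (.read 9 (var 43))))
    (.not (.and
      (.not (.and (.natLe (.read 5 (var 43)) (.const 0)) (.and (.natLe (.read 5 (var 42)) (.const 0))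
        (.realLe (distExpr 43 42) (.mul (rvar 14) (rvar 22))))))
      (.not (.and (.natLe (.const 1) (.read 5 (var 43))) (.and
        (.natLe (.const 1) (.read 5 (var 42))) (.and
        (.and (.natLe (.read 8 (var 43)) (.read 8 (var 42)))
          (.natLe (.read 8 (var 42)) (.read 8 (var 43))))
        (.realLe (.sqrt (rvar 5)) (rvar 14))))))))

/-- Search for a leader of the point in `42`. -/
def findLeaderCmd : Cmd :=
  argmin 43 (var 42) 25 25 (sqDistCmd 8 43 8 42) leaderTest (.ofNat (.const 0))

/-- Greedy selection of leaders. -/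
def leaderCmd : Cmd :=
  for_ 42 numN (findLeaderCmd ;; ite (.natLe (.const 1) (.read 25 (.const 1)))
    (setNat 9 (var 42) (var 25)) (setNat 9 (var 42) (var 42)))

/-- Neither symmetry nor transitivity of `rel` is needed: a new index is only compared with earlier
leaders, and the hypothesis says that it joins one of them or is related to none. -/
theorem IsLeaderMap.succ {i : ℕ} {rel : ℕ → ℕ → Prop} {rep : ℕ → ℕ} (h : IsLeaderMap i rel rep)
    {r : ℕ} (hr : (r < i ∧ rep r = r ∧ rel r i) ∨ (r = i ∧ ∀ y < i, rep y = y → ¬ rel y i)) :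
    IsLeaderMap (i + 1) rel (Function.update rep i r) := by
  have hold : ∀ z < i, Function.update rep i r z = rep z := fun z hz =>
    Function.update_of_ne (by omega) _ _
  have hnew : Function.update rep i r i = r := Function.update_self _ _ _
  constructor
  · intro z hz
    rcases Nat.lt_succ_iff_lt_or_eq.1 hz with hlt | rfl
    · rw [hold z hlt]; have := h.lt z hlt; omega
    · rw [hnew]; omega
  · intro z hz
    rcases Nat.lt_succ_iff_lt_or_eq.1 hz with hlt | rfl
    · rw [hold z hlt, hold _ (h.lt z hlt), h.idem z hlt]
    · rw [hnew]
      rcases hr with hr | hr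
      · rw [hold r hr.1, hr.2.1]
      · rw [hr.1]; simp
  · intro z hz
    rcases Nat.lt_succ_iff_lt_or_eq.1 hz with hlt | rfl
    · rw [hold z hlt]; exact h.eq_or_rel z hlt
    · rw [hnew]
      rcases hr with hr | hr
      · exact Or.inr hr.2.2
      · exact Or.inl hr.1
  · intro y z hyz hz hy hz'
    rcases Nat.lt_succ_iff_lt_or_eq.1 hz with hlt | rfl
    · rw [hold y (by omega)] at hy
      rw [hold z hlt] at hz'
      exact h.not_rel y z hyz hlt hy hz'
    · rw [hold y hyz] at hy
      rw [hnew] at hz'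
      rcases hr with hr | hr
      · omega
      · exact hr.2 y hyz hy

theorem leaderCmd_spec {e ρ : ℝ} (h : HasDist I s) (he : s.real 14 0 = e) (hρ : s.real 22 0 = ρ)
    (hdir : ∀ z < I.n, HasRow s 8 z (dir I.x (s.nat 8) z)) :
    IsLeaderMap I.n (Related I.x e ρ (flagged I.n (s.nat 5)) (s.nat 8)) ((leaderCmd.den s).nat 9) := by
  set rel := Related I.x e ρ (flagged I.n (s.nat 5)) (s.nat 8) with hrel
  refine den_for (v := 42) (e := numN) (s := s)
    (P := findLeaderCmd ;; ite (.natLe (.const 1) (.read 25 (.const 1)))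
    (setNat 9 (var 42) (var 25)) (setNat 9 (var 42) (var 42))) rfl h.rounds_numN
    (fun i t => IsLeaderMap i rel (t.nat 9)) (fun i t j y hh => by simpa using hh)
    ⟨by simp, by simp, by simp, by simp⟩ ?_
  intro z hz t ha hz' hI
  have ht : HasDist I t := h.of_agreeOff ha
  -- With a constant key, the search for a minimum just decides whether a related earlier leader
  -- exists and returns one.
  have key := den_argmin (v := 43) (e := var 42) (B := 25) (R := 25) (c := sqDistCmd 8 43 8 42)
    (T := leaderTest) (K := .ofNat (.const 0)) (s := t) (N := z)
    (fun y => t.nat 9 y = y ∧ rel y z) (fun _ => 0) rfl rfl rfl (by norm_num) (by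
      refine (ht.of_agreeOff (agreeOff_den (setNat 25 (.const 1) (.const 0)) t)).rounds_of_le ?_ hz.le
      simp [den, hz']) (by
      intro y hy t' ha' hy'
      refine ⟨?_, fun _ => by simp⟩
      have hyn : y < I.n := hy.trans hz
      have ht' : HasDist I t' := ht.of_agreeOff ha'
      have e42' : t'.nat 42 0 = z := by rw [ha'.1 42 rfl, hz']
      have e8' : t'.nat 8 = s.nat 8 := by rw [ha'.1 8 rfl, ha.1 8 rfl]
      have hrow : ∀ w < I.n, HasRow t' 8 w (dir I.x (s.nat 8) w) := fun w hw =>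
        ((hdir w hw).of_agreeOff ha).of_agreeOff ha'
      have hsq := den_sqDistCmd (A := 8) (a := 43) (B := 8) (b := 42) ht'.toHasMul hy' e42' hyn hz
        (hrow y hyn) (hrow z hz) (by norm_num) (by norm_num) (by norm_num) (by norm_num)
      have hag := agreeOff_den (sqDistCmd 8 43 8 42) t'
      set t'' := (sqDistCmd 8 43 8 42).den t' with ht''
      have hd : HasDist I t'' := ht'.of_agreeOff hag
      have e43 : t''.nat 43 0 = y := by rw [hag.1 43 rfl, hy']
      have e42 : t''.nat 42 0 = z := by rw [hag.1 42 rfl, e42']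
      have e9 : t''.nat 9 = t.nat 9 := by rw [hag.1 9 rfl, ha'.1 9 rfl]
      have e5 : t''.nat 5 = s.nat 5 := by rw [hag.1 5 rfl, ha'.1 5 rfl, ha.1 5 rfl]
      have e8 : t''.nat 8 = s.nat 8 := by rw [hag.1 8 rfl, e8']
      have e14 : t''.real 14 0 = e := by rw [hag.2 14 rfl, ha'.2 14 rfl, ha.2 14 rfl, he]
      have e22 : t''.real 22 0 = ρ := by rw [hag.2 22 rfl, ha'.2 22 rfl, ha.2 22 rfl, hρ]
      have hdd : (distExpr 43 42).eval t'' = dist (I.x y) (I.x z) :=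
        hd.eval_distExpr e43 e42 hyn hz
      simp only [leaderTest, Test.Holds, hdd]
      simp only [NatExpr.eval, RealExpr.eval, e43, e42, e9, e5, e8, e14, e22, hsq,
        Real.sqrt_sq dist_nonneg, hrel, Related, mem_flagged, hyn, hz, true_and, not_le,
        Nat.lt_one_iff, Nat.le_zero, ← le_antisymm_iff]
      tauto)
  rw [den_seq]
  set t₁ := findLeaderCmd.den t with ht₁
  have hag := agreeOff_den findLeaderCmd t
  have e42 : t₁.nat 42 0 = z := by rw [hag.1 42 rfl, hz']
  have e9 : t₁.nat 9 = t.nat 9 := hag.1 9 rfl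
  change IsArgmin z _ _ (t₁.nat 25 1) (t₁.nat 25 0) (t₁.real 25 0) at key
  rcases key with ⟨k1, k2⟩ | ⟨k1, k2, k3, -, -⟩
  · rw [den_ite_neg (by simp [k1])]
    simp only [den, NatExpr.eval, e42, e9, Memory.setNat_nat, if_true]
    exact hI.succ (Or.inr ⟨rfl, fun y hy h1 h2 => k2 y hy ⟨h1, h2⟩⟩)
  · rw [den_ite_pos (by simp [k1])]
    simp only [den, NatExpr.eval, e42, e9, Memory.setNat_nat, if_true]
    exact hI.succ (Or.inl ⟨k2, k3.1, k3.2⟩)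

end PCentrum
end

noncomputable section
namespace PCentrum

/-! ### Filling buckets -/

/-- The state after the points in `D` have been put into buckets, in the order of their radii: `b`
assigns buckets (named after their first points), `cur` is the current bucket of each group (`n` if
there is none) and `sum` holds the sums of the buckets. -/
structure BucketInv (n : ℕ) (Z : Finset ℕ) (rep : ℕ → ℕ) (R δ : ℕ → ℝ) (D : Finset ℕ)
    (b cur : ℕ → ℕ) (sum : ℕ → ℝ) : Prop where
  subset : D ⊆ Z
  le : ∀ z ∈ D, ∀ w ∈ Z \ D, R z ≤ R w
  name : ∀ z ∈ D, b z ∈ D ∧ b (b z) = b z ∧ rep (b z) = rep z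
  cur_spec : ∀ g < n, (cur g = n ∧ ∀ z ∈ D, rep z ≠ g) ∨
    (cur g ∈ D ∧ b (cur g) = cur g ∧ rep (cur g) = g)
  last : ∀ z ∈ D, ∀ w ∈ D, rep z = rep w → b w = cur (rep w) → b z ≠ cur (rep z) → R z ≤ R w
  ordered : ∀ β γ, β ≠ γ →
    (∀ z ∈ D, b z = β → ∀ w ∈ D, b w = γ → rep z = rep w → R z ≤ R w) ∨
    (∀ z ∈ D, b z = β → ∀ w ∈ D, b w = γ → rep z = rep w → R w ≤ R z)
  sum_eq : ∀ β ∈ D, b β = β → sum β = ∑ w ∈ fiber D b β, R w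
  small : ∀ β ∈ D, b β = β →
    ∑ w ∈ fiber D b β, R w ≤ δ (rep β) ∨ (fiber D b β).card ≤ 1
  count : ∀ g < n, ((D.filter fun β => b β = β ∧ rep β = g).card : ℝ) * δ g +
    ∑ w ∈ fiber D b (cur g), R w ≤ δ g + 2 * ∑ w ∈ group D rep g, R w

theorem BucketInv.empty {n : ℕ} {Z : Finset ℕ} {rep : ℕ → ℕ} {R δ : ℕ → ℝ}
    (hδ : ∀ g < n, 0 ≤ δ g) {b cur : ℕ → ℕ} (hcur : ∀ g < n, cur g = n) (sum : ℕ → ℝ) :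
    BucketInv n Z rep R δ ∅ b cur sum where
  subset := by simp
  le := by simp
  name := by simp
  cur_spec g hg := Or.inl ⟨hcur g hg, by simp⟩
  last := by simp
  ordered := by simp
  sum_eq := by simp
  small := by simp
  count g hg := by simpa [fiber, group] using hδ g hg

section

variable {n : ℕ} {Z : Finset ℕ} {rep : ℕ → ℕ} {R δ : ℕ → ℝ} {D : Finset ℕ} {b cur : ℕ → ℕ}
  {sum : ℕ → ℝ} {z : ℕ}

theorem update_apply_of_mem {α : Type*} {D : Finset ℕ} {z : ℕ} (hz : z ∉ D) (f : ℕ → α) (v : α)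
    {w : ℕ} (hw : w ∈ D) : Function.update f z v w = f w :=
  Function.update_of_ne (by rintro rfl; exact hz hw) _ _

theorem fiber_insert_update (hz : z ∉ D) (β γ : ℕ) :
    fiber (insert z D) (Function.update b z β) γ =
      if γ = β then insert z (fiber D b γ) else fiber D b γ := by
  ext w
  by_cases hwz : w = z
  · subst hwz
    by_cases hγ : γ = β
    · simp [fiber, hγ]
    · simp [fiber, hγ, Ne.symm hγ, hz]
  · by_cases hγ : γ = β
    · simp [fiber, hγ, hwz]
    · simp [fiber, hγ, hwz]

theorem group_insert (g : ℕ) :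
    group (insert z D) rep g = if rep z = g then insert z (group D rep g) else group D rep g := by
  simp only [group, Finset.filter_insert]

theorem notMem_fiber (hz : z ∉ D) (γ : ℕ) : z ∉ fiber D b γ := fun h => hz (Finset.mem_filter.1 h).1

theorem notMem_group (hz : z ∉ D) (g : ℕ) : z ∉ group D rep g := fun h => hz (Finset.mem_filter.1 h).1

/-- The next point joins the current bucket of its group. -/
theorem BucketInv.join (h : BucketInv n Z rep R δ D b cur sum) (hR : ∀ w, 0 ≤ R w) (hz : z ∈ Z)
    (hzD : z ∉ D) (hmin : ∀ w ∈ Z \ D, R z ≤ R w) (hrep : rep z < n) (hn : cur (rep z) ≠ n)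
    (hsum : sum (cur (rep z)) + R z ≤ δ (rep z)) :
    BucketInv n Z rep R δ (insert z D) (Function.update b z (cur (rep z))) cur
      (Function.update sum (cur (rep z)) (sum (cur (rep z)) + R z)) := by
  obtain ⟨hcD, hcb, hcr⟩ : cur (rep z) ∈ D ∧ b (cur (rep z)) = cur (rep z) ∧
      rep (cur (rep z)) = rep z := (h.cur_spec _ hrep).resolve_left fun hh => hn hh.1
  set c := cur (rep z) with hc
  have hold : ∀ w ∈ D, Function.update b z c w = b w := fun w hw => update_apply_of_mem hzD b c hw
  have hnew : Function.update b z c z = c := Function.update_self _ _ _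
  have hzc : z ≠ c := fun hh => hzD (hh ▸ hcD)
  have hle : ∀ w ∈ D, R w ≤ R z := fun w hw => h.le w hw z (Finset.mem_sdiff.2 ⟨hz, hzD⟩)
  have hself : ∀ β ∈ insert z D, Function.update b z c β = β → β ∈ D ∧ b β = β := by
    intro β hβ hβ'
    rcases Finset.mem_insert.1 hβ with rfl | hβD
    · rw [hnew] at hβ'; exact absurd hβ'.symm hzc
    · exact ⟨hβD, by rwa [hold β hβD] at hβ'⟩
  constructor
  · exact Finset.insert_subset hz h.subset
  · intro u hu w hw
    have hw' : w ∈ Z \ D := Finset.mem_sdiff.2 ⟨(Finset.mem_sdiff.1 hw).1,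
      fun hh => (Finset.mem_sdiff.1 hw).2 (Finset.mem_insert_of_mem hh)⟩
    rcases Finset.mem_insert.1 hu with rfl | huD
    · exact hmin w hw'
    · exact h.le u huD w hw'
  · intro u hu
    rcases Finset.mem_insert.1 hu with rfl | huD
    · rw [hnew, hold c hcD]; exact ⟨Finset.mem_insert_of_mem hcD, hcb, hcr⟩
    · obtain ⟨n1, n2, n3⟩ := h.name u huD
      rw [hold u huD, hold _ n1]; exact ⟨Finset.mem_insert_of_mem n1, n2, n3⟩
  · intro g hg
    by_cases hgz : g = rep z
    · subst hgz
      right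
      rw [← hc, hold c hcD]; exact ⟨Finset.mem_insert_of_mem hcD, hcb, hcr⟩
    · rcases h.cur_spec g hg with ⟨c1, c2⟩ | ⟨c1, c2, c3⟩
      · left
        refine ⟨c1, fun u hu => ?_⟩
        rcases Finset.mem_insert.1 hu with rfl | huD
        · exact fun hh => hgz hh.symm
        · exact c2 u huD
      · right
        rw [hold _ c1]; exact ⟨Finset.mem_insert_of_mem c1, c2, c3⟩
  · intro u hu w hw hr hw1 hu1
    rcases Finset.mem_insert.1 hu with rfl | huD
    · rw [hnew] at hu1; exact absurd rfl hu1
    rcases Finset.mem_insert.1 hw with rfl | hwD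
    · exact hle u huD
    · rw [hold w hwD] at hw1
      rw [hold u huD] at hu1
      exact h.last u huD w hwD hr hw1 hu1
  · -- only the bucket `c` has changed, by a point of maximal radius
    have hlast : ∀ u ∈ D, ∀ w ∈ insert z D, rep u = rep w → rep w = rep z → b u ≠ c →
        Function.update b z c w = c → R u ≤ R w := by
      intro u huD w hw hr hrz hu hw'
      rcases Finset.mem_insert.1 hw with rfl | hwD
      · exact hle u huD
      · rw [hold w hwD] at hw'
        refine h.last u huD w hwD hr ?_ ?_
        · rw [hw', hrz]
        · rw [hr, hrz]; exact hu
    have hcrep : ∀ w ∈ insert z D, Function.update b z c w = c → rep w = rep z := by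
      intro w hw hw'
      rcases Finset.mem_insert.1 hw with rfl | hwD
      · rfl
      · rw [hold w hwD] at hw'
        rw [← (h.name w hwD).2.2, hw', hcr]
    intro β γ hne
    by_cases hβ : β = c
    · right
      intro u hu hu' w hw hw' hr
      have hwne : w ≠ z := by
        rintro rfl
        rw [hnew] at hw'; exact hne (hβ.trans hw')
      have hwD := Finset.mem_of_mem_insert_of_ne hw hwne
      rw [hold w hwD] at hw'
      exact hlast w hwD u hu hr.symm (hcrep u hu (hu'.trans hβ)) (by
        rw [hw', ← hβ]; exact hne.symm) (hu'.trans hβ)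
    by_cases hγ : γ = c
    · left
      intro u hu hu' w hw hw' hr
      have hune : u ≠ z := by
        rintro rfl
        rw [hnew] at hu'; exact hβ hu'.symm
      have huD := Finset.mem_of_mem_insert_of_ne hu hune
      rw [hold u huD] at hu'
      exact hlast u huD w hw hr (hcrep w hw (hw'.trans hγ)) (by rw [hu']; exact hβ)
        (hw'.trans hγ)
    · have hsub : ∀ w ∈ insert z D, Function.update b z c w ≠ c → w ∈ D ∧
          Function.update b z c w = b w := by
        intro w hw hw'
        rcases Finset.mem_insert.1 hw with rfl | hwD
        · exact absurd hnew hw'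
        · exact ⟨hwD, hold w hwD⟩
      refine (h.ordered β γ hne).imp ?_ ?_ <;>
      · intro hh u hu hu' w hw hw' hr
        obtain ⟨huD, hue⟩ := hsub u hu (by rw [hu']; exact hβ)
        obtain ⟨hwD, hwe⟩ := hsub w hw (by rw [hw']; exact hγ)
        exact hh u huD (hue ▸ hu') w hwD (hwe ▸ hw') hr
  · intro β hβ hβ'
    obtain ⟨hβD, hβb⟩ := hself β hβ hβ'
    rw [fiber_insert_update hzD]
    by_cases hβc : β = c
    · rw [if_pos hβc, Finset.sum_insert (notMem_fiber hzD β), hβc, Function.update_self,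
        h.sum_eq c hcD hcb, add_comm]
    · rw [if_neg hβc, Function.update_of_ne hβc, h.sum_eq β hβD hβb]
  · intro β hβ hβ'
    obtain ⟨hβD, hβb⟩ := hself β hβ hβ'
    rw [fiber_insert_update hzD]
    by_cases hβc : β = c
    · left
      rw [if_pos hβc, Finset.sum_insert (notMem_fiber hzD β), hβc, hcr, ← h.sum_eq c hcD hcb,
        add_comm]
      exact hsum
    · rw [if_neg hβc]; exact h.small β hβD hβb
  · intro g hg
    have hcard : ((insert z D).filter fun β => Function.update b z c β = β ∧ rep β = g) =
        D.filter fun β => b β = β ∧ rep β = g := by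
      ext β
      simp only [Finset.mem_filter]
      constructor
      · rintro ⟨h1, h2, h3⟩
        obtain ⟨h4, h5⟩ := hself β h1 h2
        exact ⟨h4, h5, h3⟩
      · rintro ⟨h1, h2, h3⟩
        exact ⟨Finset.mem_insert_of_mem h1, by rw [hold β h1]; exact h2, h3⟩
    have hcount := h.count g hg
    rw [hcard, fiber_insert_update hzD, group_insert]
    by_cases hgz : rep z = g
    · have : cur g = c := by rw [hc, hgz]
      rw [if_pos this, if_pos hgz, Finset.sum_insert (notMem_fiber hzD _),
        Finset.sum_insert (notMem_group hzD _)]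
      -- In `count` the left side grows by `R z` and the right side by `2 * R z`.
      have := hR z
      linarith
    · have : cur g ≠ c := by
        intro hh
        rcases h.cur_spec g hg with ⟨c1, -⟩ | ⟨-, -, c3⟩
        · exact hn (hh.symm.trans c1)
        · rw [hh, hcr] at c3; exact hgz c3
      rw [if_neg this, if_neg hgz]
      exact hcount

/-- The next point opens a bucket. -/
theorem BucketInv.open_bucket (h : BucketInv n Z rep R δ D b cur sum) (hR : ∀ w, 0 ≤ R w)
    (hz : z ∈ Z) (hzD : z ∉ D) (hZn : Z ⊆ Finset.range n) (hmin : ∀ w ∈ Z \ D, R z ≤ R w)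
    (hrep : rep z < n)
    (hsum : cur (rep z) ≠ n → δ (rep z) ≤ sum (cur (rep z)) + R z) :
    BucketInv n Z rep R δ (insert z D) (Function.update b z z) (Function.update cur (rep z) z)
      (Function.update sum z (R z)) := by
  have hold : ∀ w ∈ D, Function.update b z z w = b w := fun w hw => update_apply_of_mem hzD b z hw
  have hnew : Function.update b z z z = z := Function.update_self _ _ _
  have hle : ∀ w ∈ D, R w ≤ R z := fun w hw => h.le w hw z (Finset.mem_sdiff.2 ⟨hz, hzD⟩)
  -- Names of buckets are points already placed, so the name `z` is new.
  have hbz : ∀ w ∈ D, b w ≠ z := fun w hw hh => hzD (hh ▸ (h.name w hw).1)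
  have hfz : fiber D b z = ∅ := Finset.filter_eq_empty_iff.2 fun w hw => hbz w hw
  have hzn : z < n := Finset.mem_range.1 (hZn hz)
  constructor
  · exact Finset.insert_subset hz h.subset
  · intro u hu w hw
    have hw' : w ∈ Z \ D := Finset.mem_sdiff.2 ⟨(Finset.mem_sdiff.1 hw).1,
      fun hh => (Finset.mem_sdiff.1 hw).2 (Finset.mem_insert_of_mem hh)⟩
    rcases Finset.mem_insert.1 hu with rfl | huD
    · exact hmin w hw'
    · exact h.le u huD w hw'
  · intro u hu
    rcases Finset.mem_insert.1 hu with rfl | huD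
    · rw [hnew, hnew]; exact ⟨Finset.mem_insert_self _ _, rfl, rfl⟩
    · obtain ⟨n1, n2, n3⟩ := h.name u huD
      rw [hold u huD, hold _ n1]; exact ⟨Finset.mem_insert_of_mem n1, n2, n3⟩
  · intro g hg
    by_cases hgz : g = rep z
    · subst hgz
      right
      rw [Function.update_self, hnew]
      exact ⟨Finset.mem_insert_self _ _, rfl, rfl⟩
    · rw [Function.update_of_ne hgz]
      rcases h.cur_spec g hg with ⟨c1, c2⟩ | ⟨c1, c2, c3⟩
      · left
        refine ⟨c1, fun u hu => ?_⟩
        rcases Finset.mem_insert.1 hu with rfl | huD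
        · exact fun hh => hgz hh.symm
        · exact c2 u huD
      · right
        rw [hold _ c1]; exact ⟨Finset.mem_insert_of_mem c1, c2, c3⟩
  · intro u hu w hw hr hw1 hu1
    rcases Finset.mem_insert.1 hw with rfl | hwD
    · rcases Finset.mem_insert.1 hu with rfl | huD
      · exact le_rfl
      · exact hle u huD
    · by_cases hwz : rep w = rep z
      · rw [hwz, Function.update_self, hold w hwD] at hw1
        exact absurd hw1 (hbz w hwD)
      · have hune : u ≠ z := by
          rintro rfl
          exact hwz hr.symm
        have huD := Finset.mem_of_mem_insert_of_ne hu hune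
        rw [hold w hwD, Function.update_of_ne hwz] at hw1
        rw [hold u huD, hr, Function.update_of_ne hwz] at hu1
        exact h.last u huD w hwD hr hw1 (by rw [hr]; exact hu1)
  · have hz1 : ∀ w ∈ insert z D, Function.update b z z w = z → w = z := by
      intro w hw hw'
      rcases Finset.mem_insert.1 hw with rfl | hwD
      · rfl
      · rw [hold w hwD] at hw'; exact absurd hw' (hbz w hwD)
    have hlez : ∀ w ∈ insert z D, R w ≤ R z := by
      intro w hw
      rcases Finset.mem_insert.1 hw with rfl | hwD
      · exact le_rfl
      · exact hle w hwD
    intro β γ hne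
    by_cases hβ : β = z
    · right
      intro u hu hu' w hw _ _
      rw [hz1 u hu (hu'.trans hβ)]; exact hlez w hw
    by_cases hγ : γ = z
    · left
      intro u hu _ w hw hw' _
      rw [hz1 w hw (hw'.trans hγ)]; exact hlez u hu
    · have hsub : ∀ w ∈ insert z D, Function.update b z z w ≠ z → w ∈ D ∧
          Function.update b z z w = b w := by
        intro w hw hw'
        rcases Finset.mem_insert.1 hw with rfl | hwD
        · exact absurd hnew hw'
        · exact ⟨hwD, hold w hwD⟩
      refine (h.ordered β γ hne).imp ?_ ?_ <;>
      · intro hh u hu hu' w hw hw' hr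
        obtain ⟨huD, hue⟩ := hsub u hu (by rw [hu']; exact hβ)
        obtain ⟨hwD, hwe⟩ := hsub w hw (by rw [hw']; exact hγ)
        exact hh u huD (hue ▸ hu') w hwD (hwe ▸ hw') hr
  · intro β hβ hβ'
    rw [fiber_insert_update hzD]
    rcases Finset.mem_insert.1 hβ with rfl | hβD
    · rw [if_pos rfl, hfz, Function.update_self]; simp
    · have hβz : β ≠ z := fun hh => hzD (hh ▸ hβD)
      rw [if_neg hβz, Function.update_of_ne hβz]
      exact h.sum_eq β hβD (by rwa [hold β hβD] at hβ')
  · intro β hβ hβ'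
    rw [fiber_insert_update hzD]
    rcases Finset.mem_insert.1 hβ with rfl | hβD
    · right
      rw [if_pos rfl, hfz]; simp
    · have hβz : β ≠ z := fun hh => hzD (hh ▸ hβD)
      rw [if_neg hβz]
      exact h.small β hβD (by rwa [hold β hβD] at hβ')
  · intro g hg
    have hcard : ((insert z D).filter fun β => Function.update b z z β = β ∧ rep β = g) =
        if rep z = g then insert z (D.filter fun β => b β = β ∧ rep β = g)
        else D.filter fun β => b β = β ∧ rep β = g := by
      ext β
      by_cases hβz : β = z
      · subst hβz
        split_ifs with hg' <;> simp [hg', hzD]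
      · split_ifs with hg' <;> simp [hβz]
    have hcount := h.count g hg
    rw [hcard, fiber_insert_update hzD, group_insert]
    by_cases hgz : rep z = g
    · subst hgz
      rw [if_pos rfl, if_pos rfl, Function.update_self, if_pos rfl, hfz,
        Finset.sum_insert (notMem_group hzD _),
        Finset.card_insert_of_notMem fun hh => hzD (Finset.mem_filter.1 hh).1]
      simp only [insert_empty_eq, Finset.sum_singleton]
      push_cast
      have hRz := hR z
      -- The first bucket of a group is paid for by the summand `δ g` in `count`. A later one is
      -- paid for by the previous bucket together with `z`, whose sum is at least `δ`. As `R z` is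
      -- used there and again in the sum of the new bucket, the group sum enters `count` with the
      -- factor `2`.
      rcases h.cur_spec _ hrep with ⟨c1, c2⟩ | ⟨c1, c2, c3⟩
      · have e1 : (D.filter fun β => b β = β ∧ rep β = rep z) = ∅ :=
          Finset.filter_eq_empty_iff.2 fun w hw hh => c2 w hw hh.2
        have e2 : group D rep (rep z) = ∅ := Finset.filter_eq_empty_iff.2 fun w hw => c2 w hw
        rw [e1, e2]
        simp
        linarith
      · have hcn : cur (rep z) ≠ n := by
          have := Finset.mem_range.1 (hZn (h.subset c1))
          omega
        have h1 := hsum hcn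
        rw [h.sum_eq _ c1 c2] at h1
        linarith
    · have hcz : cur g ≠ z := by
        intro hh
        rcases h.cur_spec g hg with ⟨c1, -⟩ | ⟨c1, -, -⟩
        · omega
        · exact hzD (hh ▸ c1)
      rw [if_neg hgz, Function.update_of_ne fun hh => hgz hh.symm, if_neg hcz, if_neg hgz]
      exact hcount

/-- The result of filling buckets. -/
theorem BucketInv.isBucketing (h : BucketInv n Z rep R δ Z b cur sum) (hR : ∀ w, 0 ≤ R w)
    {g : ℕ} (hδ : 0 ≤ δ g) : IsBucketing (group Z rep g) b R (δ g) where
  nonneg z _ := hR z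
  delta_nonneg := hδ
  ordered β γ hne := by
    refine (h.ordered β γ hne).imp ?_ ?_ <;>
    · intro hh u hu w hw
      obtain ⟨hu1, hu2⟩ := Finset.mem_filter.1 hu
      obtain ⟨hu1, hu3⟩ := Finset.mem_filter.1 hu1
      obtain ⟨hw1, hw2⟩ := Finset.mem_filter.1 hw
      obtain ⟨hw1, hw3⟩ := Finset.mem_filter.1 hw1
      exact hh u hu1 hu2 w hw1 hw2 (hu3.trans hw3.symm)
  small β := by
    rcases (fiber (group Z rep g) b β).eq_empty_or_nonempty with he | ⟨u, hu⟩
    · right; rw [he]; simp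
    · obtain ⟨hu1, hu2⟩ := Finset.mem_filter.1 hu
      obtain ⟨hu1, hu3⟩ := Finset.mem_filter.1 hu1
      obtain ⟨n1, n2, n3⟩ := h.name u hu1
      rw [hu2] at n1 n2 n3
      have hsub : fiber (group Z rep g) b β ⊆ fiber Z b β :=
        Finset.filter_subset_filter _ (Finset.filter_subset _ _)
      rcases h.small β n1 n2 with hs | hs
      · left
        rw [n3, hu3] at hs
        exact (Finset.sum_le_sum_of_subset_of_nonneg hsub fun w _ _ => hR w).trans hs
      · right
        exact (Finset.card_le_card hsub).trans hs

/-- The buckets of a group are counted by their names, which are the fixed points of `b` with that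
leader; the sum of the current bucket is dropped from `count`. -/
theorem BucketInv.card_image_mul_le (h : BucketInv n Z rep R δ Z b cur sum) (hR : ∀ w, 0 ≤ R w)
    {g : ℕ} (hg : g < n) (hδ : 0 ≤ δ g) :
    (((group Z rep g).image b).card : ℝ) * δ g ≤ δ g + 2 * ∑ w ∈ group Z rep g, R w := by
  have h1 := h.count g hg
  have h2 : 0 ≤ ∑ w ∈ fiber Z b (cur g), R w := Finset.sum_nonneg fun w _ => hR w
  have h3 : ((group Z rep g).image b).card ≤ (Z.filter fun β => b β = β ∧ rep β = g).card := by
    refine Finset.card_le_card fun β hβ => ?_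
    obtain ⟨u, hu, rfl⟩ := Finset.mem_image.1 hβ
    obtain ⟨hu1, hu2⟩ := Finset.mem_filter.1 hu
    obtain ⟨n1, n2, n3⟩ := h.name u hu1
    exact Finset.mem_filter.2 ⟨n1, n2, n3.trans hu2⟩
  have h4 : (((group Z rep g).image b).card : ℝ) * δ g ≤
      ((Z.filter fun β => b β = β ∧ rep β = g).card : ℝ) * δ g :=
    mul_le_mul_of_nonneg_right (by exact_mod_cast h3) hδ
  linarith

/-- Points share the leader of their bucket's name, so no bucket meets two groups. Hence the mean
over a bucket within all of `Z`, which the program computes, is the mean within the group. -/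
theorem BucketInv.fiber_group_eq (h : BucketInv n Z rep R δ Z b cur sum) (hz : z ∈ Z) :
    fiber (group Z rep (rep z)) b (b z) = fiber Z b (b z) := by
  ext w
  simp only [fiber, group, Finset.mem_filter]
  constructor
  · rintro ⟨⟨h1, -⟩, h2⟩
    exact ⟨h1, h2⟩
  · rintro ⟨h1, h2⟩
    refine ⟨⟨h1, ?_⟩, h2⟩
    rw [← (h.name w h1).2.2, h2, (h.name z hz).2.2]

end

end PCentrum
end

noncomputable section
namespace PCentrum
open Cmd

/-! ### The program: buckets -/

variable {I : Inst} {s : Memory}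

/-- The largest sum of a bucket, for each group. -/
def budgetCmd : Cmd :=
  realTable 44 numN 10
    (condSum 45 numN 7 (.and (.natLe (.const 1) (.read 5 (var 45)))
      (.and (.natLe (.read 9 (var 45)) (var 44)) (.natLe (var 44) (.read 9 (var 45)))))
      (.read 9 (var 45)))
    (.div (.mul (rvar 14) (rvar 7)) (.ofNat numK))

theorem budgetCmd_spec {e : ℝ} {R : ℕ → ℝ} (h : HasDist I s) (he : s.real 14 0 = e)
    (hr : ∀ z < I.n, s.real 9 z = R z) :
    ∀ g < I.n, (budgetCmd.den s).real 10 g =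
      e * (∑ z ∈ group (flagged I.n (s.nat 5)) (s.nat 9) g, R z) / I.k := by
  refine den_realTable (fun g => e * (∑ z ∈ group (flagged I.n (s.nat 5)) (s.nat 9) g, R z) / I.k)
    rfl rfl h.rounds_numN ?_
  intro g hg t ha hg'
  have ht : HasDist I t := h.of_agreeOff ha
  have hsum := den_condSum (v := 45) (e := numN) (acc := 7)
    (T := .and (.natLe (.const 1) (.read 5 (var 45)))
      (.and (.natLe (.read 9 (var 45)) (var 44)) (.natLe (var 44) (.read 9 (var 45)))))
    (E := .read 9 (var 45)) (s := t) (N := I.n) (fun z => 1 ≤ s.nat 5 z ∧ s.nat 9 z = g) R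
    (by norm_num) ht.rounds_numN (by
      intro z hz t' ha' hz'
      have e5 : t'.nat 5 = s.nat 5 := by rw [ha'.1 5 rfl, ha.1 5 rfl]
      have e9 : t'.nat 9 = s.nat 9 := by rw [ha'.1 9 rfl, ha.1 9 rfl]
      have e9' : t'.real 9 = s.real 9 := by rw [ha'.2 9 rfl, ha.2 9 rfl]
      have e44 : t'.nat 44 0 = g := by rw [ha'.1 44 rfl, hg']
      refine ⟨?_, fun _ => by simp only [RealExpr.eval, NatExpr.eval, hz', e9', hr z hz]⟩
      simp only [Test.Holds, NatExpr.eval, hz', e5, e9, e44, ← le_antisymm_iff])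
  set cs := condSum 45 numN 7 (.and (.natLe (.const 1) (.read 5 (var 45)))
      (.and (.natLe (.read 9 (var 45)) (var 44)) (.natLe (var 44) (.read 9 (var 45)))))
      (.read 9 (var 45)) with hcs
  have hag := agreeOff_den cs t
  have e14 : (cs.den t).real 14 0 = e := by rw [hag.2 14 rfl, ha.2 14 rfl, he]
  simp only [RealExpr.eval, NatExpr.eval, hsum, e14, (ht.of_agreeOff hag).k_eq]
  rw [group, flagged, Finset.filter_filter]

/-- The outer point of smallest radius that is in no bucket. -/
def nextCmd : Cmd :=
  argmin 46 numN 26 26 skip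
    (.and (.natLe (.const 1) (.read 5 (var 46))) (.natLe (.read 10 (var 46)) (.const 0)))
    (.read 9 (var 46))

/-- The test whether the point in `26` fits into the bucket in `17` of its group in `16`. -/
def fitsTest : Test :=
  .and (.natLe (.add (var 17) (.const 1)) numN)
    (.realLe (.add (.read 11 (var 17)) (.read 9 (var 26))) (.read 10 (var 16)))

/-- Placement of the point in `26`. -/
def placeCmd : Cmd :=
  setNat 10 (var 26) (.const 1) ;; setNat 16 (.const 0) (.read 9 (var 26)) ;;
    setNat 17 (.const 0) (.read 11 (var 16)) ;;
    ite fitsTest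
      (setNat 12 (var 26) (var 17) ;;
        setReal 11 (var 17) (.add (.read 11 (var 17)) (.read 9 (var 26))))
      (setNat 12 (var 26) (var 26) ;; setNat 11 (var 16) (var 26) ;;
        setReal 11 (var 26) (.read 9 (var 26)))

/-- Filling buckets. -/
def bucketCmd : Cmd :=
  natTable 44 numN 10 skip (.const 0) ;; natTable 44 numN 11 skip numN ;;
    for_ 44 numN (nextCmd ;; ite (.natLe (.const 1) (.read 26 (.const 1))) placeCmd skip)

/-- The memory holds the state of filling buckets. -/
def HasBuckets (I : Inst) (Z : Finset ℕ) (rep : ℕ → ℕ) (R δ : ℕ → ℝ) (s : Memory) : Prop :=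
  BucketInv I.n Z rep R δ (flagged I.n (s.nat 10)) (s.nat 12) (s.nat 11) (s.real 11)

section

variable {Z : Finset ℕ} {rep : ℕ → ℕ} {R δ : ℕ → ℝ}

theorem placeCmd_spec (h : HasDist I s) (hrep : ∀ z < I.n, rep z < I.n)
    (h9 : s.nat 9 = rep) (hr : ∀ z < I.n, s.real 9 z = R z) (hδ : ∀ g < I.n, s.real 10 g = δ g)
    (hR : ∀ z, 0 ≤ R z) (hZ : Z ⊆ Finset.range I.n) (hb : HasBuckets I Z rep R δ s) {z : ℕ}
    (hz : s.nat 26 0 = z) (hzZ : z ∈ Z) (hzD : z ∉ flagged I.n (s.nat 10))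
    (hmin : ∀ w ∈ Z \ flagged I.n (s.nat 10), R z ≤ R w) :
    HasBuckets I Z rep R δ (placeCmd.den s) ∧
      flagged I.n ((placeCmd.den s).nat 10) = insert z (flagged I.n (s.nat 10)) := by
  have hzn : z < I.n := Finset.mem_range.1 (hZ hzZ)
  set c := (setNat 10 (var 26) (.const 1) ;; setNat 16 (.const 0) (.read 9 (var 26)) ;;
    setNat 17 (.const 0) (.read 11 (var 16))) with hc
  have hag := agreeOff_den c s
  set t := c.den s with ht
  have hD : HasDist I t := h.of_agreeOff hag
  have e26 : t.nat 26 0 = z := by rw [hag.1 26 rfl, hz]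
  have e16 : t.nat 16 0 = rep z := by simp [ht, hc, den, hz, h9]
  have e17 : t.nat 17 0 = s.nat 11 (rep z) := by simp [ht, hc, den, hz, h9]
  have e10 : t.nat 10 = Function.update (s.nat 10) z 1 := by simp [ht, hc, den, hz]
  have e11 : t.nat 11 = s.nat 11 := hag.1 11 rfl
  have e12 : t.nat 12 = s.nat 12 := hag.1 12 rfl
  have e11' : t.real 11 = s.real 11 := hag.2 11 rfl
  have e9' : t.real 9 z = R z := by rw [hag.2 9 rfl, hr z hzn]
  have e10' : t.real 10 (rep z) = δ (rep z) := by rw [hag.2 10 rfl, hδ _ (hrep z hzn)]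
  have hflag : flagged I.n (Function.update (s.nat 10) z 1) = insert z (flagged I.n (s.nat 10)) :=
    flagged_update_one _ hzn
  -- A missing bucket is marked by `n`, and all names are below `n`; therefore the comparison with
  -- `n` in `fitsTest` detects whether there is a current bucket.
  have hle : s.nat 11 (rep z) ≤ I.n := by
    rcases hb.cur_spec _ (hrep z hzn) with hh | hh
    · exact hh.1.le
    · exact (mem_flagged.1 hh.1).1.le
  have hT : Test.Holds t fitsTest ↔ s.nat 11 (rep z) ≠ I.n ∧
      s.real 11 (s.nat 11 (rep z)) + R z ≤ δ (rep z) := by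
    simp only [fitsTest, Test.Holds, NatExpr.eval, RealExpr.eval, e16, e17, e26, hD.n_eq, e11',
      e9', e10']
    refine and_congr_left fun _ => ?_
    omega
  have hden : placeCmd.den s = (ite fitsTest
      (setNat 12 (var 26) (var 17) ;;
        setReal 11 (var 17) (.add (.read 11 (var 17)) (.read 9 (var 26))))
      (setNat 12 (var 26) (var 26) ;; setNat 11 (var 16) (var 26) ;;
        setReal 11 (var 26) (.read 9 (var 26)))).den t := rfl
  rw [hden]
  by_cases hif : s.nat 11 (rep z) ≠ I.n ∧ s.real 11 (s.nat 11 (rep z)) + R z ≤ δ (rep z)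
  · rw [den_ite_pos (hT.2 hif)]
    have := hb.join hR hzZ hzD hmin (hrep z hzn) hif.1 hif.2
    simpa [HasBuckets, den, e10, hflag, e12, e11, e11', e17, e26, e9'] using this
  · rw [den_ite_neg fun hh => hif (hT.1 hh)]
    have := hb.open_bucket hR hzZ hzD hZ hmin (hrep z hzn) fun h1 => by
      by_contra! h2
      exact hif ⟨h1, h2.le⟩
    simpa [HasBuckets, den, e10, hflag, e12, e11, e11', e16, e26, e9'] using this

theorem bucketCmd_spec (h : HasDist I s) (h5 : flagged I.n (s.nat 5) = Z) (h9 : s.nat 9 = rep)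
    (hrep : ∀ z < I.n, rep z < I.n) (hr : ∀ z < I.n, s.real 9 z = R z)
    (hδ : ∀ g < I.n, s.real 10 g = δ g) (hR : ∀ z, 0 ≤ R z) (hδ0 : ∀ g, 0 ≤ δ g) :
    ∃ cur sum, BucketInv I.n Z rep R δ Z ((bucketCmd.den s).nat 12) cur sum := by
  have hZ : Z ⊆ Finset.range I.n := h5 ▸ flagged_subset _ _
  set s₁ := (natTable 44 numN 10 skip (.const 0)).den s with hs₁
  have a₁ := agreeOff_den (natTable 44 numN 10 skip (.const 0)) s
  have h₁ : HasDist I s₁ := h.of_agreeOff a₁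
  set s₂ := (natTable 44 numN 11 skip numN).den s₁ with hs₂
  have a₂ := agreeOff_den (natTable 44 numN 11 skip numN) s₁
  have h₂ : HasDist I s₂ := h₁.of_agreeOff a₂
  have hdone : flagged I.n (s₂.nat 10) = ∅ := by
    rw [a₂.1 10 rfl]
    have := den_natTable (v := 44) (e := numN) (A := 10) (c := skip) (E := .const 0) (s := s)
      (fun _ => 0) rfl rfl (by norm_num) h.rounds_numN (fun _ _ _ _ _ => rfl)
    refine Finset.filter_eq_empty_iff.2 fun i hi => ?_
    rw [this i (Finset.mem_range.1 hi)]; simp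
  have hcur : ∀ g < I.n, s₂.nat 11 g = I.n :=
    den_natTable (v := 44) (e := numN) (A := 11) (c := skip) (E := numN) (s := s₁)
      (fun _ => I.n) rfl rfl (by norm_num) h₁.rounds_numN
      (fun _ _ t ha _ => (h₁.of_agreeOff ha).n_eq)
  -- Either all outer points are placed, or every round so far has placed one. As `Z` has at most
  -- `n` points, `n` rounds suffice.
  have key := den_for (v := 44) (e := numN) (s := s₂)
    (P := nextCmd ;; ite (.natLe (.const 1) (.read 26 (.const 1))) placeCmd skip) rfl
    h₂.rounds_numN (fun i t => HasBuckets I Z rep R δ t ∧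
      (flagged I.n (t.nat 10) = Z ∨ i ≤ (flagged I.n (t.nat 10)).card))
    (fun i t j y hh => by simpa [HasBuckets] using hh)
    ⟨by
      unfold HasBuckets
      rw [hdone]; exact BucketInv.empty (fun g _ => hδ0 g) hcur _, by simp⟩ (by
    intro i hi t ha _ hI
    obtain ⟨hI, hcard⟩ := hI
    have ht : HasDist I t := h₂.of_agreeOff ha
    have e5 : t.nat 5 = s.nat 5 := by rw [ha.1 5 rfl, a₂.1 5 rfl, a₁.1 5 rfl]
    have e9 : t.nat 9 = rep := by rw [ha.1 9 rfl, a₂.1 9 rfl, a₁.1 9 rfl, h9]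
    have e9' : t.real 9 = s.real 9 := by rw [ha.2 9 rfl, a₂.2 9 rfl, a₁.2 9 rfl]
    have e10' : t.real 10 = s.real 10 := by rw [ha.2 10 rfl, a₂.2 10 rfl, a₁.2 10 rfl]
    have key := den_argmin (v := 46) (e := numN) (B := 26) (R := 26) (c := skip)
      (T := .and (.natLe (.const 1) (.read 5 (var 46))) (.natLe (.read 10 (var 46)) (.const 0)))
      (K := .read 9 (var 46)) (s := t) (N := I.n)
      (fun w => w ∈ Z \ flagged I.n (t.nat 10)) R rfl rfl rfl (by norm_num)
      (ht.of_agreeOff (agreeOff_den (setNat 26 (.const 1) (.const 0)) t)).rounds_numN (by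
        intro w hw t' ha' hw'
        refine ⟨?_, fun _ => ?_⟩
        · simp only [den, Test.Holds, NatExpr.eval, hw', ha'.1 5 rfl, ha'.1 10 rfl, e5,
            Finset.mem_sdiff, ← h5, mem_flagged, hw, true_and, not_le]
          omega
        · simp only [den, RealExpr.eval, NatExpr.eval, hw', ha'.2 9 rfl, e9', hr w hw])
    rw [den_seq]
    have hag := agreeOff_den nextCmd t
    set t₁ := nextCmd.den t with ht₁
    change IsArgmin I.n _ _ (t₁.nat 26 1) (t₁.nat 26 0) (t₁.real 26 0) at key
    have b₁ : HasBuckets I Z rep R δ t₁ := by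
      unfold HasBuckets
      rw [hag.1 10 rfl, hag.1 11 rfl, hag.1 12 rfl, hag.2 11 rfl]
      exact hI
    have e10 : t₁.nat 10 = t.nat 10 := hag.1 10 rfl
    rcases key with ⟨k1, k2⟩ | ⟨k1, k2, k3, -, k5⟩
    · rw [den_ite_neg (by simp [k1])]
      simp only [den]
      refine ⟨b₁, Or.inl ?_⟩
      rw [e10]
      refine hI.subset.antisymm fun w hw => ?_
      by_contra hcon
      exact k2 w (Finset.mem_range.1 (hZ hw)) (Finset.mem_sdiff.2 ⟨hw, hcon⟩)
    · rw [den_ite_pos (by simp [k1])]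
      obtain ⟨k3, k4⟩ := Finset.mem_sdiff.1 k3
      obtain ⟨q1, q2⟩ := placeCmd_spec (s := t₁) (z := t₁.nat 26 0) (ht.of_agreeOff hag) hrep
        (by rw [hag.1 9 rfl, e9]) (fun z hz => by rw [hag.2 9 rfl, e9', hr z hz])
        (fun g hg => by rw [hag.2 10 rfl, e10', hδ g hg]) hR hZ b₁ rfl k3 (by rw [e10]; exact k4)
        (by
          rw [e10]
          exact fun w hw => k5 w (Finset.mem_range.1 (hZ (Finset.mem_sdiff.1 hw).1)) hw)
      refine ⟨q1, Or.inr ?_⟩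
      rw [q2, e10, Finset.card_insert_of_notMem k4]
      rcases hcard with hcard | hcard
      · rw [hcard] at k4; exact absurd k3 k4
      · omega)
  obtain ⟨k1, k2⟩ := key
  have hfin : flagged I.n ((bucketCmd.den s).nat 10) = Z := by
    rcases k2 with k2 | k2
    · exact k2
    · have h1 : Finset.card Z ≤ I.n := by simpa using Finset.card_le_card hZ
      exact Finset.eq_of_subset_of_card_le k1.subset (h1.trans k2)
  exact ⟨_, _, by
    have k1 : BucketInv I.n Z rep R δ (flagged I.n ((bucketCmd.den s).nat 10)) _ _ _ := k1
    rw [hfin] at k1; exact k1⟩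

end

/-- The test whether the point in `45` is an outer point in the bucket of the point in `44`. -/
def sameBucketTest : Test :=
  .and (.natLe (.const 1) (.read 5 (var 45)))
    (.and (.natLe (.read 12 (var 45)) (.read 12 (var 44)))
      (.natLe (.read 12 (var 44)) (.read 12 (var 45))))

/-- The mean radius in the bucket of each point. -/
def meanCmd : Cmd :=
  realTable 44 numN 15
    (condSum 45 numN 7 sameBucketTest (.read 9 (var 45)) ;; countLoop 45 numN 6 sameBucketTest)
    (.div (rvar 7) (rvar 6))

theorem meanCmd_spec {R : ℕ → ℝ} (h : HasDist I s) (hr : ∀ z < I.n, s.real 9 z = R z) :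
    ∀ z < I.n, (meanCmd.den s).real 15 z =
      bucketMean (flagged I.n (s.nat 5)) (s.nat 12) R (s.nat 12 z) := by
  refine den_realTable (fun z => bucketMean (flagged I.n (s.nat 5)) (s.nat 12) R (s.nat 12 z))
    rfl rfl h.rounds_numN ?_
  intro z hz t ha hz'
  have ht : HasDist I t := h.of_agreeOff ha
  have hT : ∀ w < I.n, ∀ t' : Memory, t'.nat 45 0 = w → t'.nat 44 0 = z → t'.nat 5 = s.nat 5 →
      t'.nat 12 = s.nat 12 →
      (sameBucketTest.Holds t' ↔ 1 ≤ s.nat 5 w ∧ s.nat 12 w = s.nat 12 z) := by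
    intro w hw t' h1 h2 h3 h4
    simp only [sameBucketTest, Test.Holds, NatExpr.eval, h1, h2, h3, h4, ← le_antisymm_iff]
  set cs := condSum 45 numN 7 sameBucketTest (.read 9 (var 45)) with hcs
  set cc := countLoop 45 numN 6 sameBucketTest with hcc
  have a₁ := agreeOff_den cs t
  have a₂ := agreeOff_den cc (cs.den t)
  have hsum : (cs.den t).real 7 0 = _ := den_condSum (v := 45) (e := numN) (acc := 7)
    (T := sameBucketTest)
    (E := .read 9 (var 45)) (s := t) (N := I.n)
    (fun w => 1 ≤ s.nat 5 w ∧ s.nat 12 w = s.nat 12 z) R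
    (by norm_num) ht.rounds_numN (by
      intro w hw t' ha' hw'
      refine ⟨hT w hw t' hw' (by rw [ha'.1 44 rfl, hz']) (by rw [ha'.1 5 rfl, ha.1 5 rfl])
        (by rw [ha'.1 12 rfl, ha.1 12 rfl]), fun _ => ?_⟩
      simp only [RealExpr.eval, NatExpr.eval, hw', ha'.2 9 rfl, ha.2 9 rfl, hr w hw])
  have hcount : (cc.den (cs.den t)).real 6 0 = _ := den_countLoop (v := 45) (e := numN) (acc := 6)
    (T := sameBucketTest) (s := cs.den t) (N := I.n)
    (fun w => 1 ≤ s.nat 5 w ∧ s.nat 12 w = s.nat 12 z)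
    (by norm_num) (ht.of_agreeOff a₁).rounds_numN (by
      intro w hw t' ha' hw'
      exact hT w hw t' hw' (by rw [ha'.1 44 rfl, a₁.1 44 rfl, hz'])
        (by rw [ha'.1 5 rfl, a₁.1 5 rfl, ha.1 5 rfl])
        (by rw [ha'.1 12 rfl, a₁.1 12 rfl, ha.1 12 rfl]))
  have e7 : (cc.den (cs.den t)).real 7 0 = (cs.den t).real 7 0 := by rw [a₂.2 7 rfl]
  rw [den_seq]
  simp only [RealExpr.eval, NatExpr.eval, e7, hsum, hcount]
  rw [bucketMean, fiber, flagged, Finset.filter_filter]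

end PCentrum
end

noncomputable section
namespace PCentrum
open Cmd

/-! ### The program: images of the points and output -/

variable {I : Inst} {s : Memory}

/-- The images of the points. -/
def imageCmd : Cmd :=
  realTable₂ 35 numN 36 numD 12 4
    (ite (.natLe (.const 1) (.read 5 (var 35)))
      (setReal 13 (.const 0) (.add (.read 1 (.add (.read 4 (.read 8 (var 35))) (var 36)))
        (.mul (.read 15 (var 35)) (.read 8 (.add (.read 4 (.read 9 (var 35))) (var 36))))))
      (setReal 13 (.const 0) (.read 1 (.add (.read 4 (.read 9 (var 35))) (var 36)))))
    (rvar 13)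

theorem imageCmd_spec {V : ℕ → Point I.d} (h : HasDist I s) (h8 : ∀ z < I.n, s.nat 8 z < I.n)
    (h9 : ∀ z < I.n, s.nat 9 z < I.n) (hV : ∀ z < I.n, HasRow s 8 z (V z)) :
    ∀ z < I.n, HasRow (imageCmd.den s) 12 z
      (if 1 ≤ s.nat 5 z then I.x (s.nat 8 z) + s.real 15 z • V (s.nat 9 z) else I.x (s.nat 9 z)) := by
  intro z hz l
  rw [show (imageCmd.den s).real 12 (z * I.d + l) = _ from den_realTable₂ (N := I.n) (M := I.d)
    (fun z l => if hl : l < I.d then (if 1 ≤ s.nat 5 z then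
      I.x (s.nat 8 z) + s.real 15 z • V (s.nat 9 z) else I.x (s.nat 9 z)) ⟨l, hl⟩ else 0)
    rfl rfl rfl rfl (by norm_num) (by norm_num) (by norm_num) h.rounds_numN
    (fun t ha => (h.of_agreeOff ha).rounds_numD) h.mulD ?_ z hz l l.2]
  · simp
  · intro z hz l hl t ha hz' hl'
    have ht : HasDist I t := h.of_agreeOff ha
    have e5 : t.nat 5 = s.nat 5 := ha.1 5 rfl
    have e8 : t.nat 8 = s.nat 8 := ha.1 8 rfl
    have e9 : t.nat 9 = s.nat 9 := ha.1 9 rfl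
    have e15 : t.real 15 = s.real 15 := ha.2 15 rfl
    have r8 := ht.row _ (h8 z hz) ⟨l, hl⟩
    have r9 := ht.row _ (h9 z hz) ⟨l, hl⟩
    have rV := ((hV _ (h9 z hz)).of_agreeOff ha) ⟨l, hl⟩
    have hT : Test.Holds t (.natLe (.const 1) (.read 5 (var 35))) ↔ 1 ≤ s.nat 5 z := by
      simp only [Test.Holds, NatExpr.eval, hz', e5]
    by_cases hif : 1 ≤ s.nat 5 z
    · rw [den_ite_pos (hT.2 hif), dif_pos hl, if_pos hif]
      simp only [den, RealExpr.eval, NatExpr.eval, hz', hl', e8, e9, e15, ht.mulD _ (h8 z hz),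
        ht.mulD _ (h9 z hz), Memory.setReal_real, if_true, Function.update_self, r8, rV]
      simp
    · rw [den_ite_neg fun hh => hif (hT.1 hh), dif_pos hl, if_neg hif]
      simp only [den, RealExpr.eval, NatExpr.eval, hz', hl', e9,
        ht.mulD _ (h9 z hz), Memory.setReal_real, if_true, Function.update_self, r9]

/-- The identity as the image of the points. -/
def copyCmd : Cmd :=
  realTable₂ 35 numN 36 numD 12 4 skip (.read 1 (.add (.read 4 (var 35)) (var 36)))

theorem copyCmd_spec (h : HasMul I s) : ∀ z < I.n, HasRow (copyCmd.den s) 12 z (I.x z) := by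
  intro z hz l
  rw [show (copyCmd.den s).real 12 (z * I.d + l) = _ from den_realTable₂ (N := I.n) (M := I.d)
    (fun z l => if hl : l < I.d then I.x z ⟨l, hl⟩ else 0) rfl rfl rfl rfl (by norm_num)
    (by norm_num) (by norm_num) h.rounds_numN (fun t ha => (h.of_agreeOff ha).rounds_numD) h.mulD
    ?_ z hz l l.2]
  · simp
  · intro z hz l hl t ha hz' hl'
    have ht : HasMul I t := h.of_agreeOff ha
    simp only [den, RealExpr.eval, NatExpr.eval, hz', hl', ht.mulD z hz, hl, dif_pos]
    exact ht.row z hz ⟨l, hl⟩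

/-- The multiset `D` consists of the distinct elements `P 0, …, P (c - 1)` with positive
multiplicities `w 0, …, w (c - 1)`. -/
def Represents {α : Type*} (c : ℕ) (P : ℕ → α) (w : ℕ → ℕ) (D : Multiset α) : Prop :=
  Set.InjOn P (Set.Iio c) ∧ (∀ i < c, 0 < w i) ∧
    D = ∑ i ∈ Finset.range c, Multiset.replicate (w i) (P i)

theorem Represents.cons_old {α : Type*} {c : ℕ} {P : ℕ → α} {w : ℕ → ℕ} {D : Multiset α}
    (h : Represents c P w D) {j : ℕ} (hj : j < c) :
    Represents c P (Function.update w j (w j + 1)) (P j ::ₘ D) := by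
  obtain ⟨h1, h2, h3⟩ := h
  refine ⟨h1, fun i hi => ?_, ?_⟩
  · by_cases hij : i = j
    · subst hij; simp
    · rw [Function.update_of_ne hij]; exact h2 i hi
  · have hmem := Finset.mem_range.2 hj
    rw [h3, ← Finset.add_sum_erase _ _ hmem, ← Finset.add_sum_erase _ _ hmem,
      Function.update_self, Multiset.replicate_succ, Multiset.cons_add]
    congr 2
    refine Finset.sum_congr rfl fun i hi => ?_
    rw [Function.update_of_ne (Finset.ne_of_mem_erase hi)]

theorem Represents.cons_new {α : Type*} {c : ℕ} {P P' : ℕ → α} {w : ℕ → ℕ} {D : Multiset α}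
    (h : Represents c P w D) (hP : ∀ j < c, P' j = P j) (hne : ∀ j < c, P j ≠ P' c) :
    Represents (c + 1) P' (Function.update w c 1) (P' c ::ₘ D) := by
  obtain ⟨h1, h2, h3⟩ := h
  refine ⟨fun i hi j hj hij => ?_, fun i hi => ?_, ?_⟩
  · rcases Nat.lt_succ_iff_lt_or_eq.1 hi with hi | rfl <;>
      rcases Nat.lt_succ_iff_lt_or_eq.1 hj with hj | rfl
    · exact h1 hi hj (by rwa [hP i hi, hP j hj] at hij)
    · rw [hP i hi] at hij; exact absurd hij (hne i hi)
    · rw [hP j hj] at hij; exact absurd hij.symm (hne j hj)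
    · rfl
  · rcases Nat.lt_succ_iff_lt_or_eq.1 hi with hi | rfl
    · rw [Function.update_of_ne hi.ne]; exact h2 i hi
    · simp
  · rw [Finset.sum_range_succ, Function.update_self, Multiset.replicate_one, add_comm,
      Multiset.singleton_add, h3]
    congr 1
    refine Finset.sum_congr rfl fun i hi => ?_
    have hi := Finset.mem_range.1 hi
    rw [Function.update_of_ne hi.ne, hP i hi]

theorem hasRow_outPoint (d : ℕ) (s : Memory) (i : ℕ) : HasRow s 2 i (outPoint d s i) :=
  fun _ => rfl

theorem HasRow.outPoint_eq {d i : ℕ} {P : Point d} (h : HasRow s 2 i P) : outPoint d s i = P := by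
  ext l
  exact h l

/-- Search for the image of the point in `47` in the output. -/
def findCmd : Cmd :=
  argmin 48 (var 1) 27 27 (sqDistCmd 2 48 12 47) (.realLe (rvar 5) (.ofNat (.const 0)))
    (.ofNat (.const 0))

/-- Extension of the output by the image of the point in `47`. -/
def appendCmd : Cmd :=
  for_ 49 numD (setReal 2 (.add (.read 4 (var 1)) (var 49)) (.read 12 (.add (.read 4 (var 47)) (var 49)))) ;;
    setNat 2 (var 1) (.const 1) ;; setNat 1 (.const 0) (.add (var 1) (.const 1))

/-- Output of the images with their multiplicities. -/
def outputCmd : Cmd :=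
  setNat 1 (.const 0) (.const 0) ;;
    for_ 47 numN (findCmd ;; ite (.natLe (.const 1) (.read 27 (.const 1)))
      (setNat 2 (var 27) (.add (.read 2 (var 27)) (.const 1))) appendCmd)

/-- Equality of points is tested as squared distance at most `0`; exact arithmetic makes this valid.
As in the search for leaders, the key is constant. -/
theorem findCmd_spec {Y : Point I.d} {z : ℕ} (h : HasMul I s) (hz : s.nat 47 0 = z) (hzn : z < I.n)
    (hc : outCount s ≤ I.n) (hY : HasRow s 12 z Y) :
    ((findCmd.den s).nat 27 1 = 0 ∧ ∀ j < outCount s, outPoint I.d s j ≠ Y) ∨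
      ((findCmd.den s).nat 27 1 = 1 ∧ (findCmd.den s).nat 27 0 < outCount s ∧
        outPoint I.d s ((findCmd.den s).nat 27 0) = Y) := by
  have key := den_argmin (v := 48) (e := var 1) (B := 27) (R := 27) (c := sqDistCmd 2 48 12 47)
    (T := .realLe (rvar 5) (.ofNat (.const 0))) (K := .ofNat (.const 0)) (s := s)
    (N := outCount s) (fun j => outPoint I.d s j = Y) (fun _ => 0) rfl rfl rfl (by norm_num) (by
      refine (h.of_agreeOff (agreeOff_den (setNat 27 (.const 1) (.const 0)) s)).rounds_of_le ?_ hc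
      simp [den, outCount]) (by
      intro j hj t ha hj'
      refine ⟨?_, fun _ => by simp⟩
      have ht : HasMul I t := h.of_agreeOff ha
      have hsq := den_sqDistCmd (A := 2) (a := 48) (B := 12) (b := 47) ht hj'
        ((congrFun (ha.1 47 rfl) 0).trans hz) (hj.trans_le hc) hzn
        ((hasRow_outPoint I.d s j).of_agreeOff ha) (hY.of_agreeOff ha)
        (by norm_num) (by norm_num) (by norm_num) (by norm_num)
      simp only [Test.Holds, RealExpr.eval, NatExpr.eval, hsq, Nat.cast_zero]
      rw [sq_nonpos_iff, dist_eq_zero])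
  rcases key with ⟨k1, k2⟩ | ⟨k1, k2, k3, -, -⟩
  · exact Or.inl ⟨k1, k2⟩
  · exact Or.inr ⟨k1, k2, k3⟩

theorem appendCmd_spec {Y : Point I.d} {z : ℕ} {D : Multiset (Point I.d)} (h : HasMul I s)
    (hz : s.nat 47 0 = z) (hzn : z < I.n) (hc : outCount s < I.n) (hY : HasRow s 12 z Y)
    (hne : ∀ j < outCount s, outPoint I.d s j ≠ Y) (hD : Outputs s D) :
    outCount (appendCmd.den s) = outCount s + 1 ∧ Outputs (appendCmd.den s) (Y ::ₘ D) := by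
  set c := outCount s with hcs
  set cp := for_ 49 numD (setReal 2 (.add (.read 4 (var 1)) (var 49))
    (.read 12 (.add (.read 4 (var 47)) (var 49)))) with hcp
  have hag := agreeOff_den cp s
  have key := den_for (v := 49) (e := numD) (s := s)
    (P := setReal 2 (.add (.read 4 (var 1)) (var 49)) (.read 12 (.add (.read 4 (var 47)) (var 49))))
    rfl h.rounds_numD
    (fun i t => (∀ j < c, HasRow t 2 j (outPoint I.d s j)) ∧
      ∀ l : Fin I.d, (l : ℕ) < i → t.real 2 (c * I.d + l) = Y l)
    (fun i t j y hh => hh) ⟨fun j _ => hasRow_outPoint I.d s j, by simp⟩ (by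
      intro i hi t ha hi' hI
      have ht : HasMul I t := h.of_agreeOff ha
      have e1 : t.nat 1 0 = c := by rw [ha.1 1 rfl]; rfl
      have e47 : t.nat 47 0 = z := by rw [ha.1 47 rfl, hz]
      have hrow := (hY.of_agreeOff ha) ⟨i, hi⟩
      simp only [den, NatExpr.eval, RealExpr.eval, e1, e47, hi', ht.mulD c hc, ht.mulD z hzn, hrow]
      refine ⟨fun j hj l => ?_, fun l hl => ?_⟩
      · simp only [Memory.setReal_real, if_true]
        rw [Function.update_of_ne]
        · exact hI.1 j hj l
        · intro hh
          have := (mul_add_injective l.2 hi hh).1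
          omega
      · simp only [Memory.setReal_real, if_true]
        rcases Nat.lt_succ_iff_lt_or_eq.1 hl with hlt | heq
        · rw [Function.update_of_ne (by omega)]; exact hI.2 l hlt
        · subst heq
          rw [Function.update_self])
  set t := cp.den s with ht
  have hold : ∀ j < c, outPoint I.d t j = outPoint I.d s j := fun j hj => (key.1 j hj).outPoint_eq
  have hnew : outPoint I.d t c = Y := HasRow.outPoint_eq fun l => key.2 l l.2
  have e1 : t.nat 1 0 = c := by rw [hag.1 1 rfl]; rfl
  have e2 : t.nat 2 = s.nat 2 := hag.1 2 rfl
  have hden : appendCmd.den s = (t.setNat 2 c 1).setNat 1 0 (c + 1) := by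
    simp [appendCmd, den_seq, ← hcp, ← ht, den, e1]
  have hcount : outCount (appendCmd.den s) = c + 1 := by simp [hden, outCount]
  refine ⟨hcount, ?_⟩
  have hrep : Represents c (outPoint I.d s) (outWeight s) D := hD
  have hw : outWeight (appendCmd.den s) = Function.update (outWeight s) c 1 := by
    funext j
    simp only [outWeight, hden, Memory.setNat_nat, e2]
    simp only [OfNat.ofNat_ne_one, if_false, if_true]
    rfl
  have hP : outPoint I.d (appendCmd.den s) = outPoint I.d t := by
    funext j
    simp [outPoint, hden]
  have := hrep.cons_new (P' := outPoint I.d t) hold (by rw [hnew]; exact hne)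
  rw [hnew] at this
  change Represents (outCount _) (outPoint I.d _) (outWeight _) _
  rw [hcount, hw, hP]
  exact this

theorem outputCmd_spec {Y : ℕ → Point I.d} (h : HasMul I s)
    (hY : ∀ z < I.n, HasRow s 12 z (Y z)) :
    Outputs (outputCmd.den s) ((Finset.range I.n).val.map Y) := by
  set s₁ := (setNat 1 (.const 0) (.const 0)).den s with hs₁
  have a₁ := agreeOff_den (setNat 1 (.const 0) (.const 0)) s
  have h₁ : HasMul I s₁ := h.of_agreeOff a₁
  -- The bound `outCount t ≤ i` keeps the output within the table of row starts and the search in it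
  -- within the cut-off of loops.
  refine (den_for (v := 47) (e := numN) (s := s₁)
    (P := findCmd ;; ite (.natLe (.const 1) (.read 27 (.const 1)))
      (setNat 2 (var 27) (.add (.read 2 (var 27)) (.const 1))) appendCmd) rfl h₁.rounds_numN
    (fun i t => outCount t ≤ i ∧ Outputs t ((Finset.range i).val.map Y)) ?_ ?_ ?_).2
  · intro i t j y hh
    have hP : outPoint I.d (t.setNat 47 j y) = outPoint I.d t := rfl
    simpa [Outputs, outCount, outWeight, hP] using hh
  · have : outCount s₁ = 0 := by simp [hs₁, den, outCount]
    refine ⟨this.le, ?_⟩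
    simp [Outputs, this]
  · intro z hz t ha hz' hI
    obtain ⟨hcz, hI⟩ := hI
    have ht : HasMul I t := h₁.of_agreeOff ha
    have hYt : HasRow t 12 z (Y z) := ((hY z hz).of_agreeOff a₁).of_agreeOff ha
    have key := findCmd_spec ht hz' hz (hcz.trans hz.le) hYt
    have hag := agreeOff_den findCmd t
    rw [den_seq]
    set t₁ := findCmd.den t with ht₁
    have c₁ : outCount t₁ = outCount t := by simp only [outCount, hag.1 1 rfl]
    have w₁ : outWeight t₁ = outWeight t := by funext; simp only [outWeight, hag.1 2 rfl]
    have p₁ : outPoint I.d t₁ = outPoint I.d t := by funext; simp only [outPoint, hag.2 2 rfl]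
    have o₁ : Outputs t₁ ((Finset.range z).val.map Y) := by
      unfold Outputs
      rw [c₁, w₁, p₁]; exact hI
    have hsucc : (Finset.range (z + 1)).val.map Y = Y z ::ₘ (Finset.range z).val.map Y := by
      simp [Finset.range_val, Multiset.range_succ]
    rw [hsucc]
    rcases key with ⟨k1, k2⟩ | ⟨k1, k2, k3⟩
    · rw [den_ite_neg (by simp [k1])]
      obtain ⟨q1, q2⟩ := appendCmd_spec (ht.of_agreeOff hag) (by rw [hag.1 47 rfl, hz']) hz
        (by rw [c₁]; omega) (hYt.of_agreeOff hag) (by rw [c₁, p₁]; exact k2) o₁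
      exact ⟨by omega, q2⟩
    · rw [den_ite_pos (by simp [k1])]
      set j := t₁.nat 27 0 with hj
      have hden : (setNat 2 (var 27) (.add (.read 2 (var 27)) (.const 1))).den t₁ =
          t₁.setNat 2 j (t₁.nat 2 j + 1) := rfl
      rw [hden]
      have hrep : Represents (outCount t₁) (outPoint I.d t₁) (outWeight t₁) _ := o₁
      have := hrep.cons_old (j := j) (by rw [c₁]; exact k2)
      rw [p₁, k3, ← p₁] at this
      have hc' : outCount (t₁.setNat 2 j (t₁.nat 2 j + 1)) = outCount t₁ := by simp [outCount]
      refine ⟨by rw [hc', c₁]; omega, ?_⟩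
      have hw' : outWeight (t₁.setNat 2 j (t₁.nat 2 j + 1)) =
          Function.update (outWeight t₁) j (outWeight t₁ j + 1) := by
        funext i
        simp only [outWeight, Memory.setNat_nat, if_true]
        rfl
      change Represents (outCount _) (outPoint I.d _) (outWeight _) _
      rw [hc', hw']
      exact this

end PCentrum
end

noncomputable section
namespace PCentrum
open Cmd

/-! ### The algorithm -/

theorem IsLeaderMap.center_eq {d n : ℕ} {x : ℕ → Point d} {e ρ : ℝ} {Z : Finset ℕ}
    {a rep : ℕ → ℕ} (h : IsLeaderMap n (Related x e ρ Z a) rep) {z : ℕ} (hz : z ∈ Z)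
    (hzn : z < n) : a (rep z) = a z := by
  rcases h.eq_or_rel z hzn with h1 | h1
  · rw [h1]
  · rcases h1 with h1 | h1
    · exact absurd hz h1.2.1
    · exact h1.2.2.1

/-- The number of buckets of a group. -/
theorem BucketInv.card_image_le {d n k : ℕ} {x : ℕ → Point d} {e ρ : ℝ} {Z : Finset ℕ}
    {a rep b cur : ℕ → ℕ} {δ sum : ℕ → ℝ} (h : BucketInv n Z rep (radius x a) δ Z b cur sum)
    (hlead : IsLeaderMap n (Related x e ρ Z a) rep) (hZ : Z ⊆ Finset.range n)
    (hx : Set.InjOn x (Set.Iio n)) (he : 0 < e) (hk : 1 ≤ k)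
    {g : ℕ} (hδ : δ g = e * (∑ z ∈ group Z rep g, radius x a z) / k) :
    (((group Z rep g).image b).card : ℝ) ≤ 1 + 2 * k / e := by
  have hk0 : (0 : ℝ) < k := by exact_mod_cast hk
  have hpos : 0 ≤ 2 * k / e := by positivity
  rcases (group Z rep g).eq_empty_or_nonempty with hemp | ⟨u, hu⟩
  · rw [hemp]; simp; linarith
  have hgn : g < n := by
    obtain ⟨h1, rfl⟩ := Finset.mem_filter.1 hu
    exact hlead.lt u (Finset.mem_range.1 (hZ h1))
  have hG : 0 ≤ ∑ z ∈ group Z rep g, radius x a z :=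
    Finset.sum_nonneg fun z _ => radius_nonneg x a z
  -- If the radii of the group sum to zero, then `δ g = 0` and `card_image_mul_le` says nothing. But
  -- then all points of the group coincide with their common center, and since the data points are
  -- distinct, there is only one.
  rcases hG.eq_or_lt with h0 | h0
  · have hzero := (Finset.sum_eq_zero_iff_of_nonneg fun z _ => radius_nonneg x a z).1 h0.symm
    have hone : (group Z rep g).card ≤ 1 := by
      refine Finset.card_le_one.2 fun v hv w hw => ?_
      have hxv : x v = x (a v) := dist_eq_zero.1 (hzero v hv)
      have hxw : x w = x (a w) := dist_eq_zero.1 (hzero w hw)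
      obtain ⟨hv1, hv2⟩ := Finset.mem_filter.1 hv
      obtain ⟨hw1, hw2⟩ := Finset.mem_filter.1 hw
      have hvn := Finset.mem_range.1 (hZ hv1)
      have hwn := Finset.mem_range.1 (hZ hw1)
      refine hx hvn hwn ?_
      rw [hxv, hxw, ← hlead.center_eq hv1 hvn, ← hlead.center_eq hw1 hwn, hv2, hw2]
    have : (((group Z rep g).image b).card : ℝ) ≤ 1 := by
      exact_mod_cast Finset.card_image_le.trans hone
    linarith
  · have hδ0 : 0 < δ g := by rw [hδ]; positivity
    have h1 := h.card_image_mul_le (radius_nonneg x a) hgn hδ0.le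
    have h2 : δ g + 2 * ∑ z ∈ group Z rep g, radius x a z = (1 + 2 * k / e) * δ g := by
      rw [hδ]; field_simp
    rw [h2] at h1
    exact le_of_mul_le_mul_right h1 hδ0

/-- The images of the points of a large instance. -/
def coresetCmd : Cmd :=
  distCmd ;; setReal 14 (.const 0) (.div (rvar 0) (.ofNat (.const 64))) ;; coverCmd ;;
    searchCmd ;; centerCmd ;; radiusCmd ;; dirCmd ;; leaderCmd ;; budgetCmd ;; bucketCmd ;;
    meanCmd ;; imageCmd

variable {I : Inst} {s : Memory}

theorem coresetCmd_spec (h : HasMul I s) (hk1 : 1 ≤ I.k) (hk : 2 * I.k < I.n) (hp : I.p ≤ I.n)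
    (hp1 : 1 ≤ I.p) (hε : 0 < I.ε) (hx : Set.InjOn I.x (Set.Iio I.n)) :
    ∃ ρ Z S a rep b Y, CoresetData I.x I.n I.k I.p (I.ε / 64) ρ Z S a rep b Y ∧
      ∀ z < I.n, HasRow (coresetCmd.den s) 12 z (Y z) := by
  -- Two distinct data points exclude the zero-dimensional space; hence the space is infinite and
  -- contains sets of `k` centers.
  have hex : ∃ C : Finset (Point I.d), C.card = I.k := by
    have : Nontrivial (Point I.d) := ⟨I.x 0, I.x 1, fun hh =>
      zero_ne_one (hx (Set.mem_Iio.2 (by omega)) (Set.mem_Iio.2 (by omega)) hh)⟩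
    have : Infinite (Point I.d) := Module.Free.infinite ℝ (Point I.d)
    exact Infinite.exists_subset_card_eq (Point I.d) I.k
  simp only [coresetCmd, den_seq]
  have h₀ := hasDist_distCmd h
  generalize distCmd.den s = s₀ at *
  have a₁ := agreeOff_den (setReal 14 (.const 0) (.div (rvar 0) (.ofNat (.const 64)))) s₀
  have e₁ : ((setReal 14 (.const 0) (.div (rvar 0) (.ofNat (.const 64)))).den s₀).real 14 0 =
      I.ε / 64 := by
    simp [den, h₀.eps_eq]
  generalize (setReal 14 (.const 0) (.div (rvar 0) (.ofNat (.const 64)))).den s₀ = s₁ at *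
  have h₁ : HasDist I s₁ := h₀.of_agreeOff a₁
  have a₂ := agreeOff_den coverCmd s₁
  have c₂ := coverCmd_correct h₁ hk1 (by omega) hp hp1 hex
  generalize coverCmd.den s₁ = s₂ at *
  have h₂ : HasDist I s₂ := h₁.of_agreeOff a₂
  have a₃ := agreeOff_den searchCmd s₂
  have c₃ := searchCmd_spec h₂ hk1 hk
  generalize searchCmd.den s₂ = s₃ at *
  have h₃ : HasDist I s₃ := h₂.of_agreeOff a₃
  have a₄ := agreeOff_den centerCmd s₃
  have c₄ := centerCmd_spec h₃ (Finset.card_pos.1 (by rw [c₃.card_eq]; omega))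
  generalize centerCmd.den s₃ = s₄ at *
  have h₄ : HasDist I s₄ := h₃.of_agreeOff a₄
  have a₅ := agreeOff_den radiusCmd s₄
  have hcn : ∀ z < I.n, s₄.nat 8 z < I.n := fun z hz => (mem_flagged.1 (c₄ z hz).1).1
  have c₅ := radiusCmd_spec h₄ hcn
  generalize radiusCmd.den s₄ = s₅ at *
  have h₅ : HasDist I s₅ := h₄.of_agreeOff a₅
  have a₆ := agreeOff_den dirCmd s₅
  have c₆ := dirCmd_spec h₅ (by rw [a₅.1 8 rfl]; exact hcn) (by rw [a₅.1 8 rfl]; exact c₅)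
  rw [a₅.1 8 rfl] at c₆
  generalize dirCmd.den s₅ = s₆ at *
  have h₆ : HasDist I s₆ := h₅.of_agreeOff a₆
  have a₇ := agreeOff_den leaderCmd s₆
  have n8 : s₆.nat 8 = s₄.nat 8 := (a₅.seq a₆).1 8 rfl
  have n5 : s₆.nat 5 = s₂.nat 5 := (a₃.seq (a₄.seq (a₅.seq a₆))).1 5 rfl
  have e₆ : s₆.real 14 0 = I.ε / 64 := by
    rw [(a₂.seq (a₃.seq (a₄.seq (a₅.seq a₆)))).2 14 rfl, e₁]
  have c₇ := leaderCmd_spec h₆ e₆ (ρ := s₂.real 22 0)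
    (by rw [(a₃.seq (a₄.seq (a₅.seq a₆))).2 22 rfl]) (by rw [n8]; exact c₆)
  rw [n8, n5] at c₇
  generalize leaderCmd.den s₆ = s₇ at *
  have h₇ : HasDist I s₇ := h₆.of_agreeOff a₇
  have a₈ := agreeOff_den budgetCmd s₇
  have r₇ : ∀ z < I.n, s₇.real 9 z = radius I.x (s₄.nat 8) z := by
    rw [(a₆.seq a₇).2 9 rfl]; exact c₅
  have c₈ := budgetCmd_spec h₇ (e := I.ε / 64) (by rw [a₇.2 14 rfl]; exact e₆) r₇
  rw [a₇.1 5 rfl, n5] at c₈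
  generalize budgetCmd.den s₇ = s₈ at *
  have h₈ : HasDist I s₈ := h₇.of_agreeOff a₈
  have a₉ := agreeOff_den bucketCmd s₈
  set Z := flagged I.n (s₂.nat 5) with hZdef
  set a := s₄.nat 8 with hadef
  set rep := s₇.nat 9 with hrepdef
  set R := radius I.x a with hRdef
  set δ : ℕ → ℝ := fun g => I.ε / 64 * (∑ z ∈ group Z rep g, R z) / I.k with hδdef
  have hδ0 : ∀ g, 0 ≤ δ g := fun g => div_nonneg (mul_nonneg (by positivity)
    (Finset.sum_nonneg fun z _ => radius_nonneg _ _ z)) (Nat.cast_nonneg _)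
  obtain ⟨cur, sum, c₉⟩ := bucketCmd_spec (Z := Z) (rep := rep) (R := R) (δ := δ) h₈
    (by rw [a₈.1 5 rfl, a₇.1 5 rfl, n5]) (a₈.1 9 rfl) c₇.lt
    (by rw [a₈.2 9 rfl]; exact r₇) c₈ (radius_nonneg _ _) hδ0
  generalize bucketCmd.den s₈ = s₉ at *
  have h₉ : HasDist I s₉ := h₈.of_agreeOff a₉
  have a₁₀ := agreeOff_den meanCmd s₉
  have c₁₀ := meanCmd_spec (R := R) h₉ (by rw [(a₈.seq a₉).2 9 rfl]; exact r₇)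
  rw [(a₇.seq (a₈.seq a₉)).1 5 rfl, n5] at c₁₀
  generalize meanCmd.den s₉ = s₁₀ at *
  have h₁₀ : HasDist I s₁₀ := h₉.of_agreeOff a₁₀
  set b := s₉.nat 12 with hbdef
  have t := a₇.seq (a₈.seq (a₉.seq a₁₀))
  have m8 : s₁₀.nat 8 = a := by rw [t.1 8 rfl, n8]
  have m5 : s₁₀.nat 5 = s₂.nat 5 := by rw [t.1 5 rfl, n5]
  have m9 : s₁₀.nat 9 = rep := (a₈.seq (a₉.seq a₁₀)).1 9 rfl
  have c₁₁ := imageCmd_spec (V := dir I.x a) h₁₀ (by rw [m8]; exact hcn)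
    (by rw [m9]; exact c₇.lt) (fun z hz => (c₆ z hz).of_agreeOff t)
  rw [m8, m5, m9] at c₁₁
  have hZ : Z ⊆ Finset.range I.n := flagged_subset _ _
  refine ⟨s₂.real 22 0, Z, flagged I.n (s₃.nat 6), a, rep, b, _, ?_, c₁₁⟩
  have hlt : ∀ z ∈ Z, z < I.n := fun z hz => Finset.mem_range.1 (hZ hz)
  constructor
  · exact hZ
  · exact c₂.2.1
  · exact c₂.2.2.1.covered
  · exact c₂.1
  · exact c₂.2.2.2
  · exact c₃.card_eq.le
  · exact fun z hz => (c₄ z (hlt z hz)).1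
  -- The constant `8` is the factor `4` of local search times the factor `2` for restricting centers
  -- to data points. Since `Z` has at most `p` points, its distances to `C` sum to at most the cost.
  · intro C hC
    obtain ⟨τ, V, hτ, hV⟩ := exists_isAssignment (x := I.x) hZ (C := C)
      (Finset.card_pos.1 (by omega))
    rw [hC] at hτ
    have h1 : ∑ z ∈ Z, radius I.x a z = medianCost I.x Z (flagged I.n (s₃.nat 6)) :=
      Finset.sum_congr rfl fun z hz => (c₄ z (hlt z hz)).2
    have h2 := c₃.cost_le_four hk1 (by omega) hτ
    have h3 := sum_le_topSumOn hp hp1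
      (f := fun z => Metric.infDist (I.x z) (C : Set (Point I.d)))
      (fun _ => Metric.infDist_nonneg) hZ c₂.2.1
    linarith
  · exact c₇
  · exact fun g => c₉.isBucketing (radius_nonneg _ _) (hδ0 g)
  · exact fun g => c₉.card_image_le c₇ hZ hx (by positivity) hk1 rfl
  · intro z hz
    obtain ⟨hz1, hz2⟩ := Finset.mem_sdiff.1 hz
    rw [if_neg fun hh => hz2 (mem_flagged.2 ⟨Finset.mem_range.1 hz1, hh⟩)]
  · intro z hz
    rw [if_pos (mem_flagged.1 hz).2, c₁₀ z (hlt z hz), ← hZdef, bucketMean, bucketMean,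
      c₉.fiber_group_eq hz]

/-- The algorithm. -/
def mainCmd : Cmd :=
  mulCmd ;; ite (.natLe numN (.add numK numK)) copyCmd coresetCmd ;; outputCmd

theorem hasInput_inputMemory {n d : ℕ} (k p : ℕ) (ε : ℝ) (x : Fin n → Point d) :
    HasInput ⟨d, n, k, p, ε, extend x⟩ (inputMemory k p ε x) where
  n_eq := rfl
  d_eq := rfl
  k_eq := rfl
  p_eq := rfl
  eps_eq := by simp [inputMemory]
  row i hi l := by
    change i < n at hi
    change Fin d at l
    have hlt : i * d + l < n * d := by
      calc i * d + l < i * d + d := by omega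
        _ = (i + 1) * d := by ring
        _ ≤ n * d := Nat.mul_le_mul_right d hi
    have hpair : finProdFinEquiv.symm ⟨i * d + l, hlt⟩ = ((⟨i, hi⟩ : Fin n), l) := by
      rw [Equiv.symm_apply_eq]
      ext
      simp [finProdFinEquiv, mul_comm, add_comm]
    change (if h : i * d + l < n * d then x (finProdFinEquiv.symm ⟨i * d + l, h⟩).1
      (finProdFinEquiv.symm ⟨i * d + l, h⟩).2 else 0) = extend x i l
    rw [dif_pos hlt, hpair, extend_of_lt x hi]

theorem injOn_extend {n d : ℕ} (x : Fin n ↪ Point d) : Set.InjOn (extend x) (Set.Iio n) := by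
  intro i hi j hj hij
  rw [extend_of_lt x hi, extend_of_lt x hj] at hij
  exact congrArg Fin.val (x.injective hij)

/-- On small instances all points are kept. -/
theorem small_size_le {ε : ℝ} (hε : 0 < ε) (hε1 : ε < 1) (d : ℕ) {n k : ℕ} (hk : 1 ≤ k)
    (hn : n ≤ k + k) : (n : ℝ) ≤ (300 : ℝ) ^ (d + 1) * k ^ 2 / ε ^ (d + 1) := by
  have hk' : (1 : ℝ) ≤ k := by exact_mod_cast hk
  have h1 : (n : ℝ) ≤ 2 * k := by exact_mod_cast (by omega : n ≤ 2 * k)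
  have h2 : (2 : ℝ) ≤ 300 ^ (d + 1) := by
    calc (2 : ℝ) ≤ 300 ^ 1 := by norm_num
      _ ≤ 300 ^ (d + 1) := pow_le_pow_right₀ (by norm_num) (by omega)
  have h3 : ε ^ (d + 1) ≤ 1 := pow_le_one₀ hε.le hε1.le
  rw [le_div_iff₀ (by positivity)]
  calc (n : ℝ) * ε ^ (d + 1) ≤ n * 1 := mul_le_mul_of_nonneg_left h3 (Nat.cast_nonneg _)
    _ ≤ 2 * k := by linarith
    _ ≤ 2 * k ^ 2 := by nlinarith
    _ ≤ 300 ^ (d + 1) * k ^ 2 := mul_le_mul_of_nonneg_right h2 (by positivity)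

/-- If `n ≤ 2 * k`, local search with `2 * k` centers is pointless, and keeping all points meets the
size bound. Otherwise the error `42 * (ε / 64)` is below `ε`. -/
theorem mainCmd_spec {d n k p : ℕ} {ε : ℝ} (x : Fin n ↪ Point d) (hk : 1 ≤ k) (hp1 : 1 ≤ p)
    (hp : p ≤ n) (hε : 0 < ε) (hε1 : ε < 1) : ∃ D : Multiset (Point d),
      Outputs (mainCmd.den (inputMemory k p ε x)) D ∧ IsCoreset k p ε (Finset.univ.map x) D ∧
      (coresetSize D : ℝ) ≤ (300 : ℝ) ^ (d + 1) * k ^ 2 / ε ^ (d + 1) := by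
  classical
  set I : Inst := ⟨d, n, k, p, ε, extend x⟩ with hI
  have h₁ : HasMul I (mulCmd.den (inputMemory k p ε x)) :=
    hasMul_mulCmd (hasInput_inputMemory k p ε x)
  have hmain : mainCmd.den (inputMemory k p ε x) = outputCmd.den
      ((ite (.natLe numN (.add numK numK)) copyCmd coresetCmd).den
        (mulCmd.den (inputMemory k p ε x))) := rfl
  rw [hmain]
  set s := mulCmd.den (inputMemory k p ε x)
  have hT : Test.Holds s (.natLe numN (.add numK numK)) ↔ n ≤ k + k := by
    simp only [Test.Holds, NatExpr.eval, h₁.n_eq, h₁.k_eq, hI]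
  by_cases hn : n ≤ k + k
  · rw [den_ite_pos (hT.2 hn)]
    refine ⟨_, outputCmd_spec (I := I) (Y := extend x) (h₁.of_agreeOff (agreeOff_den copyCmd s))
      (copyCmd_spec h₁), isCoreset_of_abs_le x _ fun C hC => ?_, ?_⟩
    · rw [sub_self, abs_zero]
      exact mul_nonneg hε.le (by
        simpa using sum_le_topSumOn hp hp1
          (f := fun z => Metric.infDist (extend x z) (C : Set (Point d)))
          (fun _ => Metric.infDist_nonneg) (Finset.empty_subset _) (Nat.zero_le _))
    · change (coresetSize ((Finset.range n).val.map (extend x)) : ℝ) ≤ _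
      rw [coresetSize_eq]
      refine le_trans ?_ (small_size_le hε hε1 d hk hn)
      exact_mod_cast Finset.card_image_le.trans_eq (Finset.card_range n)
  · rw [den_ite_neg fun hh => hn (hT.1 hh)]
    obtain ⟨ρ, Z, S, a, rep, b, Y, hdata, hrow⟩ := coresetCmd_spec (I := I) h₁ hk
      (show 2 * k < n by omega) hp hp1 hε (injOn_extend x)
    refine ⟨_, outputCmd_spec (I := I) (Y := Y) (h₁.of_agreeOff (agreeOff_den coresetCmd s)) hrow,
      isCoreset_of_abs_le x Y fun C hC => ?_, ?_⟩
    · refine (hdata.abs_cost_sub_le (by positivity) hk hp hp1 hC).trans ?_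
      refine mul_le_mul_of_nonneg_right ?_ ?_
      · change 42 * (ε / 64) ≤ ε
        linarith
      · simpa using sum_le_topSumOn hp hp1
          (f := fun z => Metric.infDist (extend x z) (C : Set (Point d)))
          (fun _ => Metric.infDist_nonneg) (Finset.empty_subset _) (Nat.zero_le _)
    · change (coresetSize ((Finset.range n).val.map Y) : ℝ) ≤ _
      rw [coresetSize_eq]
      exact hdata.size_le hε hε1 hk

end PCentrum
end

/-- There are an absolute constant `c`, one real-RAM program and one polynomial `T` such that on
every instance the program halts after at most `T (n + d)` steps and outputs an `ε`-coreset for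
`k`-facility `p`-centrum with at most `c ^ (d + 1) * k ^ 2 / ε ^ (d + 1)` distinct points. -/
theorem theorem4p2 :
    ∃ (c : ℝ) (A : PCentrum.Prog) (T : Polynomial ℕ),
      ∀ (d n k p : ℕ) (ε : ℝ) (x : Fin n ↪ PCentrum.Point d),
        1 ≤ k → 1 ≤ p → p ≤ n → 0 < ε → ε < 1 →
        ∃ (t : ℕ) (s : PCentrum.Memory) (D : Multiset (PCentrum.Point d)),
          PCentrum.Exec A (PCentrum.inputMemory k p ε x) t s ∧
          t ≤ T.eval (n + d) ∧
          PCentrum.Outputs s D ∧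
          PCentrum.IsCoreset k p ε (Finset.univ.map x) D ∧
          (PCentrum.coresetSize D : ℝ) ≤ c ^ (d + 1) * (k : ℝ) ^ 2 / ε ^ (d + 1) := by
  refine ⟨300, PCentrum.mainCmd.toProg, PCentrum.mainCmd.time, ?_⟩
  intro d n k p ε x hk hp1 hp hε hε1
  obtain ⟨D, h1, h2, h3⟩ := PCentrum.mainCmd_spec x hk hp1 hp hε hε1
  -- That loop bodies respect their counters and that the array `0` is never written is checked by
  -- evaluation on the concrete program.
  obtain ⟨t, ht, hexec⟩ := PCentrum.Cmd.exec_toProg PCentrum.mainCmd rfl rfl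
    (PCentrum.inputMemory k p ε x) (M := n + d) rfl
  exact ⟨t, _, D, hexec, ht, h1, h2, h3⟩
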